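/- A cLD election $(G(N,E),v,d)$ consists of a finite directed graph $G(N,E)$ on a set $N$ of voters together with a voting cost $v(i)\in\mathbb{N}$ and a delegating cost $d(i)\in\mathbb{N}$ for each $i\in N$. A solution is a pair $(C,D)$, where $C\subseteq N$ (the casting voters) and $D\subseteq E$ consists of exactly one outgoing edge of each voter in $N\setminus C$ (and of no other edges). It satisfies the reachability constraint if every $i\in N\setminus C$ has a directed path to a vertex of $C$ using only edges of $D$. It is cost-minimizing if it satisfies the reachability constraint and its cost $\sum_{i\in C}v(i)+\sum_{i\in N\setminus C}d(i)$ is minimal among all solutions that satisfy the reachability constraint. The voting power of $j\in C$ is $|R_j|+1$, where $R_j$ is the set of the voters in $N\setminus C$ that have a directed path to $j$ using edges of $D$. A voter $x$ is the sole super-voter if $x\in C$ and the voting power of $x$ is strictly larger than that of every other voter in $C$. In Control by Adding Voters the input is a cLD election $(G(N,E),v,d)$, integers $\beta\ge 1$ and $k\ge 1$, a partition of $N$ into registered voters $N_r$ and unregistered voters $N_u$, and a voter $x\in N_r$. (The question does not depend on $\beta$.) The question is whether there is a set $A\subseteq N_u$ with $|A|\le k$ such that, in the election induced on $N_r\cup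 A$ (induced subgraph, same costs), $x$ is the sole super-voter under every cost-minimizing solution. Theorem. Restricted to the instances in which every vertex of $G(N,E)$ has out-degree at most $1$, Control by Adding Voters is solvable in polynomial time, that is, by a deterministic algorithm whose running time (on a random access machine with logarithmic cost) is bounded by a polynomial in the size of the input, numbers being written in binary. -/

import Mathlib

/-! ### Elections with voting and delegation costs -/

/-- A delegation graph `G(N, E)` on voters `N` (a finite set of labels of type `V`) with voting
costs `v` and delegating costs `d`. The values of `v` and `d` outside `N` are never used. -/
structure Election (V : Type) where
  N : Finset V
  E : Finset (V × V)
  E_sub : ∀ e ∈ E, e.1 ∈ N ∧ e.2 ∈ N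
  v : V → ℕ
  d : V → ℕ

namespace Election

variable {V : Type} [DecidableEq V]

/-- The number of edges leaving `i`. -/
def outDegree (G : Election V) (i : V) : ℕ :=
  (G.E.filter (fun e => e.1 = i)).card

/-- The maximum out-degree `Δ` of the delegation graph. -/
def maxOutDegree (G : Election V) : ℕ :=
  G.N.sup G.outDegree

/-- The election in which only the voters in `S` take part (induced subgraph, same costs). -/
def restrict (G : Election V) (S : Finset V) : Election V where
  N := G.N ∩ S
  E := G.E.filter (fun e => e.1 ∈ S ∧ e.2 ∈ S)
  E_sub := by
    intro e he
    rw [Finset.mem_filter] at he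
    have h := G.E_sub e he.1
    exact ⟨Finset.mem_inter.2 ⟨h.1, he.2.1⟩, Finset.mem_inter.2 ⟨h.2, he.2.2⟩⟩
  v := G.v
  d := G.d

/-- `(C, D)` is a solution: `C ⊆ N` is the set of casting voters, and `D ⊆ E` consists of exactly
one outgoing edge for every voter of `N` not in `C`. -/
structure IsSolution (G : Election V) (C : Finset V) (D : Finset (V × V)) : Prop where
  C_sub : C ⊆ G.N
  D_sub : D ⊆ G.E
  source_notMem : ∀ e ∈ D, e.1 ∉ C
  existsUnique : ∀ i ∈ G.N, i ∉ C → ∃! j, (i, j) ∈ D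

/-- The existence of a directed path (possibly of length zero) from `i` to `j` with edges in `D`. -/
def HasPath (D : Finset (V × V)) (i j : V) : Prop :=
  Relation.ReflTransGen (fun a b => (a, b) ∈ D) i j

/-- The reachability constraint: every delegating voter has a `D`-path to a casting voter. -/
def Reachability (G : Election V) (C : Finset V) (D : Finset (V × V)) : Prop :=
  ∀ i ∈ G.N, i ∉ C → ∃ j ∈ C, HasPath D i j

/-- The total cost of a solution with casting voters `C`. -/
def cost (G : Election V) (C : Finset V) : ℕ :=
  ∑ i ∈ C, G.v i + ∑ i ∈ G.N \ C, G.d i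

/-- A solution satisfying the reachability constraint. -/
def IsFeasible (G : Election V) (C : Finset V) (D : Finset (V × V)) : Prop :=
  G.IsSolution C D ∧ G.Reachability C D

/-- A feasible solution whose cost is minimal among all feasible solutions. -/
def IsCostMinimizing (G : Election V) (C : Finset V) (D : Finset (V × V)) : Prop :=
  G.IsFeasible C D ∧ ∀ C' D', G.IsFeasible C' D' → G.cost C ≤ G.cost C'

open Classical in
/-- The set `R_j` of the delegating voters that have a `D`-path to `j`. -/
noncomputable def represented (G : Election V) (C : Finset V) (D : Finset (V × V)) (j : V) :
    Finset V :=
  (G.N \ C).filter (fun i => HasPath D i j)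

/-- The voting power `|R_j| + 1` of a casting voter `j`. -/
noncomputable def power (G : Election V) (C : Finset V) (D : Finset (V × V)) (j : V) : ℕ :=
  (G.represented C D j).card + 1

/-- `x` is the sole super-voter: a casting voter whose voting power is strictly larger than that of
every other casting voter. -/
def IsSoleSuperVoter (G : Election V) (C : Finset V) (D : Finset (V × V)) (x : V) : Prop :=
  x ∈ C ∧ ∀ j ∈ C, j ≠ x → G.power C D j < G.power C D x

end Election

/-! ### Control by Adding Voters -/

/-- An instance of Control by Adding Voters. The voters are `0, …, n - 1`, and the unregistered
voters are those that are not in `registered`. The budget `β` is part of the input. -/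
structure CAVInstance where
  n : ℕ
  G : Election (Fin n)
  N_eq : G.N = Finset.univ
  β : ℕ
  β_pos : 0 < β
  k : ℕ
  k_pos : 0 < k
  registered : Finset (Fin n)
  x : Fin n
  x_mem : x ∈ registered

namespace CAVInstance

/-- The set of unregistered voters. -/
def unregistered (I : CAVInstance) : Finset (Fin I.n) := I.registeredᶜ

/-- The question: can at most `k` unregistered voters be added so that, in the resulting election,
`x` is the sole super-voter under every cost-minimizing solution satisfying the reachability
constraint? -/
def IsYes (I : CAVInstance) : Prop :=
  ∃ A ⊆ I.unregistered, A.card ≤ I.k ∧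
    ∀ C D, (I.G.restrict (I.registered ∪ A)).IsCostMinimizing C D →
      (I.G.restrict (I.registered ∪ A)).IsSoleSuperVoter C D I.x

/-- The input list: `n`, `x`, `k`, `β`, the indicator of the registered voters, the voting costs,
the delegating costs, and the adjacency matrix row by row. -/
def encode (I : CAVInstance) : List ℕ :=
  [I.n, (I.x : ℕ), I.k, I.β]
    ++ List.ofFn (fun i => if i ∈ I.registered then 1 else 0)
    ++ List.ofFn I.G.v
    ++ List.ofFn I.G.d
    ++ (List.ofFn (fun i => List.ofFn (fun j => if (i, j) ∈ I.G.E then 1 else 0))).flatten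

end CAVInstance

/-! ### Polynomial time on random access machines with logarithmic cost -/

namespace RAM

/-- The memory: cell `i` of bank `a` holds the natural number `s a i`. A program refers to
finitely many banks only, since banks (unlike cells) are not addressed indirectly. -/
abbrev State : Type := ℕ → ℕ → ℕ

/-- Arithmetic expressions; `read a e` is the content of the cell of bank `a` with address `e`. -/
inductive Expr : Type
  | lit (m : ℕ) : Expr
  | read (a : ℕ) (e : Expr) : Expr
  | add (e f : Expr) : Expr
  | sub (e f : Expr) : Expr
  | mul (e f : Expr) : Expr

/-- The value of an expression (subtraction is truncated at zero). -/
def Expr.eval (s : State) : Expr → ℕ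
  | .lit m => m
  | .read a e => s a (e.eval s)
  | .add e f => e.eval s + f.eval s
  | .sub e f => e.eval s - f.eval s
  | .mul e f => e.eval s * f.eval s

/-- The logarithmic cost of evaluating an expression: every operation costs one plus the
binary length of its result, and addresses and operands are paid for by the subexpressions. -/
def Expr.cost (s : State) : Expr → ℕ
  | .lit m => Nat.size m + 1
  | .read a e => e.cost s + Nat.size (s a (e.eval s)) + 1
  | .add e f => e.cost s + f.cost s + Nat.size (e.eval s + f.eval s) + 1
  | .sub e f => e.cost s + f.cost s + Nat.size (e.eval s - f.eval s) + 1
  | .mul e f => e.cost s + f.cost s + Nat.size (e.eval s * f.eval s) + 1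

/-- Programs: `write a e f` stores the value of `f` in the cell of bank `a` with address `e`;
`cond e c₁ c₂` runs `c₁` if `e` is nonzero and `c₂` otherwise; `loop e c` repeats `c` as long as
`e` is nonzero. -/
inductive Program : Type
  | skip : Program
  | write (a : ℕ) (e f : Expr) : Program
  | seq (c₁ c₂ : Program) : Program
  | cond (e : Expr) (c₁ c₂ : Program) : Program
  | loop (e : Expr) (c : Program) : Program

/-- The memory after storing `m` in cell `i` of bank `a`. -/
def State.update (s : State) (a i m : ℕ) : State :=
  Function.update s a (Function.update (s a) i m)

/-- `c.Runs s s' t`: the program `c`, started in memory `s`, halts in memory `s'` in time `t`. -/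
inductive Program.Runs : Program → State → State → ℕ → Prop
  | skip (s : State) : Runs .skip s s 1
  | write (a : ℕ) (e f : Expr) (s : State) :
      Runs (.write a e f) s (s.update a (e.eval s) (f.eval s)) (e.cost s + f.cost s + 1)
  | seq {c₁ c₂ : Program} {s s' s'' : State} {t₁ t₂ : ℕ} :
      Runs c₁ s s' t₁ → Runs c₂ s' s'' t₂ → Runs (.seq c₁ c₂) s s'' (t₁ + t₂)
  | cond_true {e : Expr} {c₁ c₂ : Program} {s s' : State} {t : ℕ} :
      e.eval s ≠ 0 → Runs c₁ s s' t → Runs (.cond e c₁ c₂) s s' (e.cost s + t + 1)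
  | cond_false {e : Expr} {c₁ c₂ : Program} {s s' : State} {t : ℕ} :
      e.eval s = 0 → Runs c₂ s s' t → Runs (.cond e c₁ c₂) s s' (e.cost s + t + 1)
  | loop_true {e : Expr} {c : Program} {s s' s'' : State} {t₁ t₂ : ℕ} :
      e.eval s ≠ 0 → Runs c s s' t₁ → Runs (.loop e c) s' s'' t₂ →
        Runs (.loop e c) s s'' (e.cost s + t₁ + t₂ + 1)
  | loop_false {e : Expr} {c : Program} {s : State} :
      e.eval s = 0 → Runs (.loop e c) s s (e.cost s + 1)

/-- The initial memory: the input list in bank `0`, its length in cell `0` of bank `1`, and zeros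
everywhere else. -/
def initial (l : List ℕ) : State := fun a i =>
  if a = 0 then l.getD i 0 else if a = 1 ∧ i = 0 then l.length else 0

/-- The size of an input: the total binary length of its entries, plus one per entry. -/
def inputSize (l : List ℕ) : ℕ := (l.map (fun m => Nat.size m + 1)).sum

/-- The decision problem `question`, restricted to the inputs in `domain`, is solvable in
polynomial time: one program halts on every such input within a number of steps (logarithmic
cost) polynomial in the size of the encoded input, and leaves in cell `0` of bank `2` the answer
`1` on the yes-instances and `0` on the no-instances. -/
def SolvableInPolyTime {α : Type} (encode : α → List ℕ) (domain : Set α) (question : α → Prop) :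
    Prop :=
  ∃ (c : Program) (p : Polynomial ℕ), ∀ I ∈ domain, ∃ (s : State) (t : ℕ),
    c.Runs (initial (encode I)) s t ∧ t ≤ p.eval (inputSize (encode I)) ∧
      (question I → s 2 0 = 1) ∧ (¬ question I → s 2 0 = 0)

end RAM

/-! With out-degree at most one, the edges of a solution are determined by its casting set `C`, and
feasibility says that every voter reaches `C`. Optimal sets can then be compared by inserting,
erasing or exchanging single voters. This turns the quantification over all cost-minimizing
solutions into an explicit condition (`Election.forall_isSoleSuperVoter_iff`). The voter `x` casts
in all of them iff voting is cheaper for it than delegating, or it has no out-neighbour, or it lies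
on a cycle and exchanging it for any other voter of the cycle raises the cost. If so, its power is
at least the size of `support` (voters whose path to `x` consists of strict delegators), and any
other casting voter `j` has power at most the size of `backing` (ties are allowed to delegate).
Conversely, for each `j` outside the support, ties can be broken so that `x` has only its support
while some rival has at least the backing of `j`.

For control (`Election.control_iff`), only added voters that enter the support matter. The support
is closed under the edges leaving its members other than `x`, so a path to a rival never meets it.
Hence the backing of a rival is its backing among the registered voters. It remains to guess the
intended power `t` and whether the cycle through `x` is used (`μ`), and to find a set `R` of at
least `t` voters, connected to `x` along strict delegations, with at most `k` unregistered members
and containing all voters that must join. If the cycle is not used and `x` does not strictly prefer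
to vote, the out-neighbour of `x` has to stay away.

Giving forced voters an additional weight `n + 1` (`subset_and_le_card_iff`) leaves a maximum weight
rooted subtree problem with a budget of at most `n`, solved by a knapsack recursion over the
children (`le_bestSubtree_iff`).

Every intermediate value, including each running maximum of the knapsack, is a cell of a table with
at most seven indices in `0, …, n`, and a fixed decision tree computes it from lexicographically
earlier cells. Nested loops fill the tables. The values stored are never products, so cell lengths
grow only by a polynomial in `n`; this additive bound is what makes `PolyTime` stable under
composition and loops. -/

namespace RAM

/-! ### Functions computed by programs in polynomial time -/

theorem size_add_le (a b : ℕ) {z w : ℕ} (ha : Nat.size a ≤ z) (hb : Nat.size b ≤ w) :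
    Nat.size (a + b) ≤ max z w + 1 := by
  rw [Nat.size_le] at *
  have h1 : 2 ^ z ≤ 2 ^ max z w := Nat.pow_le_pow_right (by norm_num) (le_max_left _ _)
  have h2 : 2 ^ w ≤ 2 ^ max z w := Nat.pow_le_pow_right (by norm_num) (le_max_right _ _)
  rw [pow_succ]
  omega

theorem size_mul_le (a b : ℕ) : Nat.size (a * b) ≤ Nat.size a + Nat.size b := by
  rw [Nat.size_le, pow_add]
  exact Nat.mul_lt_mul'' (Nat.lt_size_self a) (Nat.lt_size_self b)

/-- All cells hold numbers of binary length at most `z`. -/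
def Bounded (s : State) (z : ℕ) : Prop := ∀ a i, Nat.size (s a i) ≤ z

theorem Bounded.mono {s : State} {z w : ℕ} (h : Bounded s z) (hzw : z ≤ w) : Bounded s w :=
  fun a i => (h a i).trans hzw

theorem Bounded.update {s : State} {z : ℕ} (h : Bounded s z) {m : ℕ} (hm : Nat.size m ≤ z)
    (a i : ℕ) : Bounded (s.update a i m) z := by
  intro b j
  unfold State.update
  by_cases hb : b = a
  · subst hb
    rw [Function.update_self]
    by_cases hj : j = i
    · subst hj; rwa [Function.update_self]
    · rw [Function.update_of_ne hj]; exact h b j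
  · rw [Function.update_of_ne hb]; exact h b j

/-- An expression is a fixed finite term, so products only multiply lengths by a constant. This
suffices for addresses and conditions, whose values are not stored. -/
theorem Expr.size_cost_le (e : Expr) : ∃ k, ∀ s z, Bounded s z →
    Nat.size (e.eval s) ≤ k * (z + 1) ∧ e.cost s ≤ k * (z + 1) := by
  induction e with
  | lit m =>
    refine ⟨Nat.size m + 1, fun s z _ => ?_⟩
    simp only [Expr.eval, Expr.cost]
    constructor <;> nlinarith [Nat.zero_le (Nat.size m)]
  | read a e ih =>
    obtain ⟨k, hk⟩ := ih
    refine ⟨k + 1, fun s z hs => ?_⟩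
    obtain ⟨-, h2⟩ := hk s z hs
    have h3 := hs a (e.eval s)
    simp only [Expr.eval, Expr.cost]
    constructor <;> nlinarith
  | add e f ih1 ih2 =>
    obtain ⟨k, hk⟩ := ih1
    obtain ⟨l, hl⟩ := ih2
    refine ⟨2 * k + 2 * l + 2, fun s z hs => ?_⟩
    obtain ⟨h1, h2⟩ := hk s z hs
    obtain ⟨h3, h4⟩ := hl s z hs
    have h5 := size_add_le _ _ h1 h3
    have h6 : max (k * (z + 1)) (l * (z + 1)) ≤ k * (z + 1) + l * (z + 1) := by
      apply max_le <;> omega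
    simp only [Expr.eval, Expr.cost]
    constructor <;> nlinarith
  | sub e f ih1 ih2 =>
    obtain ⟨k, hk⟩ := ih1
    obtain ⟨l, hl⟩ := ih2
    refine ⟨2 * k + l + 1, fun s z hs => ?_⟩
    obtain ⟨h1, h2⟩ := hk s z hs
    obtain ⟨h3, h4⟩ := hl s z hs
    have h5 : Nat.size (e.eval s - f.eval s) ≤ Nat.size (e.eval s) :=
      Nat.size_le_size (Nat.sub_le _ _)
    simp only [Expr.eval, Expr.cost]
    constructor <;> nlinarith
  | mul e f ih1 ih2 =>
    obtain ⟨k, hk⟩ := ih1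
    obtain ⟨l, hl⟩ := ih2
    refine ⟨2 * k + 2 * l + 1, fun s z hs => ?_⟩
    obtain ⟨h1, h2⟩ := hk s z hs
    obtain ⟨h3, h4⟩ := hl s z hs
    have h5 := size_mul_le (e.eval s) (f.eval s)
    simp only [Expr.eval, Expr.cost]
    constructor <;> nlinarith

/-- `φ` is the value of an arithmetic expression. -/
def IsExpr (φ : State → ℕ) : Prop := ∃ e : Expr, ∀ s, e.eval s = φ s

namespace IsExpr

variable {φ ψ : State → ℕ}

theorem lit (m : ℕ) : IsExpr (fun _ => m) := ⟨.lit m, fun _ => rfl⟩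

theorem read (a : ℕ) (h : IsExpr φ) : IsExpr (fun s => s a (φ s)) := by
  obtain ⟨e, he⟩ := h
  exact ⟨.read a e, fun s => by simp [Expr.eval, he]⟩

theorem add (h : IsExpr φ) (h' : IsExpr ψ) : IsExpr (fun s => φ s + ψ s) := by
  obtain ⟨e, he⟩ := h
  obtain ⟨f, hf⟩ := h'
  exact ⟨.add e f, fun s => by simp [Expr.eval, he, hf]⟩

theorem sub (h : IsExpr φ) (h' : IsExpr ψ) : IsExpr (fun s => φ s - ψ s) := by
  obtain ⟨e, he⟩ := h
  obtain ⟨f, hf⟩ := h'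
  exact ⟨.sub e f, fun s => by simp [Expr.eval, he, hf]⟩

theorem mul (h : IsExpr φ) (h' : IsExpr ψ) : IsExpr (fun s => φ s * ψ s) := by
  obtain ⟨e, he⟩ := h
  obtain ⟨f, hf⟩ := h'
  exact ⟨.mul e f, fun s => by simp [Expr.eval, he, hf]⟩

end IsExpr

/-- `φ` is the value of an arithmetic expression whose binary length exceeds that of the memory
cells by a constant at most. -/
def IsLin (φ : State → ℕ) : Prop :=
  IsExpr φ ∧ ∃ k, ∀ s z, Bounded s z → Nat.size (φ s) ≤ z + k

namespace IsLin

variable {φ ψ : State → ℕ}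

theorem lit (m : ℕ) : IsLin (fun _ => m) := ⟨.lit m, Nat.size m, fun _ _ _ => Nat.le_add_left _ _⟩

theorem read (a : ℕ) (h : IsExpr φ) : IsLin (fun s => s a (φ s)) :=
  ⟨h.read a, 0, fun _ _ hs => hs _ _⟩

theorem add (h : IsLin φ) (h' : IsLin ψ) : IsLin (fun s => φ s + ψ s) := by
  obtain ⟨h1, k, hk⟩ := h
  obtain ⟨h2, l, hl⟩ := h'
  refine ⟨h1.add h2, max k l + 1, fun s z hs => ?_⟩
  have := size_add_le _ _ (hk s z hs) (hl s z hs)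
  refine this.trans ?_
  omega

end IsLin

/-- Some program realizes `f` in time polynomial in the content of cell `0` of bank `0` and in
the binary length of the cells, without changing bank `0`. -/
def PolyTime (f : State → State) : Prop :=
  ∃ (c : Program) (Q : Polynomial ℕ), ∀ s z, Bounded s z →
    f s 0 = s 0 ∧ Bounded (f s) (z + Q.eval (s 0 0)) ∧
      ∃ t, c.Runs s (f s) t ∧ t ≤ Q.eval (s 0 0) * (z + 1)

theorem State.update_bank_ne (s : State) {a b : ℕ} (h : b ≠ a) (i m : ℕ) :
    s.update a i m b = s b := by
  unfold State.update; rw [Function.update_of_ne h]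

theorem State.update_same (s : State) (a i m : ℕ) : s.update a i m a i = m := by
  unfold State.update; simp

theorem State.update_cell_ne (s : State) (a : ℕ) {i j : ℕ} (h : j ≠ i) (m : ℕ) :
    s.update a i m a j = s a j := by
  unfold State.update; simp [h]

namespace PolyTime

variable {f g : State → State}

/-- The growth of the cells is additive and depends only on `s 0 0`, which `f` preserves. So `g`
starts with the length bound `z + Q`, and the mixed term `Q' * Q` pays for this. -/
theorem comp (hg : PolyTime g) (hf : PolyTime f) : PolyTime (fun s => g (f s)) := by
  obtain ⟨c, Q, hc⟩ := hf
  obtain ⟨c', Q', hc'⟩ := hg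
  refine ⟨.seq c c', Q + Q' + Q' * Q, fun s z hs => ?_⟩
  obtain ⟨h0, hB, t, ht, htl⟩ := hc s z hs
  obtain ⟨h0', hB', t', ht', htl'⟩ := hc' _ _ hB
  have h00 : f s 0 0 = s 0 0 := by rw [h0]
  rw [h00] at hB' htl'
  refine ⟨h0'.trans h0, hB'.mono ?_, t + t', .seq ht ht', ?_⟩
  · simp only [Polynomial.eval_add, Polynomial.eval_mul]
    have := Nat.zero_le (Q'.eval (s 0 0) * Q.eval (s 0 0))
    omega
  · simp only [Polynomial.eval_add, Polynomial.eval_mul]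
    calc t + t' ≤ Q.eval (s 0 0) * (z + 1) + Q'.eval (s 0 0) * (z + Q.eval (s 0 0) + 1) := by omega
      _ ≤ (Q.eval (s 0 0) + Q'.eval (s 0 0) + Q'.eval (s 0 0) * Q.eval (s 0 0)) * (z + 1) := by
        nlinarith [Nat.zero_le (Q'.eval (s 0 0) * Q.eval (s 0 0) * z)]

/-- Only the stored value has to be `IsLin`. Storing products could double the length in each round
of a loop. -/
theorem write {a : ℕ} (ha : a ≠ 0) {α φ : State → ℕ} (hα : IsExpr α) (hφ : IsLin φ) :
    PolyTime (fun s => s.update a (α s) (φ s)) := by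
  obtain ⟨e, he⟩ := hα
  obtain ⟨⟨e', he'⟩, k, hk⟩ := hφ
  obtain ⟨l, hl⟩ := e.size_cost_le
  obtain ⟨l', hl'⟩ := e'.size_cost_le
  refine ⟨.write a e e', Polynomial.C (k + l + l' + 1), fun s z hs => ?_⟩
  simp only [Polynomial.eval_C]
  refine ⟨s.update_bank_ne ha.symm _ _,
    (hs.mono (by omega)).update ((hk s z hs).trans (by omega)) _ _,
    e.cost s + e'.cost s + 1, ?_, ?_⟩
  · rw [← he, ← he']; exact .write a e e' s
  · have h1 := (hl s z hs).2
    have h2 := (hl' s z hs).2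
    nlinarith

theorem ite {g : State → ℕ} {f₁ f₂ : State → State} (hg : IsExpr g) (h₁ : PolyTime f₁)
    (h₂ : PolyTime f₂) : PolyTime (fun s => if g s ≠ 0 then f₁ s else f₂ s) := by
  obtain ⟨e, he⟩ := hg
  obtain ⟨c₁, Q₁, hc₁⟩ := h₁
  obtain ⟨c₂, Q₂, hc₂⟩ := h₂
  obtain ⟨l, hl⟩ := e.size_cost_le
  refine ⟨.cond e c₁ c₂, Q₁ + Q₂ + Polynomial.C (l + 1), fun s z hs => ?_⟩
  have h1 := (hl s z hs).2
  simp only [Polynomial.eval_add, Polynomial.eval_C]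
  by_cases hgs : g s = 0
  · obtain ⟨h0, hB, t, ht, htl⟩ := hc₂ s z hs
    simp only [hgs, ne_eq, not_true_eq_false, if_false]
    refine ⟨h0, hB.mono (by omega), _, .cond_false (by rw [he, hgs]) ht, ?_⟩
    nlinarith [Nat.zero_le (Q₁.eval (s 0 0) * (z + 1))]
  · obtain ⟨h0, hB, t, ht, htl⟩ := hc₁ s z hs
    simp only [hgs, ne_eq, not_false_eq_true, if_true]
    refine ⟨h0, hB.mono (by omega), _, .cond_true (by rwa [he]) ht, ?_⟩
    nlinarith [Nat.zero_le (Q₂.eval (s 0 0) * (z + 1))]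

end PolyTime

/-- Run `f` for the values `0, …, n` of the counter in cell `0` of bank `a`, where `n` is the
content of cell `0` of bank `0`. -/
def forLoop (a : ℕ) (f : State → State) (s : State) : State :=
  (fun s => (f s).update a 0 (f s a 0 + 1))^[s 0 0 + 1] (s.update a 0 0)

theorem forLoop_induction {a : ℕ} (ha : a ≠ 0) {f : State → State} (J : ℕ → State → Prop)
    {s : State} (h0 : J 0 (s.update a 0 0))
    (hstep : ∀ i ≤ s 0 0, ∀ s', s' a 0 = i → s' 0 = s 0 → J i s' →
      f s' a 0 = i ∧ f s' 0 = s 0 ∧ J (i + 1) ((f s').update a 0 (i + 1))) :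
    J (s 0 0 + 1) (forLoop a f s) := by
  have key : ∀ i ≤ s 0 0 + 1,
      let s' := (fun s => (f s).update a 0 (f s a 0 + 1))^[i] (s.update a 0 0)
      s' a 0 = i ∧ s' 0 = s 0 ∧ J i s' := by
    intro i
    induction i with
    | zero =>
      intro _
      exact ⟨State.update_same _ _ _ _, State.update_bank_ne _ ha.symm _ _, h0⟩
    | succ i ih =>
      intro hi
      obtain ⟨h1, h2, h3⟩ := ih (by omega)
      obtain ⟨h4, h5, h6⟩ := hstep i (by omega) _ h1 h2 h3
      simp only [Function.iterate_succ_apply']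
      rw [h4]
      exact ⟨State.update_same _ _ _ _, (State.update_bank_ne _ ha.symm _ _).trans h5, h6⟩
  exact (key _ le_rfl).2.2

theorem PolyTime.forLoop {a : ℕ} (ha : a ≠ 0) {f : State → State} (hf : PolyTime f)
    (hfa : ∀ s, f s a = s a) : PolyTime (forLoop a f) := by
  have hstep : PolyTime (fun s => (f s).update a 0 (f s a 0 + 1)) :=
    (PolyTime.write ha (.lit 0) ((IsLin.read a (.lit 0)).add (.lit 1))).comp hf
  have hinit : PolyTime (fun s => s.update a 0 0) := PolyTime.write ha (.lit 0) (.lit 0)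
  obtain ⟨c, Q, hc⟩ := hstep
  set g : State → State := fun s => (f s).update a 0 (f s a 0 + 1) with hg
  -- Truncated subtraction: zero exactly when the counter has passed `n`.
  let e : Expr := .sub (.add (.read 0 (.lit 0)) (.lit 1)) (.read a (.lit 0))
  obtain ⟨l, hl⟩ := e.size_cost_le
  have hloop : ∀ m s z, Bounded s z → m + s a 0 = s 0 0 + 1 →
      (g^[m] s) 0 = s 0 ∧ Bounded (g^[m] s) (z + m * Q.eval (s 0 0)) ∧
        ∃ t, (Program.loop e c).Runs s (g^[m] s) t ∧
          t ≤ (m + 1) * ((Q.eval (s 0 0) + l + 1) * (z + m * Q.eval (s 0 0) + 1)) := by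
    intro m
    induction m with
    | zero =>
      intro s z hs hm
      refine ⟨rfl, by simpa using hs, _, .loop_false ?_, ?_⟩
      · simp only [e, Expr.eval]; omega
      · have := (hl s z hs).2
        nlinarith [Nat.zero_le (Q.eval (s 0 0) * (z + 1))]
    | succ m ih =>
      intro s z hs hm
      obtain ⟨h0, hB, t, ht, htl⟩ := hc s z hs
      have h00 : g s 0 0 = s 0 0 := by rw [h0]
      have hga : g s a 0 = s a 0 + 1 := by
        simp only [hg, State.update_same, hfa]
      obtain ⟨h0', hB', t', ht', htl'⟩ := ih (g s) _ hB (by rw [hga, h00]; omega)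
      rw [h00] at hB' htl'
      rw [Function.iterate_succ_apply]
      refine ⟨h0'.trans h0, hB'.mono (by rw [Nat.succ_mul]; omega), _,
        .loop_true ?_ ht ht', ?_⟩
      · simp only [e, Expr.eval]; omega
      · have h1 := (hl s z hs).2
        generalize Q.eval (s 0 0) = q at *
        have h2 : z + q + m * q + 1 = z + (m + 1) * q + 1 := by ring
        rw [h2] at htl'
        have h3 : Expr.cost s e + t + 1 ≤ (q + l + 1) * (z + (m + 1) * q + 1) := by
          have h4 : (q + l + 1) * (z + 1) ≤ (q + l + 1) * (z + (m + 1) * q + 1) :=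
            Nat.mul_le_mul_left _ (by omega)
          nlinarith
        calc _ ≤ (q + l + 1) * (z + (m + 1) * q + 1) +
            (m + 1) * ((q + l + 1) * (z + (m + 1) * q + 1)) := by omega
          _ = _ := by ring
  -- `PolyTime` speaks about all states, whereas the number of rounds is known only for a given
  -- counter. The test for a zero counter makes the statement total; after `hinit` it always
  -- succeeds.
  have hrest : PolyTime (fun s => if s a 0 = 0 then g^[s 0 0 + 1] s else s) := by
    refine ⟨.cond (.read a (.lit 0)) .skip (.loop e c),
      Polynomial.C 4 + (.X + 1) * Q + (.X + 2) * ((Q + Polynomial.C (l + 1)) *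
        (1 + (.X + 1) * Q)), fun s z hs => ?_⟩
    simp only [Polynomial.eval_add, Polynomial.eval_mul, Polynomial.eval_C, Polynomial.eval_X,
      Polynomial.eval_one, Polynomial.eval_ofNat]
    have hcost : (Expr.read a (.lit 0)).cost s ≤ z + 2 := by
      have := hs a 0
      simp only [Expr.cost, Expr.eval, Nat.size_zero]
      omega
    by_cases h : s a 0 = 0
    · obtain ⟨h0, hB, t, ht, htl⟩ := hloop (s 0 0 + 1) s z hs (by omega)
      simp only [h, if_true]
      refine ⟨h0, hB.mono ?_, _, .cond_false (by simpa [Expr.eval] using h) ht, ?_⟩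
      · omega
      · generalize Q.eval (s 0 0) = q at *
        generalize s 0 0 = n at *
        have h1 : z + (n + 1) * q + 1 ≤ (1 + (n + 1) * q) * (z + 1) := by
          nlinarith [Nat.zero_le ((n + 1) * q * z)]
        have h2 : (n + 1 + 1) * ((q + l + 1) * (z + (n + 1) * q + 1)) ≤
            (n + 2) * ((q + (l + 1)) * (1 + (n + 1) * q)) * (z + 1) := by
          calc _ ≤ (n + 1 + 1) * ((q + l + 1) * ((1 + (n + 1) * q) * (z + 1))) := by gcongr
            _ = _ := by ring
        nlinarith [Nat.zero_le ((n + 1) * q * (z + 1))]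
    · simp only [h, if_false]
      refine ⟨trivial, hs.mono (by omega), _,
        .cond_true (by simpa [Expr.eval] using h) (.skip s), ?_⟩
      generalize (l : ℕ) + 1 = l'
      have : (4 : ℕ) * (z + 1) ≤ (4 + (s 0 0 + 1) * Q.eval (s 0 0) + (s 0 0 + 2) *
          ((Q.eval (s 0 0) + l') * (1 + (s 0 0 + 1) * Q.eval (s 0 0)))) * (z + 1) :=
        Nat.mul_le_mul_right _ (by omega)
      omega
  have := hrest.comp hinit
  convert this using 1
  funext s
  simp only [RAM.forLoop, State.update_same, if_true, State.update_bank_ne s ha.symm]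
  rfl

/-! ### Decision trees -/

/-- The functions given by decision trees with linear expressions at the leaves. -/
inductive IsTree : (State → ℕ) → Prop
  | lin {φ : State → ℕ} : IsLin φ → IsTree φ
  | ite {g φ ψ : State → ℕ} : IsExpr g → IsTree φ → IsTree ψ →
      IsTree (fun s => if g s ≠ 0 then φ s else ψ s)

namespace IsTree

variable {φ ψ : State → ℕ}

theorem ite_le {a b : State → ℕ} (ha : IsExpr a) (hb : IsExpr b) (hφ : IsTree φ) (hψ : IsTree ψ) :
    IsTree (fun s => if a s ≤ b s then φ s else ψ s) := by
  convert IsTree.ite ((hb.add (.lit 1)).sub ha) hφ hψ using 2 with s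
  simp only [ne_eq, Nat.sub_eq_zero_iff_le, not_le, Nat.lt_succ_iff]

/-- The operation is pushed to the leaves, through the first tree and then through the second. -/
theorem map₂ {op : ℕ → ℕ → ℕ}
    (hop : ∀ φ ψ : State → ℕ, IsLin φ → IsLin ψ → IsTree (fun s => op (φ s) (ψ s)))
    (hφ : IsTree φ) (hψ : IsTree ψ) : IsTree (fun s => op (φ s) (ψ s)) := by
  induction hφ with
  | lin h =>
    induction hψ with
    | lin h' => exact hop _ _ h h'
    | @ite g φ' ψ' hg _ _ ih1 ih2 =>
      convert IsTree.ite hg ih1 ih2 using 2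
      dsimp only
      split_ifs <;> rfl
  | @ite g φ' ψ' hg _ _ ih1 ih2 =>
    convert IsTree.ite hg ih1 ih2 using 2
    dsimp only
    split_ifs <;> rfl

theorem add (hφ : IsTree φ) (hψ : IsTree ψ) : IsTree (fun s => φ s + ψ s) :=
  map₂ (fun _ _ h h' => .lin (h.add h')) hφ hψ

theorem max (hφ : IsTree φ) (hψ : IsTree ψ) : IsTree (fun s => max (φ s) (ψ s)) := by
  refine map₂ (fun φ ψ h h' => ?_) hφ hψ
  convert ite_le h.1 h'.1 (.lin h') (.lin h) using 2 with s
  exact max_def _ _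

end IsTree

theorem PolyTime.writeTree {a : ℕ} (ha : a ≠ 0) {α φ : State → ℕ} (hα : IsExpr α)
    (hφ : IsTree φ) : PolyTime (fun s => s.update a (α s) (φ s)) := by
  induction hφ with
  | lin h => exact .write ha hα h
  | ite hg _ _ ih1 ih2 =>
    convert PolyTime.ite hg ih1 ih2 using 2
    dsimp only
    split_ifs <;> rfl

/-! ### Filling tables -/

/-- The number with leading part `acc` followed by the digits `τ` in base `B`. -/
def enc (B : ℕ) : ℕ → List ℕ → ℕ
  | acc, [] => acc
  | acc, i :: τ => enc B (acc * B + i) τ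

theorem enc_append_singleton (B acc : ℕ) (τ : List ℕ) (i : ℕ) :
    enc B acc (τ ++ [i]) = enc B acc τ * B + i := by
  induction τ generalizing acc with
  | nil => rfl
  | cons j τ ih => exact ih _

theorem le_enc {B : ℕ} (acc : ℕ) (τ : List ℕ) : acc * B ^ τ.length ≤ enc B acc τ := by
  induction τ generalizing acc with
  | nil => simp [enc]
  | cons i τ ih =>
    refine le_trans ?_ (ih (acc * B + i))
    rw [List.length_cons, pow_succ', ← mul_assoc]
    exact Nat.mul_le_mul_right _ (by omega)

theorem enc_lt {B : ℕ} (acc : ℕ) (τ : List ℕ) (h : ∀ i ∈ τ, i < B) :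
    enc B acc τ < (acc + 1) * B ^ τ.length := by
  induction τ generalizing acc with
  | nil => simp [enc]
  | cons i τ ih =>
    refine lt_of_lt_of_le (ih (acc * B + i) fun j hj => h j (List.mem_cons_of_mem _ hj)) ?_
    rw [List.length_cons, pow_succ', ← mul_assoc]
    have := h i List.mem_cons_self
    exact Nat.mul_le_mul_right _ (by rw [add_mul]; omega)

/-- For tuples of equal length with digits below `B`, the order of the codes is the lexicographic
order, which is the order in which nested loops visit the tuples. -/
theorem enc_lt_enc {B : ℕ} {acc acc' : ℕ} (h : acc < acc') {τ τ' : List ℕ}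
    (hlen : τ.length = τ'.length) (hτ : ∀ i ∈ τ, i < B) : enc B acc τ < enc B acc' τ' :=
  calc enc B acc τ < (acc + 1) * B ^ τ.length := enc_lt acc τ hτ
    _ ≤ acc' * B ^ τ'.length := by rw [hlen]; exact Nat.mul_le_mul_right _ h
    _ ≤ enc B acc' τ' := le_enc _ _

theorem enc_cons_lt {B acc i j : ℕ} (h : i < j) {τ τ' : List ℕ}
    (hlen : τ.length = τ'.length) (hτ : ∀ i ∈ τ, i < B) :
    enc B acc (i :: τ) < enc B acc (j :: τ') :=
  enc_lt_enc (Nat.add_lt_add_left h _) hlen hτ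

theorem enc_injective {B : ℕ} (acc : ℕ) {τ τ' : List ℕ} (hlen : τ.length = τ'.length)
    (hτ : ∀ i ∈ τ, i < B) (hτ' : ∀ i ∈ τ', i < B) (h : enc B acc τ = enc B acc τ') : τ = τ' := by
  induction τ generalizing acc τ' with
  | nil => exact (List.length_eq_zero_iff.1 hlen.symm).symm
  | cons i τ ih =>
    cases τ' with
    | nil => simp at hlen
    | cons j τ' =>
      have hl : τ.length = τ'.length := by simpa using hlen
      have h1 : ∀ i ∈ τ, i < B := fun k hk => hτ k (List.mem_cons_of_mem _ hk)
      have h2 : ∀ i ∈ τ', i < B := fun k hk => hτ' k (List.mem_cons_of_mem _ hk)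
      rcases lt_trichotomy i j with hij | rfl | hij
      · exact absurd h (enc_cons_lt hij hl h1).ne
      · rw [ih _ hl h1 h2 h]
      · exact absurd h (enc_cons_lt hij hl.symm h2).ne'

theorem forLoop_bank {a b : ℕ} (hab : b ≠ a) {f : State → State} (hf : ∀ s, f s b = s b)
    (s : State) : forLoop a f s b = s b := by
  have : ∀ m s, (fun s => (f s).update a 0 (f s a 0 + 1))^[m] s b = s b := by
    intro m
    induction m with
    | zero => intro s; rfl
    | succ m ih =>
      intro s
      rw [Function.iterate_succ_apply, ih, State.update_bank_ne _ hab, hf]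
  rw [forLoop, this, State.update_bank_ne _ hab]

/-- Nested loops with the counters `as`. -/
def sweep : List ℕ → (State → State) → State → State
  | [], f => f
  | a :: as, f => forLoop a (sweep as f)

theorem sweep_bank {as : List ℕ} {b : ℕ} (hb : b ∉ as) {f : State → State}
    (hf : ∀ s, f s b = s b) (s : State) : sweep as f s b = s b := by
  induction as generalizing s with
  | nil => exact hf s
  | cons a as ih =>
    rw [List.mem_cons, not_or] at hb
    exact forLoop_bank hb.1 (ih hb.2) s

theorem PolyTime.sweep {as : List ℕ} (h0 : 0 ∉ as) (hnd : as.Nodup) {f : State → State}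
    (hf : PolyTime f) (hfa : ∀ a ∈ as, ∀ s, f s a = s a) : PolyTime (sweep as f) := by
  induction as with
  | nil => exact hf
  | cons a as ih =>
    rw [List.mem_cons, not_or] at h0
    rw [List.nodup_cons] at hnd
    exact (ih h0.2 hnd.2 fun b hb => hfa b (List.mem_cons_of_mem _ hb)).forLoop (Ne.symm h0.1)
      (sweep_bank hnd.1 (hfa a List.mem_cons_self))

theorem IsExpr.enc {B α : State → ℕ} (hB : IsExpr B) (hα : IsExpr α) (as : List ℕ) :
    IsExpr (fun s => RAM.enc (B s) (α s) (as.map fun a => s a 0)) := by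
  induction as generalizing α with
  | nil => exact hα
  | cons a as ih => exact ih ((hα.mul hB).add (.read a (.lit 0)))

/-- Fill bank `T` with the values of `φ`, as the counters `as` run through `0, …, n`. -/
def fill (T : ℕ) (as : List ℕ) (φ : State → ℕ) : State → State :=
  sweep as fun s => s.update T (enc (s 0 0 + 1) 0 (as.map fun a => s a 0)) (φ s)

theorem fill_bank {T b : ℕ} {as : List ℕ} (hT : b ≠ T) (hb : b ∉ as) (φ : State → ℕ)
    (s : State) : fill T as φ s b = s b :=
  sweep_bank hb (fun s => State.update_bank_ne s hT _ _) s

theorem PolyTime.fill {T : ℕ} {as : List ℕ} (hT : T ≠ 0) (hTa : T ∉ as) (h0 : 0 ∉ as)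
    (hnd : as.Nodup) {φ : State → ℕ} (hφ : IsTree φ) : PolyTime (fill T as φ) := by
  refine PolyTime.sweep h0 hnd (.writeTree hT (.enc (.add (.read 0 (.lit 0)) (.lit 1)) (.lit 0) _)
    hφ) fun a ha s => State.update_bank_ne _ ?_ _ _
  rintro rfl
  exact hTa ha

/-- The tuples of length `r` with entries at most `n`. -/
def IsTuple (n r : ℕ) (τ : List ℕ) : Prop := τ.length = r ∧ ∀ i ∈ τ, i ≤ n

/-- Cells are filled in increasing order of their codes. When a cell is computed, all cells of
smaller code are final, so `φ` may be a recursion along the lexicographic order. -/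
theorem fill_eq {T : ℕ} {as : List ℕ} (hT : T ≠ 0) (hTa : T ∉ as) (h0 : 0 ∉ as)
    (hnd : as.Nodup) {φ : State → ℕ} {F : List ℕ → ℕ} {s₀ : State}
    (hφ : ∀ s, (∀ b, b ≠ T → b ∉ as → s b = s₀ b) → (∀ a ∈ as, s a 0 ≤ s₀ 0 0) →
      (∀ τ, IsTuple (s₀ 0 0) as.length τ →
        enc (s₀ 0 0 + 1) 0 τ < enc (s₀ 0 0 + 1) 0 (as.map fun a => s a 0) →
        s T (enc (s₀ 0 0 + 1) 0 τ) = F τ) →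
      φ s = F (as.map fun a => s a 0))
    {τ : List ℕ} (hτ : IsTuple (s₀ 0 0) as.length τ) :
    fill T as φ s₀ T (enc (s₀ 0 0 + 1) 0 τ) = F τ := by
  set n := s₀ 0 0 with hn
  set B := n + 1 with hB
  let body : State → State :=
    fun s => s.update T (enc (s 0 0 + 1) 0 (as.map fun a => s a 0)) (φ s)
  have hbody : ∀ s b, b ≠ T → body s b = s b := fun s b hb => State.update_bank_ne s hb _ _
  let Good : ℕ → State → Prop := fun l s =>
    (∀ b, b ≠ T → b ∉ as → s b = s₀ b) ∧
      ∀ τ, IsTuple n as.length τ → enc B 0 τ < l → s T (enc B 0 τ) = F τ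
  -- While the outer counters `pre` stand still, the inner loops `bs` run through one block of `B ^
  -- bs.length` consecutive codes.
  have key : ∀ bs pre : List ℕ, pre ++ bs = as → ∀ s, (∀ a ∈ pre, s a 0 ≤ n) →
      Good (enc B 0 (pre.map fun a => s a 0) * B ^ bs.length) s →
      Good ((enc B 0 (pre.map fun a => s a 0) + 1) * B ^ bs.length) (sweep bs body s) := by
    intro bs
    induction bs with
    | nil =>
      intro pre hpre s hs hG
      rw [List.append_nil] at hpre
      subst hpre
      simp only [List.length_nil, pow_zero, mul_one] at hG ⊢
      have hs0 : s 0 = s₀ 0 := hG.1 0 hT.symm h0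
      have hφs : φ s = F (pre.map fun a => s a 0) := hφ s hG.1 hs fun τ h1 h2 => hG.2 τ h1 h2
      refine ⟨fun b hb hb' => (hbody s b hb).trans (hG.1 b hb hb'), fun τ h1 h2 => ?_⟩
      have hB' : s 0 0 + 1 = B := by rw [hs0]
      simp only [sweep, body, hB']
      by_cases h3 : enc B 0 τ = enc B 0 (pre.map fun a => s a 0)
      · have : τ = pre.map fun a => s a 0 := by
          refine enc_injective 0 (by simp [h1.1]) (fun i hi => Nat.lt_succ_of_le (h1.2 i hi)) ?_ h3
          intro i hi
          obtain ⟨a, ha, rfl⟩ := List.mem_map.1 hi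
          exact Nat.lt_succ_of_le (hs a ha)
        rw [h3, State.update_same, hφs, this]
      · rw [State.update_cell_ne _ _ h3]
        exact hG.2 τ h1 (by omega)
    | cons a bs ih =>
      intro pre hpre s hs hG
      have ha : a ∈ as := by rw [← hpre]; simp
      have ha0 : a ≠ 0 := fun h => h0 (h ▸ ha)
      have haT : a ≠ T := fun h => hTa (h ▸ ha)
      have hnd' : (pre ++ a :: bs).Nodup := by rw [hpre]; exact hnd
      have hapre : a ∉ pre := fun h =>
        (List.nodup_append.1 hnd').2.2 a h a List.mem_cons_self rfl
      have habs : a ∉ bs := (List.nodup_cons.1 (List.nodup_append.1 hnd').2.1).1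
      have hprebs : ∀ c ∈ pre, c ∉ bs := fun c h h' =>
        (List.nodup_append.1 hnd').2.2 c h c (List.mem_cons_of_mem _ h') rfl
      have hs0 : s 0 = s₀ 0 := hG.1 0 hT.symm h0
      set l := enc B 0 (pre.map fun a => s a 0) with hl
      have hmain := forLoop_induction ha0 (f := sweep bs body) (s := s)
        (fun i s' => (∀ c ∈ pre, s' c = s c) ∧ Good ((l * B + i) * B ^ bs.length) s') ?_ ?_
      · obtain ⟨-, h2⟩ := hmain
        rw [hs0, ← hn, ← hB] at h2
        have h3 : (l + 1) * B ^ (a :: bs).length = (l * B + B) * B ^ bs.length := by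
          rw [List.length_cons, pow_succ']
          ring
        rw [h3]
        exact h2
      · refine ⟨fun c hc => State.update_bank_ne _ (fun h => hapre (by rwa [← h])) _ _,
          fun b hb hb' => ?_, fun τ h1 h2 => ?_⟩
        · rw [State.update_bank_ne _ (fun h => hb' (by rwa [h]))]
          exact hG.1 b hb hb'
        · rw [State.update_bank_ne _ haT.symm]
          refine hG.2 τ h1 ?_
          rw [List.length_cons, pow_succ', ← mul_assoc]
          exact h2
      · rintro i hi s' hsa hs'0 ⟨hpre', hG'⟩
        have hpm : (pre ++ [a]).map (fun a => s' a 0) = (pre.map fun a => s a 0) ++ [i] := by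
          rw [List.map_append, List.map_singleton, hsa]
          congr 1
          exact List.map_congr_left fun c hc => by rw [hpre' c hc]
        have := ih (pre ++ [a]) (by simpa using hpre) s' ?_ ?_
        · rw [hpm, enc_append_singleton, ← hl] at this
          refine ⟨?_, ?_, ?_, ?_, ?_⟩
          · rw [sweep_bank habs fun s => hbody s a haT]; exact hsa
          · rw [this.1 0 hT.symm h0, hs0]
          · intro c hc
            have hcT : c ≠ T := fun h => hTa (by rw [← h, ← hpre]; simp [hc])
            rw [State.update_bank_ne _ (fun h => hapre (by rwa [← h])),
              sweep_bank (hprebs c hc) fun s => hbody s c hcT]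
            exact hpre' c hc
          · intro b hb hb'
            rw [State.update_bank_ne _ (fun h => hb' (by rwa [h]))]
            exact this.1 b hb hb'
          · intro τ h1 h2
            rw [State.update_bank_ne _ haT.symm]
            exact this.2 τ h1 (by rw [add_assoc]; exact h2)
        · intro c hc
          rcases List.mem_append.1 hc with hc | hc
          · rw [hpre' c hc]; exact hs c hc
          · rw [List.mem_singleton.1 hc, hsa, hn, ← hs0]; exact hi
        · rw [hpm, enc_append_singleton]; exact hG'
  have := key as [] rfl s₀ (by simp) ⟨fun _ _ _ => rfl, fun τ _ h => by simp [enc] at h⟩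
  refine this.2 τ hτ ?_
  rw [← hτ.1]
  exact enc_lt 0 τ fun i hi => Nat.lt_succ_of_le (hτ.2 i hi)

end RAM

/-! ### Cost-minimizing solutions in graphs of out-degree at most one -/

namespace Election

open Relation

set_option linter.unusedSectionVars false

variable {V : Type} [DecidableEq V]

/-- Every voter has at most one outgoing edge. -/
def Functional (G : Election V) : Prop := ∀ ⦃i j k⦄, (i, j) ∈ G.E → (i, k) ∈ G.E → j = k

theorem Functional.restrict {G : Election V} (hG : G.Functional) (S : Finset V) :
    (G.restrict S).Functional := fun _ _ _ h h' =>
  hG (Finset.mem_filter.1 h).1 (Finset.mem_filter.1 h').1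

theorem functional_of_maxOutDegree_le_one {G : Election V} (h : G.maxOutDegree ≤ 1) :
    G.Functional := by
  intro i j k hj hk
  have h1 : G.outDegree i ≤ 1 := (Finset.le_sup (f := G.outDegree) (G.E_sub _ hj).1).trans h
  have := Finset.card_le_one.1 h1 (i, j) (Finset.mem_filter.2 ⟨hj, rfl⟩) (i, k)
    (Finset.mem_filter.2 ⟨hk, rfl⟩)
  exact (Prod.ext_iff.1 this).2

/-- Reachability in the delegation graph. -/
def Reach (G : Election V) : V → V → Prop := ReflTransGen fun a b => (a, b) ∈ G.E

/-- The edges of the voters not in `C`. -/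
def delegations (G : Election V) (C : Finset V) : Finset (V × V) :=
  G.E.filter fun e => e.1 ∉ C

theorem mem_delegations {G : Election V} {C : Finset V} {i j : V} :
    (i, j) ∈ G.delegations C ↔ (i, j) ∈ G.E ∧ i ∉ C := Finset.mem_filter

/-- `C` is the set of casting voters of a feasible solution. -/
def Dominating (G : Election V) (C : Finset V) : Prop :=
  C ⊆ G.N ∧ ∀ i ∈ G.N, ∃ c ∈ C, G.Reach i c

variable {G : Election V} {C : Finset V} {D : Finset (V × V)}

theorem IsSolution.eq_delegations (hG : G.Functional) (h : G.IsSolution C D) :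
    D = G.delegations C := by
  ext ⟨i, j⟩
  rw [mem_delegations]
  refine ⟨fun hD => ⟨h.D_sub hD, h.source_notMem _ hD⟩, fun ⟨hE, hC⟩ => ?_⟩
  obtain ⟨k, hk, -⟩ := h.existsUnique i (G.E_sub _ hE).1 hC
  rwa [hG hE (h.D_sub hk)]

theorem IsFeasible.dominating (h : G.IsFeasible C D) : G.Dominating C := by
  refine ⟨h.1.C_sub, fun i hi => ?_⟩
  by_cases hC : i ∈ C
  · exact ⟨i, hC, .refl⟩
  · obtain ⟨j, hj, hp⟩ := h.2 i hi hC
    exact ⟨j, hj, ReflTransGen.mono (fun _ _ h' => h.1.D_sub h') _ _ hp⟩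

/-- The path is cut at its first casting voter; all earlier voters delegate. -/
theorem exists_hasPath_of_reach {i c : V} (hp : G.Reach i c) (hc : c ∈ C) :
    ∃ c' ∈ C, HasPath (G.delegations C) i c' := by
  induction hp using ReflTransGen.head_induction_on with
  | refl => exact ⟨c, hc, .refl⟩
  | @head a b hab _ ih =>
    by_cases ha : a ∈ C
    · exact ⟨a, ha, .refl⟩
    · obtain ⟨c', hc', hp'⟩ := ih
      exact ⟨c', hc', .head (mem_delegations.2 ⟨hab, ha⟩) hp'⟩

theorem Dominating.isFeasible (hG : G.Functional) (h : G.Dominating C) :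
    G.IsFeasible C (G.delegations C) := by
  refine ⟨⟨h.1, Finset.filter_subset _ _, fun e he => (Finset.mem_filter.1 he).2,
    fun i hi hC => ?_⟩, fun i hi _ => ?_⟩
  · obtain ⟨c, hc, hp⟩ := h.2 i hi
    rcases ReflTransGen.cases_head hp with rfl | ⟨j, hj, -⟩
    · exact absurd hc hC
    · exact ⟨j, mem_delegations.2 ⟨hj, hC⟩, fun k hk => hG (mem_delegations.1 hk).1 hj⟩
  · obtain ⟨c, hc, hp⟩ := h.2 i hi
    exact exists_hasPath_of_reach hp hc

/-- `C` is the set of casting voters of a cost-minimizing solution. -/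
def Optimal (G : Election V) (C : Finset V) : Prop :=
  G.Dominating C ∧ ∀ C', G.Dominating C' → G.cost C ≤ G.cost C'

theorem isCostMinimizing_iff (hG : G.Functional) :
    G.IsCostMinimizing C D ↔ G.Optimal C ∧ D = G.delegations C := by
  constructor
  · rintro ⟨h1, h2⟩
    exact ⟨⟨h1.dominating, fun C' h' => h2 C' _ (h'.isFeasible hG)⟩, h1.1.eq_delegations hG⟩
  · rintro ⟨⟨h1, h2⟩, rfl⟩
    exact ⟨h1.isFeasible hG, fun C' D' h' => h2 C' h'.dominating⟩

theorem exists_optimal (G : Election V) : ∃ C, G.Optimal C := by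
  have hN : G.Dominating G.N := ⟨Finset.Subset.refl _, fun i hi => ⟨i, hi, .refl⟩⟩
  obtain ⟨C, hC, hmin⟩ := (measure G.cost).wf.has_min {C | G.Dominating C} ⟨_, hN⟩
  exact ⟨C, hC, fun C' h' => not_lt.1 (hmin C' h')⟩

theorem cost_insert {i : V} (hC : C ⊆ G.N) (hi : i ∈ G.N) (hiC : i ∉ C) :
    G.cost (insert i C) + G.d i = G.cost C + G.v i := by
  have h : G.N \ C = insert i (G.N \ insert i C) := by
    ext j
    simp only [Finset.mem_sdiff, Finset.mem_insert]
    by_cases h : j = i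
    · subst h; simp [hi, hiC]
    · simp [h]
  rw [cost, cost, Finset.sum_insert hiC, h, Finset.sum_insert (by simp)]
  ring

theorem cost_erase {i : V} (hC : C ⊆ G.N) (hi : i ∈ C) :
    G.cost (C.erase i) + G.v i = G.cost C + G.d i := by
  have := cost_insert (G := G) ((Finset.erase_subset i C).trans hC) (hC hi)
    (Finset.notMem_erase i C)
  rw [Finset.insert_erase hi] at this
  omega

theorem Dominating.insert {i : V} (h : G.Dominating C) (hi : i ∈ G.N) :
    G.Dominating (insert i C) :=
  ⟨Finset.insert_subset hi h.1, fun j hj => by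
    obtain ⟨c, hc, hp⟩ := h.2 j hj
    exact ⟨c, Finset.mem_insert_of_mem hc, hp⟩⟩

theorem Dominating.erase {i c : V} (h : G.Dominating C) (hc : c ∈ C) (hci : c ≠ i)
    (hp : G.Reach i c) : G.Dominating (C.erase i) := by
  refine ⟨(Finset.erase_subset _ _).trans h.1, fun j hj => ?_⟩
  obtain ⟨c', hc', hp'⟩ := h.2 j hj
  by_cases hi : c' = i
  · exact ⟨c, Finset.mem_erase.2 ⟨hci, hc⟩, hi ▸ hp' |>.trans hp⟩
  · exact ⟨c', Finset.mem_erase.2 ⟨hi, hc'⟩, hp'⟩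

theorem Optimal.d_le_v (h : G.Optimal C) {i : V} (hi : i ∈ G.N) (hiC : i ∉ C) :
    G.d i ≤ G.v i := by
  have h1 := h.2 _ (h.1.insert hi)
  have h2 := cost_insert h.1.1 hi hiC
  omega

/-- Otherwise `i` could be erased: whoever reached `i` goes on to `c`, and the cost drops by `v i -
d i`. -/
theorem Optimal.eq_of_reach (h : G.Optimal C) {i c : V} (hi : i ∈ C) (hv : G.d i < G.v i)
    (hc : c ∈ C) (hp : G.Reach i c) : c = i := by
  by_contra hci
  have h1 := h.2 _ (h.1.erase hc hci hp)
  have h2 := cost_erase h.1.1 hi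
  omega

/-- Edges along which every optimal solution delegates when `x` casts a vote. -/
def SureStep (G : Election V) (x i j : V) : Prop := (i, j) ∈ G.E ∧ G.d i < G.v i ∧ i ≠ x

/-- Edges along which some optimal solution may delegate when `x` casts a vote. -/
def MayStep (G : Election V) (x i j : V) : Prop := (i, j) ∈ G.E ∧ G.d i ≤ G.v i ∧ i ≠ x

/-- Edges of voters for whom casting a vote instead of `x` is more expensive. -/
def DearStep (G : Election V) (x i j : V) : Prop :=
  (i, j) ∈ G.E ∧ i ≠ x ∧ G.d i < G.v i ∧ G.v x + G.d i < G.v i + G.d x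

open Classical in
/-- The voters who are sure to support `x`, including `x`. -/
noncomputable def support (G : Election V) (x : V) : Finset V :=
  G.N.filter fun i => ReflTransGen (G.SureStep x) i x

open Classical in
/-- The voters who may support `j`, including `j`. -/
noncomputable def backing (G : Election V) (x j : V) : Finset V :=
  G.N.filter fun i => ReflTransGen (G.MayStep x) i j

/-- The reasons for which `x` casts a vote in every optimal solution. -/
def AlwaysCasts (G : Election V) (x : V) : Prop :=
  G.v x < G.d x ∨ (∀ y, (x, y) ∉ G.E) ∨
    ∃ y, (x, y) ∈ G.E ∧ ReflTransGen (G.DearStep x) y x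

variable {x : V}

theorem mem_support {i : V} : i ∈ G.support x ↔ i ∈ G.N ∧ ReflTransGen (G.SureStep x) i x := by
  classical
  exact Finset.mem_filter

theorem mem_backing {i j : V} :
    i ∈ G.backing x j ↔ i ∈ G.N ∧ ReflTransGen (G.MayStep x) i j := by
  classical
  exact Finset.mem_filter

theorem mem_represented {i j : V} :
    i ∈ G.represented C D j ↔ (i ∈ G.N ∧ i ∉ C) ∧ HasPath D i j := by
  classical
  rw [represented, Finset.mem_filter, Finset.mem_sdiff]

theorem SureStep.reach {i j : V} (h : ReflTransGen (G.SureStep x) i j) : G.Reach i j :=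
  ReflTransGen.mono (fun _ _ h' => h'.1) _ _ h

theorem MayStep.reach {i j : V} (h : ReflTransGen (G.MayStep x) i j) : G.Reach i j :=
  ReflTransGen.mono (fun _ _ h' => h'.1) _ _ h

theorem DearStep.reach {i j : V} (h : ReflTransGen (G.DearStep x) i j) : G.Reach i j :=
  ReflTransGen.mono (fun _ _ h' => h'.1) _ _ h

theorem HasPath.reach {i j : V} (h : HasPath (G.delegations C) i j) : G.Reach i j :=
  ReflTransGen.mono (fun _ _ h' => (mem_delegations.1 h').1) _ _ h

theorem HasPath.eq_of_mem {i j : V} (h : HasPath (G.delegations C) i j) (hi : i ∈ C) : i = j := by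
  rcases ReflTransGen.cases_head h with rfl | ⟨k, hk, -⟩
  · rfl
  · exact absurd hi (mem_delegations.1 hk).2

theorem HasPath.unique (hG : G.Functional) {i c c' : V} (hc : c ∈ C) (hc' : c' ∈ C)
    (h : HasPath (G.delegations C) i c) (h' : HasPath (G.delegations C) i c') : c = c' := by
  induction h using ReflTransGen.head_induction_on with
  | refl => exact h'.eq_of_mem hc
  | @head a b hab _ ih =>
    rcases ReflTransGen.cases_head h' with rfl | ⟨k, hk, hp⟩
    · exact absurd hc' (mem_delegations.1 hab).2
    · rw [hG (mem_delegations.1 hk).1 (mem_delegations.1 hab).1] at hp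
      exact ih hp

/-- A delegating `x` would reach a casting voter `c ≠ x`. In the cycle case `c` lies on the cycle,
and exchanging `c` for `x` is strictly cheaper. -/
theorem AlwaysCasts.mem (hG : G.Functional) (hx : x ∈ G.N) (h : G.AlwaysCasts x)
    (hC : G.Optimal C) : x ∈ C := by
  by_contra hxC
  obtain ⟨c, hc, hp⟩ := hC.1.2 x hx
  have hxc : c ≠ x := fun h => hxC (h ▸ hc)
  rcases ReflTransGen.cases_head hp with rfl | ⟨y, hxy, hyc⟩
  · exact hxC hc
  rcases h with h | h | ⟨y', hxy', hy'⟩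
  · exact absurd (hC.d_le_v hx hxC) (not_le.2 h)
  · exact h y hxy
  · obtain rfl := hG hxy hxy'
    -- Edges are unique, so a walk from `y` follows the path back to `x` and, once at `x`, starts
    -- again at `y`.
    have hcx : ReflTransGen (G.DearStep x) c x := by
      clear hp hc hxc
      induction hyc with
      | refl => exact hy'
      | @tail a b _ hab ih =>
        rcases ReflTransGen.cases_head (ih) with rfl | ⟨k, hk, hkx⟩
        · rwa [hG hab hxy]
        · rwa [hG hab hk.1]
    rcases ReflTransGen.cases_head hcx with h | ⟨k, hk, -⟩
    · exact hxc h
    have h1 : G.Dominating ((insert x C).erase c) :=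
      (hC.1.insert hx).erase (Finset.mem_insert_self _ _) hxc.symm (DearStep.reach hcx)
    have h2 := hC.2 _ h1
    have h3 := cost_insert hC.1.1 hx hxC
    have h4 := cost_erase (hC.1.insert hx).1 (Finset.mem_insert_of_mem hc)
    have h5 := hk.2.2.2
    omega

/-- Strict delegators that reach the casting voter `x` never cast, so the whole support counts for
`x`. Conversely, in an optimal solution delegating voters satisfy `d ≤ v`, so those represented by
another `j` lie in its backing. -/
theorem isSoleSuperVoter_of_alwaysCasts (hG : G.Functional) (hx : x ∈ G.N)
    (h : G.AlwaysCasts x)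
    (hlt : ∀ j ∈ G.N, j ∉ G.support x → (G.backing x j).card < (G.support x).card)
    (hC : G.Optimal C) : G.IsSoleSuperVoter C (G.delegations C) x := by
  have hxC := h.mem hG hx hC
  have hsupp : ∀ i ∈ G.support x, i ∈ C → i = x := fun i hi hiC => by
    rw [mem_support] at hi
    rcases ReflTransGen.cases_head hi.2 with rfl | ⟨k, hk, -⟩
    · rfl
    · exact (hC.eq_of_reach hiC hk.2.1 hxC (SureStep.reach hi.2)).symm
  have hpowx : (G.support x).card ≤ G.power C (G.delegations C) x := by
    have : G.support x ⊆ insert x (G.represented C (G.delegations C) x) := by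
      intro i hi
      by_cases hix : i = x
      · exact hix ▸ Finset.mem_insert_self _ _
      refine Finset.mem_insert_of_mem ?_
      have hi' := mem_support.1 hi
      refine mem_represented.2 ⟨⟨hi'.1, fun h => hix (hsupp i hi h)⟩, ?_⟩
      clear hix hi
      obtain ⟨hN, hp⟩ := hi'
      induction hp using ReflTransGen.head_induction_on with
      | refl => exact .refl
      | @head a b hab hbx ih =>
        refine .head (mem_delegations.2 ⟨hab.1, fun haC => hab.2.2 ?_⟩)
          (ih (G.E_sub _ hab.1).2)
        exact hsupp a (mem_support.2 ⟨hN, .head hab hbx⟩) haC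
    exact (Finset.card_le_card this).trans (Finset.card_insert_le _ _)
  refine ⟨hxC, fun j hj hjx => ?_⟩
  have hjs : j ∉ G.support x := fun h => hjx (hsupp j h hj)
  refine lt_of_le_of_lt ?_ ((hlt j (hC.1.1 hj) hjs).trans_le hpowx)
  have hnot : j ∉ G.represented C (G.delegations C) j := fun h =>
    (mem_represented.1 h).1.2 hj
  rw [power, ← Finset.card_insert_of_notMem hnot]
  refine Finset.card_le_card fun i hi => mem_backing.2 ?_
  rcases Finset.mem_insert.1 hi with rfl | hi
  · exact ⟨hC.1.1 hj, .refl⟩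
  · obtain ⟨h1, h2⟩ := mem_represented.1 hi
    refine ⟨h1.1, ReflTransGen.mono (fun a b hab => ?_) _ _ h2⟩
    obtain ⟨h3, h4⟩ := mem_delegations.1 hab
    exact ⟨h3, hC.d_le_v (G.E_sub _ h3).1 h4, fun h => h4 (h ▸ hxC)⟩

/-- Suppose `d x ≤ v x` and `x` has an edge. If `x` reached another casting voter, dropping `x`
would give an optimal set without it. So `x` reaches only itself in `C`, hence lies on a cycle, and
exchanging it for another voter of the cycle must be strictly worse. -/
theorem alwaysCasts_of_forall_mem (h : ∀ C, G.Optimal C → x ∈ C) : G.AlwaysCasts x := by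
  obtain ⟨C, hC⟩ := G.exists_optimal
  have hxC := h C hC
  have hx := hC.1.1 hxC
  by_contra hcon
  simp only [AlwaysCasts, not_or, not_lt, not_forall, not_not, not_exists, not_and] at hcon
  obtain ⟨hdv, ⟨y, hxy⟩, hno⟩ := hcon
  have honly : ∀ c ∈ C, G.Reach x c → c = x := by
    intro c hc hp
    by_contra hcx
    have h1 := hC.1.erase hc hcx hp
    have h2 := cost_erase hC.1.1 hxC
    exact Finset.notMem_erase x C (h _ ⟨h1, fun C' hC' => by
      have := hC.2 C' hC'; omega⟩)
  refine hno y hxy ?_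
  obtain ⟨c, hc, hp⟩ := hC.1.2 y (G.E_sub _ hxy).2
  obtain rfl := honly c hc (.head hxy hp)
  have hcy : G.Reach c y := .single hxy
  clear hxy hno
  induction hp using ReflTransGen.head_induction_on with
  | refl => exact .refl
  | @head a b hab _ ih =>
    by_cases hac : a = c
    · subst hac; exact .refl
    refine .head ?_ (ih (hcy.tail hab))
    have haC : a ∉ C := fun haC => hac (honly a haC hcy)
    have haN : a ∈ G.N := (G.E_sub _ hab).1
    have h1 := (hC.1.insert haN).erase (i := c) (Finset.mem_insert_self a C) hac hcy
    have h2 := cost_insert hC.1.1 haN haC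
    have h3 := cost_erase (hC.1.insert haN).1 (Finset.mem_insert_of_mem hxC)
    have h4 : ¬ G.Optimal ((insert a C).erase c) := fun h' => Finset.notMem_erase c _ (h _ h')
    have h5 : G.cost C < G.cost ((insert a C).erase c) := by
      by_contra h6
      exact h4 ⟨h1, fun C' hC' => (not_lt.1 h6).trans (hC.2 C' hC')⟩
    exact ⟨hab, hac, by omega, by omega⟩

theorem Optimal.union_ties (hC : G.Optimal C) {A : Finset V} (hA : A ⊆ G.N)
    (hties : ∀ i ∈ A, G.v i = G.d i) : G.Optimal (C ∪ A) := by
  induction A using Finset.induction_on with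
  | empty => simpa using hC
  | insert a A _ ih =>
    rw [Finset.insert_subset_iff] at hA
    have h := ih hA.2 fun i hi => hties i (Finset.mem_insert_of_mem hi)
    rw [Finset.union_insert]
    by_cases ha : a ∈ C ∪ A
    · rwa [Finset.insert_eq_of_mem ha]
    have h1 := cost_insert h.1.1 hA.1 ha
    have h2 := hties a (Finset.mem_insert_self _ _)
    exact ⟨h.1.insert hA.1, fun C' hC' => by have := h.2 C' hC'; omega⟩

/-- Ties can be dropped at no cost, and the fixed casting voter `z` takes over whoever relied on
them. -/
theorem Optimal.sdiff_ties (hC : G.Optimal C) {A : Finset V}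
    (hties : ∀ i ∈ A, G.v i = G.d i) {z : V} (hz : z ∈ C) (hzA : z ∉ A)
    (hreach : ∀ i ∈ A, G.Reach i z) : G.Optimal (C \ A) := by
  induction A using Finset.induction_on with
  | empty => simpa using hC
  | insert a A _ ih =>
    rw [Finset.mem_insert, not_or] at hzA
    have h := ih (fun i hi => hties i (Finset.mem_insert_of_mem hi)) hzA.2
      fun i hi => hreach i (Finset.mem_insert_of_mem hi)
    rw [Finset.sdiff_insert]
    by_cases ha : a ∈ C \ A
    · have h1 := cost_erase h.1.1 ha
      have h2 := hties a (Finset.mem_insert_self _ _)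
      exact ⟨h.1.erase (Finset.mem_sdiff.2 ⟨hz, hzA.2⟩) hzA.1
        (hreach a (Finset.mem_insert_self _ _)), fun C' hC' => by have := h.2 C' hC'; omega⟩
    · rwa [Finset.erase_eq_of_notMem ha]

/-- Ties are resolved against `x`. All of them cast at first, so only strict delegators follow `x`;
then those in the backing of `j` delegate again, which sends this backing to a rival `z`. -/
theorem card_backing_lt (hG : G.Functional)
    (h : ∀ C, G.Optimal C → G.IsSoleSuperVoter C (G.delegations C) x) {j : V} (hj : j ∈ G.N)
    (hjs : j ∉ G.support x) : (G.backing x j).card < (G.support x).card := by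
  classical
  obtain ⟨C₀, hC₀⟩ := G.exists_optimal
  let T : Finset V := G.N.filter fun i => G.v i = G.d i
  have hT : ∀ i ∈ T, G.v i = G.d i := fun i hi => (Finset.mem_filter.1 hi).2
  have hC₁ : G.Optimal (C₀ ∪ T) := hC₀.union_ties (Finset.filter_subset _ _) hT
  set C₁ := C₀ ∪ T with hC₁def
  have hx₁ : x ∈ C₁ := (h C₁ hC₁).1
  have hsure : ∀ C, G.Optimal C → ∀ a b, (a, b) ∈ G.delegations C → a ∉ T → G.SureStep x a b := by
    intro C hC a b hab haT
    obtain ⟨h1, h2⟩ := mem_delegations.1 hab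
    have haN := (G.E_sub _ h1).1
    refine ⟨h1, lt_of_le_of_ne (hC.d_le_v haN h2) fun h3 => haT ?_,
      fun h3 => h2 (h3 ▸ (h C hC).1)⟩
    exact Finset.mem_filter.2 ⟨haN, h3.symm⟩
  obtain ⟨c, hc, hpc⟩ := hC₁.1.2 j hj
  obtain ⟨z, hz, hpz⟩ := exists_hasPath_of_reach hpc hc
  -- All ties cast in `C₁`, so a path from `j` to `x` would consist of sure steps.
  have hzx : z ≠ x := by
    rintro rfl
    refine hjs (mem_support.2 ⟨hj, ReflTransGen.mono (fun a b hab => ?_) _ _ hpz⟩)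
    exact hsure C₁ hC₁ a b hab fun haT =>
      (mem_delegations.1 hab).2 (Finset.mem_union_right _ haT)
  -- The voter `z` may itself be a tie of this backing and must keep casting.
  let A : Finset V := (T ∩ G.backing x j).erase z
  have hC₂ : G.Optimal (C₁ \ A) := by
    refine hC₁.sdiff_ties (fun i hi => hT i ?_) hz (Finset.notMem_erase _ _) fun i hi => ?_
    · exact (Finset.mem_inter.1 (Finset.mem_of_mem_erase hi)).1
    · exact (MayStep.reach (mem_backing.1
        (Finset.mem_inter.1 (Finset.mem_of_mem_erase hi)).2).2).trans hpz.reach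
  set C₂ := C₁ \ A with hC₂def
  have hz₂ : z ∈ C₂ := Finset.mem_sdiff.2 ⟨hz, Finset.notMem_erase _ _⟩
  have hx₂ : x ∈ C₂ := (h C₂ hC₂).1
  have hpz₂ : HasPath (G.delegations C₂) j z := ReflTransGen.mono (fun a b hab => by
    rw [mem_delegations] at hab ⊢
    exact ⟨hab.1, fun h' => hab.2 (Finset.mem_sdiff.1 h').1⟩) _ _ hpz
  have hcast : ∀ i ∈ G.backing x j, i ∈ C₂ → i = z := by
    intro i hi hi₂
    by_contra hiz
    obtain ⟨hiN, hip⟩ := mem_backing.1 hi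
    rcases ReflTransGen.cases_head hip with rfl | ⟨k, hk, -⟩
    · exact hiz (hpz.eq_of_mem (Finset.mem_sdiff.1 hi₂).1)
    · rcases hk.2.1.lt_or_eq with hlt | heq
      · exact hiz (hC₂.eq_of_reach hi₂ hlt hz₂ ((MayStep.reach hip).trans hpz.reach)).symm
      · exact (Finset.mem_sdiff.1 hi₂).2 (Finset.mem_erase.2 ⟨hiz, Finset.mem_inter.2
          ⟨Finset.mem_filter.2 ⟨hiN, heq.symm⟩, hi⟩⟩)
  have hpath : ∀ i ∈ G.backing x j, HasPath (G.delegations C₂) i z := by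
    intro i hi
    obtain ⟨hiN, hip⟩ := mem_backing.1 hi
    induction hip using ReflTransGen.head_induction_on with
    | refl => exact hpz₂
    | @head a b hab hbj ih =>
      by_cases haz : a = z
      · subst haz; exact .refl
      · refine .head (mem_delegations.2 ⟨hab.1, fun ha₂ => haz ?_⟩)
          (ih (mem_backing.2 ⟨(G.E_sub _ hab.1).2, hbj⟩) (G.E_sub _ hab.1).2)
        exact hcast a hi ha₂
  have hpowz : (G.backing x j).card ≤ G.power C₂ (G.delegations C₂) z := by
    have : G.backing x j ⊆ insert z (G.represented C₂ (G.delegations C₂) z) := by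
      intro i hi
      by_cases hiz : i = z
      · exact hiz ▸ Finset.mem_insert_self _ _
      · exact Finset.mem_insert_of_mem (mem_represented.2
          ⟨⟨(mem_backing.1 hi).1, fun h' => hiz (hcast i hi h')⟩, hpath i hi⟩)
    exact (Finset.card_le_card this).trans (Finset.card_insert_le _ _)
  refine lt_of_le_of_lt hpowz (((h C₂ hC₂).2 z hz₂ hzx).trans_le ?_)
  have hnot : x ∉ G.represented C₂ (G.delegations C₂) x := fun h =>
    (mem_represented.1 h).1.2 hx₂
  rw [power, ← Finset.card_insert_of_notMem hnot]
  refine Finset.card_le_card fun i hi => mem_support.2 ?_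
  rcases Finset.mem_insert.1 hi with rfl | hi'
  · exact ⟨hC₂.1.1 hx₂, .refl⟩
  obtain ⟨h1, h2⟩ := mem_represented.1 hi'
  refine ⟨h1.1, ?_⟩
  clear hi hi' h1 hnot
  induction h2 using ReflTransGen.head_induction_on with
  | refl => exact .refl
  | @head a b hab hbx ih =>
    -- A delegating tie belongs to `A`, hence to the backing of `j`, and so leads to `z`; it cannot
    -- also lead to `x`.
    refine .head (hsure C₂ hC₂ a b hab fun haT => hzx ?_) ih
    have ha₂ := (mem_delegations.1 hab).2
    have haA : a ∈ A := by
      by_contra haA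
      exact ha₂ (Finset.mem_sdiff.2 ⟨Finset.mem_union_right _ haT, haA⟩)
    have ha := hpath a (Finset.mem_inter.1 (Finset.mem_of_mem_erase haA)).2
    exact ha.unique hG hz₂ hx₂ (.head hab hbx)

theorem forall_isSoleSuperVoter_iff (hG : G.Functional) (hx : x ∈ G.N) :
    (∀ C D, G.IsCostMinimizing C D → G.IsSoleSuperVoter C D x) ↔
      G.AlwaysCasts x ∧
        ∀ j ∈ G.N, j ∉ G.support x → (G.backing x j).card < (G.support x).card := by
  simp only [isCostMinimizing_iff hG]
  constructor
  · intro h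
    have h' : ∀ C, G.Optimal C → G.IsSoleSuperVoter C (G.delegations C) x :=
      fun C hC => h C _ ⟨hC, rfl⟩
    exact ⟨alwaysCasts_of_forall_mem fun C hC => (h' C hC).1,
      fun j hj hjs => card_backing_lt hG h' hj hjs⟩
  · rintro ⟨h1, h2⟩ C D ⟨hC, rfl⟩
    exact isSoleSuperVoter_of_alwaysCasts hG hx h1 h2 hC

end Election

/-- Every element of `R` is connected to `v ∈ R` within `R` along the relation `c`. -/
def Rooted {α : Type} (c : α → α → Prop) (v : α) (R : Finset α) : Prop :=
  v ∈ R ∧ ∀ r ∈ R, Relation.ReflTransGen (fun a b => c a b ∧ b ∈ R) r v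

/-! ### Control by adding voters as the choice of a set rooted at `x` -/

namespace Election

open Relation

set_option linter.unusedSectionVars false

variable {V : Type} [DecidableEq V] {G : Election V} {x : V}

theorem mem_restrict_E {S : Finset V} {i j : V} :
    (i, j) ∈ (G.restrict S).E ↔ (i, j) ∈ G.E ∧ i ∈ S ∧ j ∈ S := Finset.mem_filter

theorem mem_restrict_N [Fintype V] (hN : G.N = Finset.univ) {S : Finset V} {i : V} :
    i ∈ (G.restrict S).N ↔ i ∈ S := by
  simp [restrict, hN]

/-- Delegations that join new voters to `x`; the candidate for the delegation of `x` is left out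
unless `μ` holds or `x` prefers to cast a vote. -/
def JoinStep (G : Election V) (x : V) (μ : Prop) (i j : V) : Prop :=
  G.SureStep x i j ∧ (μ ∨ G.v x < G.d x ∨ (x, i) ∉ G.E)

/-- The condition on the whole graph under which `x` can be made to cast a vote, when a cycle
through `x` is used (`μ`) or not used. -/
def Admissible (G : Election V) (x : V) (reg : Finset V) (μ : Prop) : Prop :=
  (μ ∧ ∃ y, (x, y) ∈ G.E ∧ ReflTransGen (G.DearStep x) y x) ∨
    (¬ μ ∧ (G.v x < G.d x ∨ ∀ y, (x, y) ∈ G.E → y ∉ reg))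

/-- The voters who have to join `x` if `x` is to have voting power `t`. -/
def MustJoin (G : Election V) (x : V) (reg : Finset V) (μ : Prop) (t : ℕ) (j : V) : Prop :=
  (j ∈ reg ∧ j ≠ x ∧ t ≤ ((G.restrict reg).backing x j).card) ∨ (μ ∧ (x, j) ∈ G.E)

theorem SureStep.of_restrict {S : Finset V} {i j : V} (h : (G.restrict S).SureStep x i j) :
    G.SureStep x i j := ⟨(mem_restrict_E.1 h.1).1, h.2⟩

theorem DearStep.of_restrict {S : Finset V} {i j : V} (h : (G.restrict S).DearStep x i j) :
    G.DearStep x i j := ⟨(mem_restrict_E.1 h.1).1, h.2⟩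

theorem DearStep.sureStep {i j : V} (h : G.DearStep x i j) : G.SureStep x i j :=
  ⟨h.1, h.2.2.1, h.2.1⟩

theorem backing_restrict_subset {S S' : Finset V} (h : S ⊆ S') (j : V) :
    (G.restrict S).backing x j ⊆ (G.restrict S').backing x j := by
  intro i hi
  rw [mem_backing] at hi ⊢
  refine ⟨Finset.inter_subset_inter_left h hi.1, ReflTransGen.mono (fun a b hab => ?_) _ _ hi.2⟩
  have := mem_restrict_E.1 hab.1
  exact ⟨mem_restrict_E.2 ⟨this.1, h this.2.1, h this.2.2⟩, hab.2⟩

variable [Fintype V] {reg : Finset V} {k : ℕ}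

/-- `R` is the support of `x` after the addition and `t` its size. A registered voter with backing
at least `t` among the registered voters has no smaller backing after the addition, so it must be in
the support. -/
theorem exists_rooted_of_control (hG : G.Functional) (hN : G.N = Finset.univ) (hx : x ∈ reg)
    {A : Finset V} (hAk : A.card ≤ k)
    (h : ∀ C D, (G.restrict (reg ∪ A)).IsCostMinimizing C D →
      (G.restrict (reg ∪ A)).IsSoleSuperVoter C D x) :
    ∃ μ : Prop, G.Admissible x reg μ ∧ ∃ t ≤ Fintype.card V, ∃ R : Finset V,
      Rooted (G.JoinStep x μ) x R ∧ (R \ reg).card ≤ k ∧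
        (∀ j, G.MustJoin x reg μ t j → j ∈ R) ∧ t ≤ R.card := by
  set S := reg ∪ A with hS
  have hxS : x ∈ S := Finset.mem_union_left _ hx
  obtain ⟨hcast, hlt⟩ := (forall_isSoleSuperVoter_iff (hG.restrict S)
    ((mem_restrict_N hN).2 hxS)).1 h
  set R := (G.restrict S).support x with hR
  have hRS : ∀ r ∈ R, r ∈ S := fun r hr => (mem_restrict_N hN).1 (mem_support.1 hr).1
  have hxR : x ∈ R := mem_support.2 ⟨(mem_restrict_N hN).2 hxS, .refl⟩
  have hcard : (R \ reg).card ≤ k := by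
    refine (Finset.card_le_card fun r hr => ?_).trans hAk
    rw [Finset.mem_sdiff] at hr
    exact (Finset.mem_union.1 (hRS r hr.1)).resolve_left hr.2
  have hroot : ∀ μ : Prop, (∀ a ∈ S, μ ∨ G.v x < G.d x ∨ (x, a) ∉ G.E) →
      Rooted (G.JoinStep x μ) x R := by
    refine fun μ hμ => ⟨hxR, fun r hr => ?_⟩
    have hp := (mem_support.1 hr).2
    clear hr
    induction hp using ReflTransGen.head_induction_on with
    | refl => exact .refl
    | @head a b hab hbx ih =>
      have h1 := mem_restrict_E.1 hab.1
      exact .head ⟨⟨hab.of_restrict, hμ a h1.2.1⟩,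
        mem_support.2 ⟨(mem_restrict_N hN).2 h1.2.2, hbx⟩⟩ ih
  have hforced : ∀ j, j ∈ reg → R.card ≤ ((G.restrict reg).backing x j).card → j ∈ R := by
    intro j hj hle
    by_contra hjR
    refine absurd (hlt j ((mem_restrict_N hN).2 (Finset.mem_union_left _ hj)) hjR) (not_lt.2 ?_)
    exact hle.trans (Finset.card_le_card (backing_restrict_subset Finset.subset_union_left j))
  have hcase : (G.v x < G.d x ∨ ∀ y, (x, y) ∈ G.E → y ∉ S) ∨
      ∃ y, (x, y) ∈ (G.restrict S).E ∧ ReflTransGen ((G.restrict S).DearStep x) y x := by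
    rcases hcast with h | h | h
    · exact .inl (.inl h)
    · exact .inl (.inr fun y hy hyS => h y (mem_restrict_E.2 ⟨hy, hxS, hyS⟩))
    · exact .inr h
  rcases hcase with h | ⟨y, hxy, hy⟩
  · refine ⟨False, .inr ⟨not_false, h.imp id fun h y hy hyr =>
      h y hy (Finset.mem_union_left _ hyr)⟩, R.card, Finset.card_le_univ _, R,
      hroot _ fun a ha => ?_, hcard, ?_, le_rfl⟩
    · exact .inr (h.imp id fun h hxa => h a hxa ha)
    · rintro j (⟨h1, -, h3⟩ | ⟨h1, -⟩)
      · exact hforced j h1 h3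
      · exact h1.elim
  · have hxy' := mem_restrict_E.1 hxy
    refine ⟨True, .inl ⟨trivial, y, hxy'.1, ReflTransGen.mono (fun a b => DearStep.of_restrict)
      _ _ hy⟩, R.card, Finset.card_le_univ _, R, hroot _ fun _ _ => .inl trivial, hcard, ?_,
      le_rfl⟩
    rintro j (⟨h1, -, h3⟩ | ⟨-, hxj⟩)
    · exact hforced j h1 h3
    · rw [hG hxj hxy'.1]
      exact mem_support.2 ⟨(mem_restrict_N hN).2 hxy'.2.2,
        ReflTransGen.mono (fun a b => DearStep.sureStep) _ _ hy⟩

/-- Adding the unregistered part of `R` puts `R` into the support and does not increase the backing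
of any voter outside the support. -/
theorem control_of_rooted (hG : G.Functional) (hN : G.N = Finset.univ) (hx : x ∈ reg)
    {μ : Prop} (hμ : G.Admissible x reg μ) {t : ℕ} {R : Finset V}
    (hroot : Rooted (G.JoinStep x μ) x R)
    (hforced : ∀ j, G.MustJoin x reg μ t j → j ∈ R) (ht : t ≤ R.card) :
    ∀ C D, (G.restrict (reg ∪ R \ reg)).IsCostMinimizing C D →
      (G.restrict (reg ∪ R \ reg)).IsSoleSuperVoter C D x := by
  rw [Finset.union_sdiff_self_eq_union]
  set S := reg ∪ R with hS
  have hxS : x ∈ S := Finset.mem_union_left _ hx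
  have hGS := hG.restrict S
  rw [forall_isSoleSuperVoter_iff hGS ((mem_restrict_N hN).2 hxS)]
  have hRS : R ⊆ S := Finset.subset_union_right
  have hsub : R ⊆ (G.restrict S).support x := by
    intro r hr
    refine mem_support.2 ⟨(mem_restrict_N hN).2 (hRS hr), ?_⟩
    have hp := hroot.2 r hr
    induction hp using ReflTransGen.head_induction_on with
    | refl => exact .refl
    | @head a b hab _ ih =>
      exact .head ⟨mem_restrict_E.2 ⟨hab.1.1.1, hRS hr, hRS hab.2⟩, hab.1.1.2⟩ (ih hab.2)
  -- The support is closed under the unique edge of each of its members other than `x`.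
  have hnext : ∀ a ∈ (G.restrict S).support x, a ≠ x → ∀ b, (a, b) ∈ G.E →
      b ∈ (G.restrict S).support x ∧ (a, b) ∈ (G.restrict S).E := by
    intro a ha hax b hab
    rcases ReflTransGen.cases_head (mem_support.1 ha).2 with h | ⟨c, hac, hcx⟩
    · exact absurd h hax
    · obtain rfl := hG hab (mem_restrict_E.1 hac.1).1
      exact ⟨mem_support.2 ⟨((G.restrict S).E_sub _ hac.1).2, hcx⟩, hac.1⟩
  refine ⟨?_, fun j hj hjs => ?_⟩
  · rcases hμ with ⟨hμ, y, hxy, hy⟩ | ⟨hμ, h | h⟩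
    · have hyR := hforced y (.inr ⟨hμ, hxy⟩)
      refine .inr (.inr ⟨y, mem_restrict_E.2 ⟨hxy, hxS, hRS hyR⟩, ?_⟩)
      have hys := hsub hyR
      clear hxy hyR
      induction hy using ReflTransGen.head_induction_on with
      | refl => exact .refl
      | @head a b hab _ ih =>
        obtain ⟨h1, h2⟩ := hnext a hys hab.2.1 b hab.1
        exact .head ⟨h2, hab.2⟩ (ih h1)
    · exact .inl h
    · by_cases hvd : G.v x < G.d x
      · exact .inl hvd
      refine .inr (.inl fun y hxy => ?_)
      have hxy' := mem_restrict_E.1 hxy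
      have hy := h y hxy'.1
      have hyR : y ∈ R := (Finset.mem_union.1 hxy'.2.2).resolve_left hy
      -- An unregistered out-neighbour `y` of `x` in `R` would need a join step starting at `y`, and
      -- in this case `JoinStep` forbids it.
      rcases ReflTransGen.cases_head (hroot.2 y hyR) with rfl | ⟨b, hb, -⟩
      · exact hy hx
      · rcases hb.1.2 with h' | h' | h'
        · exact hμ h'
        · exact hvd h'
        · exact h' hxy'.1
  · have hjR : j ∉ R := fun h => hjs (hsub h)
    have hjx : j ≠ x := fun h => hjR (h ▸ hroot.1)
    have hjreg : j ∈ reg := (Finset.mem_union.1 ((mem_restrict_N hN).1 hj)).resolve_right hjR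
    have hlt : ((G.restrict reg).backing x j).card < t := by
      by_contra hle
      exact hjR (hforced j (.inl ⟨hjreg, hjx, not_lt.1 hle⟩))
    refine lt_of_le_of_lt (Finset.card_le_card fun i hi => ?_)
      (hlt.trans_le (ht.trans (Finset.card_le_card hsub)))
    obtain ⟨hiN, hp⟩ := mem_backing.1 hi
    -- By closedness, a path that enters the support cannot leave it towards `j`. So all voters
    -- backing `j` avoid `R` and are registered.
    have hout : ∀ a, ReflTransGen ((G.restrict S).MayStep x) a j →
        a ∉ (G.restrict S).support x := by
      intro a hp
      induction hp using ReflTransGen.head_induction_on with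
      | refl => exact hjs
      | @head a b hab _ ih =>
        exact fun ha => ih (hnext a ha hab.2.2 b (mem_restrict_E.1 hab.1).1).1
    have hreg : ∀ a ∈ S, ReflTransGen ((G.restrict S).MayStep x) a j → a ∈ reg := fun a ha hp =>
      (Finset.mem_union.1 ha).resolve_right fun haR => hout a hp (hsub haR)
    refine mem_backing.2 ⟨(mem_restrict_N hN).2 (hreg i ((mem_restrict_N hN).1 hiN) hp), ?_⟩
    clear hi hiN
    induction hp using ReflTransGen.head_induction_on with
    | refl => exact .refl
    | @head a b hab hbj ih =>
      have h1 := mem_restrict_E.1 hab.1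
      exact .head ⟨mem_restrict_E.2 ⟨h1.1, hreg a h1.2.1 (.head hab hbj), hreg b h1.2.2 hbj⟩,
        hab.2⟩ ih

theorem control_iff (hG : G.Functional) (hN : G.N = Finset.univ) (hx : x ∈ reg) :
    (∃ A ⊆ regᶜ, A.card ≤ k ∧ ∀ C D, (G.restrict (reg ∪ A)).IsCostMinimizing C D →
      (G.restrict (reg ∪ A)).IsSoleSuperVoter C D x) ↔
    ∃ μ : Prop, G.Admissible x reg μ ∧ ∃ t ≤ Fintype.card V, ∃ R : Finset V,
      Rooted (G.JoinStep x μ) x R ∧ (R \ reg).card ≤ k ∧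
        (∀ j, G.MustJoin x reg μ t j → j ∈ R) ∧ t ≤ R.card := by
  constructor
  · rintro ⟨A, -, hAk, h⟩
    exact exists_rooted_of_control hG hN hx hAk h
  · rintro ⟨μ, hμ, t, -, R, hroot, hk, hforced, ht⟩
    exact ⟨R \ reg, fun i hi => Finset.mem_compl.2 (Finset.mem_sdiff.1 hi).2, hk,
      control_of_rooted hG hN hx hμ hroot hforced ht⟩

end Election

-- A missing forced voter costs `card V + 1`, which the at most `card V` unit weights of `R` cannot
-- make up for. Thus one weight inequality expresses both conditions.
open Classical in
theorem subset_and_le_card_iff {V : Type} [Fintype V] (F : V → Prop) (R : Finset V) (t : ℕ) :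
    ((∀ j, F j → j ∈ R) ∧ t ≤ R.card) ↔
      t + ∑ j, (if F j then Fintype.card V + 1 else 0) ≤
        ∑ j ∈ R, (1 + if F j then Fintype.card V + 1 else 0) := by
  have h1 : ∑ j ∈ R, (1 + if F j then Fintype.card V + 1 else 0) =
      R.card + (R.filter F).card * (Fintype.card V + 1) := by
    rw [Finset.sum_add_distrib, ← Finset.sum_filter]
    simp
  have h2 : ∑ j, (if F j then Fintype.card V + 1 else 0) =
      (Finset.univ.filter F).card * (Fintype.card V + 1) := by
    rw [← Finset.sum_filter]
    simp
  rw [h1, h2]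
  have hsub : R.filter F ⊆ Finset.univ.filter F := Finset.filter_subset_filter _ (Finset.subset_univ _)
  have hR := Finset.card_le_univ R
  constructor
  · rintro ⟨h3, h4⟩
    have : R.filter F = Finset.univ.filter F :=
      hsub.antisymm fun j hj => Finset.mem_filter.2
        ⟨h3 j (Finset.mem_filter.1 hj).2, (Finset.mem_filter.1 hj).2⟩
    rw [this]
    omega
  · intro h
    have h3 : R.filter F = Finset.univ.filter F := by
      by_contra hne
      have hlt := Finset.card_lt_card (hsub.ssubset_of_ne hne)
      have : ((R.filter F).card + 1) * (Fintype.card V + 1) ≤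
          (Finset.univ.filter F).card * (Fintype.card V + 1) := Nat.mul_le_mul_right _ hlt
      rw [add_mul] at this
      omega
    rw [h3] at h
    refine ⟨fun j hj => ?_, by omega⟩
    have : j ∈ R.filter F := h3 ▸ Finset.mem_filter.2 ⟨Finset.mem_univ _, hj⟩
    exact (Finset.mem_filter.1 this).1

/-! ### A knapsack problem on trees -/

/-- The maximum of `f 0, …, f b`. -/
def runMax (f : ℕ → ℕ) : ℕ → ℕ
  | 0 => f 0
  | b + 1 => max (runMax f b) (f (b + 1))

theorem le_runMax (f : ℕ → ℕ) {c b : ℕ} (h : c ≤ b) : f c ≤ runMax f b := by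
  induction b with
  | zero => rw [Nat.le_zero.1 h]; rfl
  | succ b ih =>
    rcases Nat.le_succ_iff.1 h with h | rfl
    · exact (ih h).trans (le_max_left _ _)
    · exact le_max_right _ _

theorem exists_runMax_eq (f : ℕ → ℕ) (b : ℕ) : ∃ c ≤ b, runMax f b = f c := by
  induction b with
  | zero => exact ⟨0, le_rfl, rfl⟩
  | succ b ih =>
    obtain ⟨c, hc, h⟩ := ih
    rcases max_choice (runMax f b) (f (b + 1)) with h' | h'
    · exact ⟨c, by omega, h'.trans h⟩
    · exact ⟨b + 1, le_rfl, h'⟩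

/-- The best total value when a budget is divided among the objects `0, …, u`, where `g i c` is
the value of object `i` with budget `c`. -/
def knapsack (g : ℕ → ℕ → ℕ) : ℕ → ℕ → ℕ
  | 0, b => runMax (fun c => g 0 c) b
  | u + 1, b => runMax (fun c => knapsack g u (b - c) + g (u + 1) c) b

/-- The largest weight of a subtree of height less than `m` with root `v` and cost at most `b`. -/
def bestSubtree (child : ℕ → ℕ → Prop) [∀ u v, Decidable (child u v)] (w ct : ℕ → ℕ) (n : ℕ) :
    ℕ → ℕ → ℕ → ℕ
  | 0, _, _ => 0
  | m + 1, v, b =>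
    if ct v ≤ b then
      w v + knapsack (fun u c => if child u v then bestSubtree child w ct n m u c else 0) n (b - ct v)
    else 0

section Tree

open Relation

variable {child : ℕ → ℕ → Prop} {w ct : ℕ → ℕ} {n x : ℕ}

/-- Parents are unique, so a cycle through a vertex would be passed on to its parent and finally to
`x`, which has no parent. -/
theorem not_transGen_self (hf : ∀ ⦃u v v'⦄, child u v → child u v' → v = v')
    (hx : ∀ v, ¬ child x v) {v : ℕ} (hv : ReflTransGen child v x) : ¬ TransGen child v v := by
  induction hv using ReflTransGen.head_induction_on with
  | refl =>
    intro h
    obtain ⟨b, hb, -⟩ := TransGen.head'_iff.1 h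
    exact hx b hb
  | @head a b hab _ ih =>
    intro h
    obtain ⟨c, hc, hca⟩ := TransGen.head'_iff.1 h
    obtain rfl := hf hab hc
    exact ih (TransGen.tail'_iff.2 ⟨a, hca, hab⟩)

/-- Branches below different children of `v` are disjoint: the upward path from `r` is unique, so
one of `u`, `u'` is above the other, and if they differed `v` would lie on a cycle. -/
theorem eq_of_common_descendant (hf : ∀ ⦃u v v'⦄, child u v → child u v' → v = v')
    (hx : ∀ v, ¬ child x v) {v : ℕ} (hv : ReflTransGen child v x) {r u u' : ℕ}
    (hu : child u v) (hu' : child u' v) (h : ReflTransGen child r u)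
    (h' : ReflTransGen child r u') : u = u' := by
  have key : ∀ u u', child u v → child u' v → ReflTransGen child u u' → u = u' := by
    intro u u' hu hu' hp
    rcases ReflTransGen.cases_head hp with h | ⟨c, hc, hcu⟩
    · exact h
    · obtain rfl := hf hu hc
      exact absurd (TransGen.tail'_iff.2 ⟨u', hcu, hu'⟩) (not_transGen_self hf hx hv)
  have hU : Relator.RightUnique child := fun _ _ _ h1 h2 => hf h1 h2
  rcases ReflTransGen.total_of_right_unique hU h h' with h | h
  · exact key u u' hu hu' h
  · exact (key u' u hu' hu h).symm

theorem ReflTransGen.forget {α : Type} {c P : α → α → Prop} {r u : α}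
    (h : ReflTransGen (fun a b => c a b ∧ P a b) r u) : ReflTransGen c r u :=
  ReflTransGen.mono (fun _ _ h => h.1) _ _ h

variable [∀ u v, Decidable (child u v)]

/-- The value `0` is split off because it is also the default when no subtree is affordable or the
height is exhausted; as a summand it means an omitted branch. -/
theorem exists_rooted_of_bestSubtree (hf : ∀ ⦃u v v'⦄, child u v → child u v' → v = v')
    (hx : ∀ v, ¬ child x v) (m v b : ℕ) (hv : ReflTransGen child v x) :
    bestSubtree child w ct n m v b = 0 ∨ ∃ R : Finset ℕ, Rooted child v R ∧ ∑ r ∈ R, ct r ≤ b ∧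
      bestSubtree child w ct n m v b ≤ ∑ r ∈ R, w r := by
  induction m generalizing v b with
  | zero => exact .inl rfl
  | succ m ih =>
    by_cases hvb : ct v ≤ b
    swap
    · left; rw [bestSubtree, if_neg hvb]
    right
    set g : ℕ → ℕ → ℕ := fun u c => if child u v then bestSubtree child w ct n m u c else 0 with hg
    have hgR : ∀ u c, g u c = 0 ∨ child u v ∧ ∃ R : Finset ℕ, Rooted child u R ∧
        ∑ r ∈ R, ct r ≤ c ∧ g u c ≤ ∑ r ∈ R, w r := by
      intro u c
      simp only [hg]
      split_ifs with hu
      · rcases ih u c (.head hu hv) with h | h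
        · exact .inl h
        · exact .inr ⟨hu, h⟩
      · exact .inl rfl
    -- `Q` is a union of branches rooted at children `u' ≤ u` of `v`; the branch chosen below `u +
    -- 1` is disjoint from it.
    have key : ∀ u b, ∃ Q : Finset ℕ, ∑ r ∈ Q, ct r ≤ b ∧ knapsack g u b ≤ ∑ r ∈ Q, w r ∧
        ∀ r ∈ Q, ∃ u' ≤ u, child u' v ∧ u' ∈ Q ∧
          ReflTransGen (fun a b => child a b ∧ b ∈ Q) r u' := by
      intro u
      induction u with
      | zero =>
        intro b
        obtain ⟨c, hc, heq⟩ := exists_runMax_eq (fun c => g 0 c) b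
        rw [knapsack, heq]
        rcases hgR 0 c with h | ⟨hu, R, hR, h1, h2⟩
        · exact ⟨∅, by simp, by simp [h], by simp⟩
        · exact ⟨R, h1.trans hc, h2, fun r hr => ⟨0, le_rfl, hu, hR.1, hR.2 r hr⟩⟩
      | succ u ihu =>
        intro b
        obtain ⟨c, hc, heq⟩ := exists_runMax_eq (fun c => knapsack g u (b - c) + g (u + 1) c) b
        rw [knapsack, heq]
        obtain ⟨Q, hQ1, hQ2, hQ3⟩ := ihu (b - c)
        rcases hgR (u + 1) c with h | ⟨hu, R, hR, h1, h2⟩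
        · refine ⟨Q, by omega, by omega, fun r hr => ?_⟩
          obtain ⟨u', hu', h'⟩ := hQ3 r hr
          exact ⟨u', by omega, h'⟩
        · have hdisj : Disjoint Q R := by
            rw [Finset.disjoint_left]
            intro r hrQ hrR
            obtain ⟨u', hu', h3, -, h4⟩ := hQ3 r hrQ
            have := eq_of_common_descendant hf hx hv h3 hu (ReflTransGen.forget h4)
              (ReflTransGen.forget (hR.2 r hrR))
            omega
          refine ⟨Q ∪ R, ?_, ?_, fun r hr => ?_⟩
          · rw [Finset.sum_union hdisj]; omega
          · rw [Finset.sum_union hdisj]; omega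
          rcases Finset.mem_union.1 hr with hr | hr
          · obtain ⟨u', hu', h3, h4, h5⟩ := hQ3 r hr
            exact ⟨u', by omega, h3, Finset.mem_union_left _ h4, ReflTransGen.mono
              (fun a b h => ⟨h.1, Finset.mem_union_left _ h.2⟩) _ _ h5⟩
          · exact ⟨u + 1, le_rfl, hu, Finset.mem_union_right _ hR.1, ReflTransGen.mono
              (fun a b h => ⟨h.1, Finset.mem_union_right _ h.2⟩) _ _ (hR.2 r hr)⟩
    obtain ⟨Q, hQ1, hQ2, hQ3⟩ := key n (b - ct v)
    have hvQ : v ∉ Q := by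
      intro hvQ
      obtain ⟨u', -, h3, -, h4⟩ := hQ3 v hvQ
      exact not_transGen_self hf hx hv (TransGen.tail'_iff.2 ⟨u', ReflTransGen.forget h4, h3⟩)
    refine ⟨insert v Q, ⟨Finset.mem_insert_self _ _, fun r hr => ?_⟩, ?_, ?_⟩
    · rcases Finset.mem_insert.1 hr with rfl | hr
      · exact .refl
      · obtain ⟨u', -, h3, -, h4⟩ := hQ3 r hr
        exact .tail (ReflTransGen.mono (fun a b h => ⟨h.1, Finset.mem_insert_of_mem h.2⟩) _ _ h4)
          ⟨h3, Finset.mem_insert_self _ _⟩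
    · rw [Finset.sum_insert hvQ]; omega
    · rw [Finset.sum_insert hvQ, bestSubtree, if_pos hvb]; exact Nat.add_le_add_left hQ2 _

/-- `R` without its root splits into branches below the children of `v`, and their costs are one of
the divisions of the budget considered by `knapsack`. Cardinality serves as a bound for the height
because a branch lacks `v`. -/
theorem sum_le_bestSubtree (hf : ∀ ⦃u v v'⦄, child u v → child u v' → v = v')
    (hx : ∀ v, ¬ child x v) (hn : ∀ ⦃u v⦄, child u v → u ≤ n) (m v b : ℕ)
    (hv : ReflTransGen child v x) (R : Finset ℕ) (hR : Rooted child v R) (hm : R.card ≤ m)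
    (hb : ∑ r ∈ R, ct r ≤ b) : ∑ r ∈ R, w r ≤ bestSubtree child w ct n m v b := by
  classical
  induction m generalizing v b R with
  | zero => exact absurd hR.1 (by rw [Finset.card_eq_zero.1 (Nat.le_zero.1 hm)]; simp)
  | succ m ih =>
    have hsplit := Finset.add_sum_erase R ct hR.1
    rw [bestSubtree, if_pos (by omega), ← Finset.add_sum_erase R w hR.1]
    refine Nat.add_le_add_left ?_ _
    set g : ℕ → ℕ → ℕ := fun u c => if child u v then bestSubtree child w ct n m u c else 0 with hg
    -- `P u` describes the branch of `R` below the child `u`, and `P'` below collects the branches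
    -- of the children up to `u`.
    let P : ℕ → ℕ → Prop := fun u r =>
      child u v ∧ ReflTransGen (fun a b => child a b ∧ b ∈ R) r u
    have hPR : ∀ u r, r ∈ R → P u r → u ∈ R := by
      intro u r hr h
      rcases ReflTransGen.cases_tail h.2 with rfl | ⟨k, -, hk⟩
      · exact hr
      · exact hk.2
    have hPv : ∀ u, ¬ P u v := fun u h => not_transGen_self hf hx hv
      (TransGen.tail'_iff.2 ⟨u, ReflTransGen.forget h.2, h.1⟩)
    have hgP : ∀ u, ∑ r ∈ R.filter (P u), w r ≤ g u (∑ r ∈ R.filter (P u), ct r) := by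
      intro u
      rcases (R.filter (P u)).eq_empty_or_nonempty with he | ⟨r, hr⟩
      · simp [he]
      obtain ⟨hrR, hr⟩ := Finset.mem_filter.1 hr
      simp only [hg, if_pos hr.1]
      refine ih u _ (.head hr.1 hv) _ ⟨Finset.mem_filter.2 ⟨hPR u r hrR hr, hr.1, .refl⟩, ?_⟩ ?_
        le_rfl
      · intro q hq
        have hp := (Finset.mem_filter.1 hq).2.2
        clear hq
        induction hp using ReflTransGen.head_induction_on with
        | refl => exact .refl
        | @head a b hab hbu ih' =>
          exact .head ⟨hab.1, Finset.mem_filter.2 ⟨hab.2, hr.1, hbu⟩⟩ ih'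
      · have : R.filter (P u) ⊆ R.erase v := fun q hq => by
          obtain ⟨h1, h2⟩ := Finset.mem_filter.1 hq
          exact Finset.mem_erase.2 ⟨fun h => hPv u (h ▸ h2), h1⟩
        have := Finset.card_le_card this
        rw [Finset.card_erase_of_mem hR.1] at this
        omega
    obtain ⟨P', hP'⟩ : ∃ P' : ℕ → ℕ → Prop, ∀ u r, P' u r ↔ ∃ u' ≤ u, P u' r :=
      ⟨_, fun _ _ => Iff.rfl⟩
    have key : ∀ u b, ∑ r ∈ R.filter (P' u), ct r ≤ b →
        ∑ r ∈ R.filter (P' u), w r ≤ knapsack g u b := by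
      intro u
      induction u with
      | zero =>
        intro b hb
        have h0 : R.filter (P' 0) = R.filter (P 0) :=
          Finset.filter_congr fun r _ => by simp [hP']
        rw [h0] at hb ⊢
        exact (hgP 0).trans (le_runMax (fun c => g 0 c) hb)
      | succ u ihu =>
        intro b hb
        have h1 : R.filter (P' (u + 1)) =
            R.filter (P' u) ∪ R.filter (P (u + 1)) := by
          rw [← Finset.filter_or]
          refine Finset.filter_congr fun r _ => ?_
          simp only [hP']
          constructor
          · rintro ⟨u', hu', h⟩
            rcases Nat.le_succ_iff.1 hu' with hu' | rfl
            · exact .inl ⟨u', hu', h⟩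
            · exact .inr h
          · rintro (⟨u', hu', h⟩ | h)
            · exact ⟨u', by omega, h⟩
            · exact ⟨u + 1, le_rfl, h⟩
        have h2 : Disjoint (R.filter (P' u)) (R.filter (P (u + 1))) := by
          rw [Finset.disjoint_left]
          intro r h3 h4
          obtain ⟨u', hu', h3⟩ := (hP' _ _).1 (Finset.mem_filter.1 h3).2
          have h4 := (Finset.mem_filter.1 h4).2
          have := eq_of_common_descendant hf hx hv h3.1 h4.1 (ReflTransGen.forget h3.2)
            (ReflTransGen.forget h4.2)
          omega
        rw [h1, Finset.sum_union h2] at hb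
        rw [h1, Finset.sum_union h2]
        refine le_trans ?_ (le_runMax (fun c => knapsack g u (b - c) + g (u + 1) c)
          (c := ∑ r ∈ R.filter (P (u + 1)), ct r) (by omega))
        exact add_le_add (ihu _ (by omega)) (hgP (u + 1))
    have hfin : R.erase v = R.filter (P' n) := by
      ext r
      rw [Finset.mem_erase, Finset.mem_filter, hP']
      constructor
      · rintro ⟨hrv, hr⟩
        refine ⟨hr, ?_⟩
        rcases ReflTransGen.cases_tail (hR.2 r hr) with h | ⟨u, hru, huv⟩
        · exact absurd h.symm hrv
        · exact ⟨u, hn huv.1, huv.1, hru⟩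
      · rintro ⟨hr, u, -, hu⟩
        exact ⟨fun h => hPv u (h ▸ hu), hr⟩
    rw [hfin]
    exact key n _ (by rw [← hfin]; omega)

/-- The root is affordable by `hct`, so the default value `0` is realized by `{x}`; the bound `hm`
makes the height limit harmless. -/
theorem le_bestSubtree_iff (hf : ∀ ⦃u v v'⦄, child u v → child u v' → v = v')
    (hx : ∀ v, ¬ child x v) (hn : ∀ ⦃u v⦄, child u v → u ≤ n) {m b t : ℕ} (hct : ct x ≤ b)
    (hm : ∀ R, Rooted child x R → R.card ≤ m + 1) :
    t ≤ bestSubtree child w ct n (m + 1) x b ↔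
      ∃ R : Finset ℕ, Rooted child x R ∧ ∑ r ∈ R, ct r ≤ b ∧ t ≤ ∑ r ∈ R, w r := by
  constructor
  · intro h
    rcases exists_rooted_of_bestSubtree (w := w) (ct := ct) (n := n) hf hx (m + 1) x b .refl with
      h0 | ⟨R, h1, h2, h3⟩
    · exact ⟨{x}, ⟨by simp, fun r hr => by rw [Finset.mem_singleton.1 hr]⟩, by simpa using hct,
        by omega⟩
    · exact ⟨R, h1, h2, h.trans h3⟩
  · rintro ⟨R, h1, h2, h3⟩
    exact h3.trans (sum_le_bestSubtree hf hx hn (m + 1) x b .refl R h1 (hm R h1) h2)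

end Tree

/-! ### The algorithm -/

namespace Algo

/-! The functions below refer to an input list `σ` as in `CAVInstance.encode`. -/

variable (σ : ℕ → ℕ)

/-- Nonzero if voter `i` is registered. -/
def rg (i : ℕ) : ℕ := σ (4 + i)

/-- The voting cost of `i`. -/
def vc (i : ℕ) : ℕ := σ (4 + σ 0 + i)

/-- The delegating cost of `i`. -/
def dc (i : ℕ) : ℕ := σ (4 + σ 0 + σ 0 + i)

/-- The entry `(i, j)` of the adjacency matrix. -/
def ad (i j : ℕ) : ℕ := σ (4 + σ 0 + σ 0 + σ 0 + i * σ 0 + j)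

/-- The largest out-neighbour of `i` that is at most `j`, or else the number of voters. -/
def parTab (i : ℕ) : ℕ → ℕ
  | 0 => if i < σ 0 ∧ 0 < σ 0 ∧ ad σ i 0 ≠ 0 then 0 else σ 0
  | j + 1 => if i < σ 0 ∧ j + 1 < σ 0 ∧ ad σ i (j + 1) ≠ 0 then j + 1 else parTab i j

/-- The out-neighbour of `i`, or else the number of voters. -/
def par (i : ℕ) : ℕ := parTab σ i (σ 0)

/-- The next voter on a path of possible delegations between registered voters. -/
def mayNext (i : ℕ) : ℕ :=
  if i < σ 0 ∧ i ≠ σ 1 ∧ dc σ i ≤ vc σ i ∧ rg σ i ≠ 0 ∧ par σ i < σ 0 ∧ rg σ (par σ i) ≠ 0 then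
    par σ i else σ 0

/-- How often the path of possible delegations from `i` visits `j` in `e` steps. -/
def hits (j i e : ℕ) : ℕ := ∑ e' ∈ Finset.range (e + 1), if (mayNext σ)^[e'] i = j then 1 else 0

/-- The number of the registered voters up to `i` who may support `j`. -/
def backers (j i : ℕ) : ℕ :=
  ∑ i' ∈ Finset.range (i + 1), if i' < σ 0 ∧ rg σ i' ≠ 0 ∧ hits σ j i' (σ 0) ≠ 0 then 1 else 0

/-- The next voter on a path of voters for whom voting is more expensive than for `x`. -/
def dearNext (i : ℕ) : ℕ :=
  if i = σ 1 then σ 1 else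
    if i < σ 0 ∧ dc σ i < vc σ i ∧ vc σ (σ 1) + dc σ i < vc σ i + dc σ (σ 1) then par σ i else σ 0

/-- The weight added to voters that have to join `x`. -/
def extra (μ t j : ℕ) : ℕ :=
  if j < σ 0 ∧ ((rg σ j ≠ 0 ∧ j ≠ σ 1 ∧ t ≤ backers σ j (σ 0)) ∨ (μ ≠ 0 ∧ j = par σ (σ 1))) then
    σ 0 + 1 else 0

/-- The weight of a voter. -/
def wt (μ t j : ℕ) : ℕ := 1 + extra σ μ t j

/-- The number of additions needed for a voter. -/
def ct (j : ℕ) : ℕ := if rg σ j = 0 then 1 else 0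

/-- The edges that join voters to `x`. -/
def Child (μ u v : ℕ) : Prop :=
  u < σ 0 ∧ u ≠ σ 1 ∧ dc σ u < vc σ u ∧ par σ u = v ∧
    (μ ≠ 0 ∨ vc σ (σ 1) < dc σ (σ 1) ∨ u ≠ par σ (σ 1))

instance (μ u v : ℕ) : Decidable (Child σ μ u v) := by unfold Child; infer_instance

/-- The largest weight of a subtree. -/
def best (μ t m v b : ℕ) : ℕ := bestSubtree (Child σ μ) (wt σ μ t) (ct σ) (σ 0) m v b

/-- The largest weight of a proper subtree, for a potential child. -/
def gain (μ t m v u c : ℕ) : ℕ := if Child σ μ u v then best σ μ t m u c else 0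

/-- The running maxima in the recursion for `knapsack`. -/
def knapTab (μ t m v u b c : ℕ) : ℕ :=
  runMax (fun c' => (if u = 0 then 0 else knapsack (gain σ μ t m v) (u - 1) (b - c')) +
    gain σ μ t m v u c') c

/-- The weight to be reached. -/
def need (μ t j : ℕ) : ℕ := t + ∑ j' ∈ Finset.range (j + 1), extra σ μ t j'

/-- The conditions on the instance that do not depend on the added voters. -/
def Adm (μ : ℕ) : Prop :=
  (μ ≠ 0 ∧ (dearNext σ)^[σ 0] (par σ (σ 1)) = σ 1) ∨
    (μ = 0 ∧ (vc σ (σ 1) < dc σ (σ 1) ∨ par σ (σ 1) = σ 0 ∨ rg σ (par σ (σ 1)) = 0))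

instance (μ : ℕ) : Decidable (Adm σ μ) := by unfold Adm; infer_instance

/-- The number of `t' ≤ t` for which `x` can be given voting power `t'`, mode `μ`. -/
def successes (μ t : ℕ) : ℕ :=
  ∑ t' ∈ Finset.range (t + 1),
    if Adm σ μ ∧ need σ μ t' (σ 0) ≤ best σ μ t' (σ 0 + 1) (σ 1) (σ 2 - (σ 2 - σ 0)) then 1 else 0

/-- `σ` holds the encoding of `I`. -/
structure Encodes (I : CAVInstance) : Prop where
  n_eq : σ 0 = I.n
  x_eq : σ 1 = I.x
  k_eq : σ 2 = I.k
  rg_iff : ∀ i : Fin I.n, rg σ i ≠ 0 ↔ i ∈ I.registered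
  vc_eq : ∀ i : Fin I.n, vc σ i = I.G.v i
  dc_eq : ∀ i : Fin I.n, dc σ i = I.G.d i
  ad_iff : ∀ i j : Fin I.n, ad σ i j ≠ 0 ↔ (i, j) ∈ I.G.E

variable {σ}

theorem parTab_eq (i j : ℕ) : parTab σ i j = σ 0 ∨
    i < σ 0 ∧ parTab σ i j < σ 0 ∧ ad σ i (parTab σ i j) ≠ 0 := by
  induction j with
  | zero => rw [parTab]; split_ifs with h <;> simp_all
  | succ j ih => rw [parTab]; split_ifs with h <;> simp_all

theorem parTab_ne {i j j' : ℕ} (hj : j' ≤ j) (hi : i < σ 0) (hj' : j' < σ 0)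
    (h : ad σ i j' ≠ 0) : parTab σ i j ≠ σ 0 := by
  induction j with
  | zero =>
    obtain rfl := Nat.le_zero.1 hj
    rw [parTab, if_pos ⟨hi, hj', h⟩]
    exact hj'.ne
  | succ j ih =>
    rw [parTab]
    split_ifs with h'
    · exact h'.2.1.ne
    · rcases Nat.le_succ_iff.1 hj with hj | rfl
      · exact ih hj
      · exact absurd ⟨hi, hj', h⟩ h'

theorem par_le (i : ℕ) : par σ i ≤ σ 0 := by
  rcases parTab_eq (σ := σ) i (σ 0) with h | h
  · exact h.le
  · exact h.2.1.le

/-- Some iterate of `f` reaches `j` if and only if one of the first `n` iterates does. -/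
theorem exists_iterate_le {n : ℕ} {f : ℕ → ℕ} (hf : ∀ i ≤ n, f i ≤ n) {i j e : ℕ} (hi : i ≤ n)
    (h : f^[e] i = j) : ∃ e' ≤ n, f^[e'] i = j := by
  classical
  have hex : ∃ e, f^[e] i = j := ⟨e, h⟩
  refine ⟨Nat.find hex, ?_, Nat.find_spec hex⟩
  by_contra hlt
  have hle : ∀ m, f^[m] i ≤ n := by
    intro m
    induction m with
    | zero => exact hi
    | succ m ih => rw [Function.iterate_succ_apply']; exact hf _ ih
  obtain ⟨a, ha, b, hb, hab, heq⟩ := Finset.exists_ne_map_eq_of_card_lt_of_maps_to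
    (s := Finset.range (n + 2)) (t := Finset.range (n + 1)) (f := fun m => f^[m] i) (by simp)
    (fun m _ => by simpa [Nat.lt_succ_iff] using hle m)
  -- A repetition before the first visit to `j` could be cut out, giving an earlier visit.
  have key : ∀ a b, a < b → b < n + 2 → f^[a] i = f^[b] i → False := by
    intro a b hab hb heq
    refine Nat.find_min hex (m := Nat.find hex - (b - a)) (by omega) ?_
    have h1 : Nat.find hex - (b - a) = Nat.find hex - b + a := by omega
    rw [h1, Function.iterate_add_apply, heq, ← Function.iterate_add_apply]
    have h2 : Nat.find hex - b + b = Nat.find hex := by omega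
    rw [h2]
    exact Nat.find_spec hex
  rw [Finset.mem_range] at ha hb
  rcases lt_or_gt_of_ne hab with h | h
  · exact key a b h hb heq
  · exact key b a h ha heq.symm

/-- The value `n` stands for a missing successor. It is a fixed point, so an orbit that runs into it
never reaches a voter afterwards. -/
theorem exists_iterate_iff {n : ℕ} {f : ℕ → ℕ} (hf : ∀ i, f i ≤ n) (hn : f n = n)
    {r : Fin n → Fin n → Prop} (hr : ∀ i j : Fin n, f i = j ↔ r i j) (i j : Fin n) :
    (∃ e ≤ n, f^[e] i = j) ↔ Relation.ReflTransGen r i j := by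
  constructor
  · rintro ⟨e, -, h⟩
    induction e generalizing i with
    | zero => rw [Fin.ext (show (i : ℕ) = j from h)]
    | succ e ih =>
      rw [Function.iterate_succ_apply] at h
      rcases (hf i).lt_or_eq with hlt | heq
      · exact .head ((hr i ⟨f i, hlt⟩).1 rfl) (ih ⟨f i, hlt⟩ h)
      · rw [heq, Function.iterate_fixed hn] at h
        exact absurd h j.2.ne'
  · intro h
    have : ∃ e, f^[e] i = j := by
      induction h using Relation.ReflTransGen.head_induction_on with
      | refl => exact ⟨0, rfl⟩
      | @head a b hab _ ih =>
        obtain ⟨e, he⟩ := ih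
        exact ⟨e + 1, by rw [Function.iterate_succ_apply, (hr a b).2 hab, he]⟩
    obtain ⟨e, he⟩ := this
    exact exists_iterate_le (fun i _ => hf i) i.2.le he

variable {I : CAVInstance}

namespace Encodes

variable (h : Encodes σ I) (hG : I.G.Functional)
include h hG

theorem par_eq_iff (i j : Fin I.n) : par σ i = j ↔ (i, j) ∈ I.G.E := by
  have key : ∀ j : Fin I.n, par σ i = j → (i, j) ∈ I.G.E := by
    intro j hj
    rcases parTab_eq (σ := σ) i (σ 0) with h' | h'
    · exact absurd (hj.symm.trans h') (by rw [h.n_eq]; exact j.2.ne)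
    · have h3 := h'.2.2
      change ad σ i (par σ i) ≠ 0 at h3
      rw [hj] at h3
      exact (h.ad_iff i j).1 h3
  refine ⟨key j, fun hij => ?_⟩
  have h1 : par σ i ≠ σ 0 := parTab_ne (j' := j) (by rw [h.n_eq]; exact j.2.le)
    (by rw [h.n_eq]; exact i.2) (by rw [h.n_eq]; exact j.2) ((h.ad_iff i j).2 hij)
  have h2 := (par_le (σ := σ) i).lt_of_ne h1
  rw [h.n_eq] at h2
  rw [hG hij (key ⟨_, h2⟩ rfl)]

theorem par_eq_n_iff (i : Fin I.n) : par σ i = σ 0 ↔ ∀ j, (i, j) ∉ I.G.E := by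
  constructor
  · intro h' j hj
    rw [(h.par_eq_iff hG i j).2 hj, h.n_eq] at h'
    exact j.2.ne h'
  · intro h'
    by_contra hne
    have h2 := (par_le (σ := σ) i).lt_of_ne hne
    rw [h.n_eq] at h2
    exact h' ⟨_, h2⟩ ((h.par_eq_iff hG i ⟨_, h2⟩).1 rfl)

theorem mayNext_eq_iff (i j : Fin I.n) :
    mayNext σ i = j ↔ (I.G.restrict I.registered).MayStep I.x i j := by
  have hn := h.n_eq
  have hx : (i : ℕ) ≠ σ 1 ↔ i ≠ I.x := by rw [h.x_eq, ne_eq, ← Fin.ext_iff]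
  rw [Election.MayStep, Election.mem_restrict_E, ← h.par_eq_iff hG i j, ← h.rg_iff i,
    ← h.rg_iff j, ← hx]
  change _ ↔ _ ∧ I.G.d i ≤ I.G.v i ∧ _
  rw [← h.vc_eq, ← h.dc_eq, mayNext]
  split_ifs with hc
  · constructor
    · intro hp
      rw [hp] at hc
      exact ⟨⟨hp, hc.2.2.2.1, hc.2.2.2.2.2⟩, hc.2.2.1, hc.2.1⟩
    · exact fun h' => h'.1.1
  · constructor
    · intro h'
      exact absurd h' (by rw [hn]; exact j.2.ne')
    · rintro ⟨⟨h1, h2, h3⟩, h4, h5⟩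
      refine absurd ⟨by rw [hn]; exact i.2, h5, h4, h2, ?_, ?_⟩ hc
      · rw [h1, hn]; exact j.2
      · rwa [h1]

theorem hits_ne_zero_iff (i j : Fin I.n) : hits σ j i (σ 0) ≠ 0 ↔
    Relation.ReflTransGen ((I.G.restrict I.registered).MayStep I.x) i j := by
  rw [← exists_iterate_iff (f := mayNext σ) ?_ ?_ (h.mayNext_eq_iff hG), h.n_eq]
  · simp [hits]
  · intro i
    rw [mayNext, ← h.n_eq]
    split_ifs
    · exact par_le _
    · exact le_rfl
  · rw [mayNext, if_neg (by rw [h.n_eq]; simp), h.n_eq]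

theorem backers_eq (j : Fin I.n) :
    backers σ j (σ 0) = ((I.G.restrict I.registered).backing I.x j).card := by
  classical
  rw [backers, Finset.sum_range_succ, if_neg (by simp), add_zero, h.n_eq, Finset.sum_range,
    ← Finset.card_filter]
  congr 1
  ext i
  have h1 := h.hits_ne_zero_iff hG i j
  rw [h.n_eq] at h1
  rw [Finset.mem_filter, Election.mem_backing, Election.mem_restrict_N I.N_eq, h1, h.rg_iff]
  simp

/-- Since `x` is made a fixed point of `dearNext`, an orbit that arrives at `x` stays there, and the
`n`-th iterate alone decides whether it arrives. -/
theorem chain_iff : (dearNext σ)^[σ 0] (par σ (σ 1)) = σ 1 ↔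
    ∃ y, (I.x, y) ∈ I.G.E ∧ Relation.ReflTransGen (I.G.DearStep I.x) y I.x := by
  have hn := h.n_eq
  have hx := h.x_eq
  have hxn : (I.x : ℕ) < σ 0 := by rw [hn]; exact I.x.2
  have hfix : dearNext σ (σ 1) = σ 1 := by rw [dearNext, if_pos rfl]
  have hfn : dearNext σ I.n = I.n := by
    rw [dearNext, if_neg (by rw [hx]; exact I.x.2.ne'), if_neg (by rw [hn]; simp), hn]
  have hr : ∀ i j : Fin I.n, dearNext σ i = j ↔
      (I.G.DearStep I.x i j ∨ i = I.x ∧ j = I.x) := by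
    intro i j
    rw [dearNext, Election.DearStep, ← h.par_eq_iff hG i j, ← h.vc_eq, ← h.dc_eq, ← h.vc_eq,
      ← h.dc_eq, hx]
    by_cases hix : i = I.x
    · simp [hix, Fin.ext_iff, eq_comm]
    · rw [if_neg (by rwa [Fin.val_inj])]
      split_ifs with hc
      · simp [hix, hc.2.1, hc.2.2]
      · constructor
        · intro h'
          exact absurd h' (by rw [hn]; exact j.2.ne')
        · rintro (⟨-, -, h3⟩ | h3)
          · exact absurd ⟨by rw [hn]; exact i.2, h3⟩ hc
          · exact absurd h3.1 hix
  have hle : ∀ i, dearNext σ i ≤ I.n := by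
    intro i
    rw [dearNext, ← hn]
    split_ifs
    · rw [hx]; exact hxn.le
    · exact par_le _
    · exact le_rfl
  have hpath : ∀ y : Fin I.n, (dearNext σ)^[σ 0] y = σ 1 ↔
      Relation.ReflTransGen (I.G.DearStep I.x) y I.x := by
    intro y
    have h1 : Relation.ReflTransGen (I.G.DearStep I.x) y I.x ↔ Relation.ReflTransGen
        (fun i j => I.G.DearStep I.x i j ∨ i = I.x ∧ j = I.x) y I.x := by
      constructor
      · exact Relation.ReflTransGen.mono (fun _ _ h => .inl h) _ _
      · intro hp
        induction hp using Relation.ReflTransGen.head_induction_on with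
        | refl => exact .refl
        | @head a b hab _ ih =>
          rcases hab with hab | ⟨rfl, -⟩
          · exact .head hab ih
          · exact .refl
    rw [h1, ← exists_iterate_iff hle hfn hr, hx, hn]
    constructor
    · exact fun h' => ⟨I.n, le_rfl, h'⟩
    · rintro ⟨e, he, h'⟩
      obtain ⟨c, hc⟩ := Nat.exists_eq_add_of_le he
      have h2 : ∀ m, m = c + e → (dearNext σ)^[m] y = I.x := by
        rintro m rfl
        rw [Function.iterate_add_apply, h', ← hx]
        exact Function.iterate_fixed hfix c
      exact h2 _ (by omega)
  constructor
  · intro h'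
    rcases (par_le (σ := σ) (σ 1)).lt_or_eq with hlt | heq
    · rw [hn] at hlt
      refine ⟨⟨_, hlt⟩, (h.par_eq_iff hG _ _).1 (congrArg (par σ) hx.symm), (hpath ⟨_, hlt⟩).1 h'⟩
    · rw [heq, hn, Function.iterate_fixed hfn, hx] at h'
      exact absurd h' I.x.2.ne'
  · rintro ⟨y, hy, hp⟩
    rw [hx, (h.par_eq_iff hG _ _).2 hy, ← hx]
    exact (hpath y).2 hp

theorem adm_iff (μ : ℕ) : Adm σ μ ↔ I.G.Admissible I.x I.registered (μ ≠ 0) := by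
  rw [Adm, h.chain_iff hG, Election.Admissible, h.x_eq, h.vc_eq, h.dc_eq, ne_eq, not_not]
  have : (par σ I.x = σ 0 ∨ rg σ (par σ I.x) = 0) ↔ ∀ y, (I.x, y) ∈ I.G.E → y ∉ I.registered := by
    rcases (par_le (σ := σ) I.x).lt_or_eq with hlt | heq
    · have hlt' := hlt
      rw [h.n_eq] at hlt'
      have hE := (h.par_eq_iff hG I.x ⟨_, hlt'⟩).1 rfl
      have h1 : (∀ y, (I.x, y) ∈ I.G.E → y ∉ I.registered) ↔ ⟨_, hlt'⟩ ∉ I.registered :=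
        ⟨fun h' => h' _ hE, fun h' y hy => by rwa [hG hy hE]⟩
      rw [h1, ← h.rg_iff, not_not]
      simp [hlt.ne]
    · have := (h.par_eq_n_iff hG I.x).1 heq
      simp [heq, this]
  rw [this]

open Classical in
theorem extra_eq (μ t : ℕ) (j : Fin I.n) : extra σ μ t j =
    if I.G.MustJoin I.x I.registered (μ ≠ 0) t j then Fintype.card (Fin I.n) + 1 else 0 := by
  have hn : Fintype.card (Fin I.n) = σ 0 := by rw [Fintype.card_fin, h.n_eq]
  rw [extra, hn]
  refine if_congr ?_ rfl rfl
  rw [Election.MustJoin, h.backers_eq hG, h.rg_iff, h.x_eq, ← h.par_eq_iff hG, h.n_eq,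
    eq_comm (a := (j : ℕ)) (b := par σ I.x), ne_eq (j : ℕ), Fin.val_inj]
  simp

theorem child_iff (μ : ℕ) (u v : Fin I.n) :
    Child σ μ u v ↔ I.G.JoinStep I.x (μ ≠ 0) u v := by
  rw [Child, Election.JoinStep, Election.SureStep, h.par_eq_iff hG, h.x_eq, h.n_eq, h.vc_eq,
    h.vc_eq, h.dc_eq, h.dc_eq, ← h.par_eq_iff hG I.x u, eq_comm (a := par σ I.x), ne_eq,
    Fin.val_inj]
  simp only [u.2, true_and]
  tauto

theorem rooted_iff (μ : ℕ) (R : Finset (Fin I.n)) :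
    Rooted (Child σ μ) I.x (R.map Fin.valEmbedding) ↔ Rooted (I.G.JoinStep I.x (μ ≠ 0)) I.x R := by
  have hmem : ∀ i : Fin I.n, (i : ℕ) ∈ R.map Fin.valEmbedding ↔ i ∈ R := fun i =>
    Finset.mem_map' Fin.valEmbedding
  constructor
  · rintro ⟨h1, h2⟩
    refine ⟨(hmem _).1 h1, fun r hr => ?_⟩
    have key : ∀ a : ℕ, Relation.ReflTransGen
        (fun a b => Child σ μ a b ∧ b ∈ R.map Fin.valEmbedding) a I.x →
        ∀ a' : Fin I.n, (a' : ℕ) = a → Relation.ReflTransGen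
          (fun a b => I.G.JoinStep I.x (μ ≠ 0) a b ∧ b ∈ R) a' I.x := by
      intro a ha
      induction ha using Relation.ReflTransGen.head_induction_on with
      | refl => intro a' ha'; rw [Fin.ext ha']
      | @head a b hab _ ih =>
        rintro a' rfl
        obtain ⟨b', hb', rfl⟩ := Finset.mem_map.1 hab.2
        exact .head ⟨(h.child_iff hG μ a' b').1 hab.1, hb'⟩ (ih b' rfl)
    exact key r (h2 r ((hmem r).2 hr)) r rfl
  · rintro ⟨h1, h2⟩
    refine ⟨(hmem _).2 h1, fun r hr => ?_⟩
    obtain ⟨r', hr', rfl⟩ := Finset.mem_map.1 hr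
    have hp := h2 r' hr'
    clear hr hr'
    induction hp using Relation.ReflTransGen.head_induction_on with
    | refl => exact .refl
    | @head a b hab _ ih =>
      exact .head ⟨(h.child_iff hG μ a b).2 hab.1, (hmem b).2 hab.2⟩ ih

/-- Costs count unregistered members of `R`, and weights encode its size and the forced voters;
height `n + 1` suffices because a rooted set has at most `n` vertices. -/
theorem success_iff (μ t : ℕ) :
    need σ μ t (σ 0) ≤ best σ μ t (σ 0 + 1) (σ 1) (σ 2 - (σ 2 - σ 0)) ↔
      ∃ R : Finset (Fin I.n), Rooted (I.G.JoinStep I.x (μ ≠ 0)) I.x R ∧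
        (R \ I.registered).card ≤ I.k ∧
        (∀ j, I.G.MustJoin I.x I.registered (μ ≠ 0) t j → j ∈ R) ∧ t ≤ R.card := by
  classical
  have hn := h.n_eq
  have hsub : ∀ R, Rooted (Child σ μ) (σ 1) R → R ⊆ Finset.range (σ 0) := by
    rintro R ⟨-, h2⟩ r hr
    rw [Finset.mem_range]
    rcases Relation.ReflTransGen.cases_head (h2 r hr) with rfl | ⟨b, hb, -⟩
    · rw [h.x_eq, hn]; exact I.x.2
    · exact hb.1.1
  have hct : ct σ (σ 1) = 0 := by
    rw [ct, if_neg]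
    rw [h.x_eq]
    exact (h.rg_iff I.x).2 I.x_mem
  have hneed : need σ μ t (σ 0) = t + ∑ j : Fin I.n,
      (if I.G.MustJoin I.x I.registered (μ ≠ 0) t j then Fintype.card (Fin I.n) + 1 else 0) := by
    rw [need, Finset.sum_range_succ]
    have : extra σ μ t (σ 0) = 0 := by rw [extra, if_neg (by simp)]
    rw [this, add_zero, hn, Finset.sum_range]
    simp only [h.extra_eq hG]
  rw [best, le_bestSubtree_iff (x := σ 1) (fun u v v' h1 h2 => h1.2.2.2.1.symm.trans h2.2.2.2.1)
    (fun v hv => hv.2.1 rfl) (fun u v huv => huv.1.le) (by rw [hct]; exact Nat.zero_le _)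
    (fun R hR => (Finset.card_le_card (hsub R hR)).trans (by simp))]
  have hctR : ∀ R : Finset (Fin I.n),
      ∑ r ∈ R.map Fin.valEmbedding, ct σ r = (R \ I.registered).card := by
    intro R
    rw [Finset.sum_map, Finset.card_eq_sum_ones, Finset.sdiff_eq_filter, Finset.sum_filter]
    refine Finset.sum_congr rfl fun i _ => ?_
    rw [ct]
    refine if_congr ?_ rfl rfl
    rw [← h.rg_iff, not_not]
    rfl
  have hwtR : ∀ R : Finset (Fin I.n), ∑ r ∈ R.map Fin.valEmbedding, wt σ μ t r =
      ∑ j ∈ R, (1 + if I.G.MustJoin I.x I.registered (μ ≠ 0) t j then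
        Fintype.card (Fin I.n) + 1 else 0) := by
    intro R
    rw [Finset.sum_map]
    refine Finset.sum_congr rfl fun i _ => ?_
    rw [← h.extra_eq hG]
    rfl
  simp only [subset_and_le_card_iff]
  rw [hneed]
  constructor
  · rintro ⟨R', h1, h2, h3⟩
    obtain ⟨R, rfl⟩ : ∃ R : Finset (Fin I.n), R' = R.map Fin.valEmbedding := by
      refine ⟨Finset.univ.filter fun i => (i : ℕ) ∈ R', ?_⟩
      ext r
      simp only [Finset.mem_map, Finset.mem_filter, Finset.mem_univ, true_and,
        Fin.valEmbedding_apply]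
      refine ⟨fun hr => ⟨⟨r, ?_⟩, hr, rfl⟩, ?_⟩
      · rw [← hn]; exact Finset.mem_range.1 (hsub R' h1 hr)
      · rintro ⟨i, hi, rfl⟩; exact hi
    rw [hctR, h.k_eq] at h2
    rw [hwtR] at h3
    rw [h.x_eq] at h1
    exact ⟨R, (h.rooted_iff hG μ R).1 h1, by omega, h3⟩
  · rintro ⟨R, h1, h2, h3⟩
    refine ⟨R.map Fin.valEmbedding, ?_, ?_, ?_⟩
    · rw [h.x_eq]; exact (h.rooted_iff hG μ R).2 h1
    · rw [hctR, h.k_eq, hn]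
      -- The budget is `min k n`, expressed by truncated subtraction. The number `k` is given in
      -- binary and may be huge, but more than `n` additions are never needed.
      have : (R \ I.registered).card ≤ I.n := (Finset.card_le_univ _).trans (by simp)
      omega
    · rwa [hwtR]

theorem isYes_iff : I.IsYes ↔ successes σ 0 (σ 0) + successes σ 1 (σ 0) ≠ 0 := by
  have hsucc : ∀ μ, successes σ μ (σ 0) ≠ 0 ↔ I.G.Admissible I.x I.registered (μ ≠ 0) ∧
      ∃ t ≤ Fintype.card (Fin I.n), ∃ R : Finset (Fin I.n),
        Rooted (I.G.JoinStep I.x (μ ≠ 0)) I.x R ∧ (R \ I.registered).card ≤ I.k ∧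
        (∀ j, I.G.MustJoin I.x I.registered (μ ≠ 0) t j → j ∈ R) ∧ t ≤ R.card := by
    intro μ
    simp only [← h.success_iff hG, ← h.adm_iff hG, Fintype.card_fin, ← h.n_eq]
    simp only [successes, ne_eq, Finset.sum_eq_zero_iff, Finset.mem_range, Nat.lt_succ_iff]
    simp
    tauto
  have hor : successes σ 0 (σ 0) + successes σ 1 (σ 0) ≠ 0 ↔
      successes σ 0 (σ 0) ≠ 0 ∨ successes σ 1 (σ 0) ≠ 0 := by omega
  rw [hor, hsucc, hsucc, CAVInstance.IsYes, CAVInstance.unregistered,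
    Election.control_iff hG I.N_eq I.x_mem]
  constructor
  · rintro ⟨μ, hμ⟩
    by_cases h' : μ
    · right
      have : μ = ((1 : ℕ) ≠ 0) := by simp [h']
      rwa [this] at hμ
    · left
      have : μ = ((0 : ℕ) ≠ 0) := by simp [h']
      rwa [this] at hμ
  · rintro (h' | h')
    · exact ⟨_, h'⟩
    · exact ⟨_, h'⟩

end Encodes

end Algo

/-! ### Conditions, table lookups and correctness of filled tables -/

namespace RAM

/-- A predicate that can be decided by evaluating an arithmetic expression. -/
def IsCond (p : State → Prop) : Prop := ∃ g, IsExpr g ∧ ∀ s, g s ≠ 0 ↔ p s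

namespace IsCond

variable {p q : State → Prop} {α β : State → ℕ}

theorem lt (hα : IsExpr α) (hβ : IsExpr β) : IsCond (fun s => α s < β s) :=
  ⟨_, hβ.sub hα, fun s => by omega⟩

theorem le (hα : IsExpr α) (hβ : IsExpr β) : IsCond (fun s => α s ≤ β s) :=
  ⟨_, (hβ.add (.lit 1)).sub hα, fun s => by omega⟩

theorem ne (hα : IsExpr α) (hβ : IsExpr β) : IsCond (fun s => α s ≠ β s) :=
  ⟨_, (hα.sub hβ).add (hβ.sub hα), fun s => by omega⟩

theorem eq (hα : IsExpr α) (hβ : IsExpr β) : IsCond (fun s => α s = β s) :=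
  ⟨_, (IsExpr.lit 1).sub ((hα.sub hβ).add (hβ.sub hα)), fun s => by omega⟩

theorem and (hp : IsCond p) (hq : IsCond q) : IsCond (fun s => p s ∧ q s) := by
  obtain ⟨g, hg, h⟩ := hp
  obtain ⟨g', hg', h'⟩ := hq
  exact ⟨_, hg.mul hg', fun s => by rw [mul_ne_zero_iff, h, h']⟩

theorem or (hp : IsCond p) (hq : IsCond q) : IsCond (fun s => p s ∨ q s) := by
  obtain ⟨g, hg, h⟩ := hp
  obtain ⟨g', hg', h'⟩ := hq
  exact ⟨_, hg.add hg', fun s => (by omega : g s + g' s ≠ 0 ↔ g s ≠ 0 ∨ g' s ≠ 0).trans (or_congr (h s) (h' s))⟩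

end IsCond

theorem IsTree.cond {p : State → Prop} [∀ s, Decidable (p s)] {φ ψ : State → ℕ} (hp : IsCond p)
    (hφ : IsTree φ) (hψ : IsTree ψ) : IsTree (fun s => if p s then φ s else ψ s) := by
  obtain ⟨g, hg, h⟩ := hp
  convert IsTree.ite hg hφ hψ using 2 with s
  exact if_congr (h s).symm rfl rfl

/-- The entry with index `τ` of the table in bank `T`. -/
def look (s : State) (T : ℕ) (τ : List ℕ) : ℕ := s T (enc (s 0 0 + 1) 0 τ)

theorem IsExpr.size : IsExpr (fun s => s 0 0) := .read 0 (.lit 0)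

theorem IsExpr.encList {B α : State → ℕ} (hB : IsExpr B) (hα : IsExpr α)
    {l : List (State → ℕ)} (hl : ∀ β ∈ l, IsExpr β) :
    IsExpr (fun s => RAM.enc (B s) (α s) (l.map fun β => β s)) := by
  induction l generalizing α with
  | nil => exact hα
  | cons β l ih =>
    exact ih ((hα.mul hB).add (hl β List.mem_cons_self))
      fun γ hγ => hl γ (List.mem_cons_of_mem _ hγ)

theorem IsLin.look (T : ℕ) {l : List (State → ℕ)} (hl : ∀ β ∈ l, IsExpr β) :
    IsLin (fun s => RAM.look s T (l.map fun β => β s)) :=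
  .read T (.encList (.add .size (.lit 1)) (.lit 0) hl)

theorem IsLin.look₁ (T : ℕ) {α : State → ℕ} (hα : IsExpr α) :
    IsLin (fun s => RAM.look s T [α s]) :=
  IsLin.look T (l := [α]) (by simpa using hα)

theorem IsLin.look₂ (T : ℕ) {α β : State → ℕ} (hα : IsExpr α) (hβ : IsExpr β) :
    IsLin (fun s => RAM.look s T [α s, β s]) :=
  IsLin.look T (l := [α, β]) (by simpa using ⟨hα, hβ⟩)

theorem IsLin.look₃ (T : ℕ) {α β γ : State → ℕ} (hα : IsExpr α) (hβ : IsExpr β)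
    (hγ : IsExpr γ) : IsLin (fun s => RAM.look s T [α s, β s, γ s]) :=
  IsLin.look T (l := [α, β, γ]) (by simpa using ⟨hα, hβ, hγ⟩)

theorem IsLin.look₇ (T : ℕ) {α₁ α₂ α₃ α₄ α₅ α₆ α₇ : State → ℕ} (h₁ : IsExpr α₁)
    (h₂ : IsExpr α₂) (h₃ : IsExpr α₃) (h₄ : IsExpr α₄) (h₅ : IsExpr α₅) (h₆ : IsExpr α₆)
    (h₇ : IsExpr α₇) :
    IsLin (fun s => RAM.look s T [α₁ s, α₂ s, α₃ s, α₄ s, α₅ s, α₆ s, α₇ s]) :=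
  IsLin.look T (l := [α₁, α₂, α₃, α₄, α₅, α₆, α₇]) (by simpa using ⟨h₁, h₂, h₃, h₄, h₅, h₆, h₇⟩)

theorem IsExpr.look₁ (T : ℕ) {α : State → ℕ} (hα : IsExpr α) :
    IsExpr (fun s => RAM.look s T [α s]) := (IsLin.look₁ T hα).1

theorem IsExpr.look₂ (T : ℕ) {α β : State → ℕ} (hα : IsExpr α) (hβ : IsExpr β) :
    IsExpr (fun s => RAM.look s T [α s, β s]) := (IsLin.look₂ T hα hβ).1

theorem IsExpr.look₃ (T : ℕ) {α β γ : State → ℕ} (hα : IsExpr α) (hβ : IsExpr β)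
    (hγ : IsExpr γ) : IsExpr (fun s => RAM.look s T [α s, β s, γ s]) := (IsLin.look₃ T hα hβ hγ).1

theorem IsExpr.look₇ (T : ℕ) {α₁ α₂ α₃ α₄ α₅ α₆ α₇ : State → ℕ} (h₁ : IsExpr α₁)
    (h₂ : IsExpr α₂) (h₃ : IsExpr α₃) (h₄ : IsExpr α₄) (h₅ : IsExpr α₅) (h₆ : IsExpr α₆)
    (h₇ : IsExpr α₇) :
    IsExpr (fun s => RAM.look s T [α₁ s, α₂ s, α₃ s, α₄ s, α₅ s, α₆ s, α₇ s]) :=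
  (IsLin.look₇ T h₁ h₂ h₃ h₄ h₅ h₆ h₇).1

/-- Bank `T` is the table of the function `F` of `r` arguments. -/
def Holds (T r : ℕ) (F : List ℕ → ℕ) (s : State) : Prop :=
  ∀ τ, IsTuple (s 0 0) r τ → look s T τ = F τ

theorem Holds.of_eq {T r : ℕ} {F : List ℕ → ℕ} {s s' : State} (h : Holds T r F s)
    (h0 : s' 0 = s 0) (hT : s' T = s T) : Holds T r F s' := by
  intro τ hτ
  rw [look, h0, hT]
  exact h τ (by rwa [← h0])

theorem holds_fill {T : ℕ} {as : List ℕ} {φ : State → ℕ} {F : List ℕ → ℕ} {s₀ : State}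
    (hT : T ≠ 0) (hTa : T ∉ as) (h0 : 0 ∉ as) (hnd : as.Nodup)
    (hφ : ∀ s, s 0 = s₀ 0 → (∀ b, b ≠ T → b ∉ as → s b = s₀ b) → (∀ a ∈ as, s a 0 ≤ s 0 0) →
      (∀ τ, IsTuple (s 0 0) as.length τ →
        enc (s 0 0 + 1) 0 τ < enc (s 0 0 + 1) 0 (as.map fun a => s a 0) → look s T τ = F τ) →
      φ s = F (as.map fun a => s a 0)) :
    Holds T as.length F (fill T as φ s₀) := by
  intro τ hτ
  have h : fill T as φ s₀ 0 = s₀ 0 := fill_bank hT.symm h0 _ _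
  rw [look, h]
  rw [h] at hτ
  refine fill_eq hT hTa h0 hnd (fun s hs hle hprev => ?_) hτ
  have hs0 : s 0 = s₀ 0 := hs 0 hT.symm h0
  refine hφ s hs0 hs (by rwa [hs0]) ?_
  rw [hs0]
  simpa only [look, hs0] using hprev

end RAM

namespace Algo

open RAM

/-! ### The tables -/

/-- The entry of the table of `parTab`. -/
def parCell (s : State) : ℕ :=
  if s 20 0 < s 0 0 ∧ s 21 0 < s 0 0 ∧ ad (s 0) (s 20 0) (s 21 0) ≠ 0 then s 21 0
  else if s 21 0 = 0 then s 0 0 else look s 3 [s 20 0, s 21 0 - 1]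

/-- The entry of the table of `mayNext`. -/
def mayCell (s : State) : ℕ :=
  if s 20 0 < s 0 0 ∧ s 20 0 ≠ s 0 1 ∧ dc (s 0) (s 20 0) ≤ vc (s 0) (s 20 0) ∧
      rg (s 0) (s 20 0) ≠ 0 ∧ look s 3 [s 20 0, s 0 0] < s 0 0 ∧
      rg (s 0) (look s 3 [s 20 0, s 0 0]) ≠ 0 then
    look s 3 [s 20 0, s 0 0] else s 0 0

/-- The entry of the table of the iterates of `mayNext`. -/
def walkCell (s : State) : ℕ :=
  if s 21 0 = 0 then s 20 0 else look s 4 [look s 5 [s 20 0, s 21 0 - 1]]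

/-- The entry of the table of `hits`. -/
def hitsCell (s : State) : ℕ :=
  (if s 22 0 = 0 then 0 else look s 6 [s 20 0, s 21 0, s 22 0 - 1]) +
    if look s 5 [s 21 0, s 22 0] = s 20 0 then 1 else 0

/-- The entry of the table of `backers`. -/
def backersCell (s : State) : ℕ :=
  (if s 21 0 = 0 then 0 else look s 7 [s 20 0, s 21 0 - 1]) +
    if s 21 0 < s 0 0 ∧ rg (s 0) (s 21 0) ≠ 0 ∧ look s 6 [s 20 0, s 21 0, s 0 0] ≠ 0 then 1 else 0

/-- The entry of the table of `dearNext`. -/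
def dearCell (s : State) : ℕ :=
  if s 20 0 = s 0 1 then s 0 1 else
    if s 20 0 < s 0 0 ∧ dc (s 0) (s 20 0) < vc (s 0) (s 20 0) ∧
        vc (s 0) (s 0 1) + dc (s 0) (s 20 0) < vc (s 0) (s 20 0) + dc (s 0) (s 0 1) then
      look s 3 [s 20 0, s 0 0] else s 0 0

/-- The entry of the table of the iterates of `dearNext`. -/
def chainCell (s : State) : ℕ :=
  if s 20 0 = 0 then look s 3 [s 0 1, s 0 0] else look s 8 [look s 9 [s 20 0 - 1]]

/-- The entry of the table of `extra`. -/
def extraCell (s : State) : ℕ :=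
  if s 22 0 < s 0 0 ∧ ((rg (s 0) (s 22 0) ≠ 0 ∧ s 22 0 ≠ s 0 1 ∧
      s 21 0 ≤ look s 7 [s 22 0, s 0 0]) ∨ (s 20 0 ≠ 0 ∧ s 22 0 = look s 3 [s 0 1, s 0 0])) then
    s 0 0 + 1 else 0

/-- The entry of the table of `need`. -/
def needCell (s : State) : ℕ :=
  (if s 22 0 = 0 then s 21 0 else look s 11 [s 20 0, s 21 0, s 22 0 - 1]) +
    look s 10 [s 20 0, s 21 0, s 22 0]

/-- The value that is compared with the previous ones in `knapTab`. -/
def gainCell (s : State) : ℕ :=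
  (if s 24 0 = 0 then 0 else look s 12 [s 20 0, s 21 0, s 22 0, s 23 0, s 24 0 - 1,
      s 25 0 - s 26 0, s 25 0 - s 26 0]) +
    if s 24 0 < s 0 0 ∧ s 24 0 ≠ s 0 1 ∧ dc (s 0) (s 24 0) < vc (s 0) (s 24 0) ∧
        look s 3 [s 24 0, s 0 0] = s 23 0 ∧ (s 20 0 ≠ 0 ∨ vc (s 0) (s 0 1) < dc (s 0) (s 0 1) ∨
          s 24 0 ≠ look s 3 [s 0 1, s 0 0]) then
      if s 22 0 = 0 then 0 else
        if 1 - rg (s 0) (s 24 0) ≤ s 26 0 then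
          (1 + look s 10 [s 20 0, s 21 0, s 24 0]) + look s 12 [s 20 0, s 21 0, s 22 0 - 1, s 24 0,
            s 0 0, s 26 0 - (1 - rg (s 0) (s 24 0)), s 26 0 - (1 - rg (s 0) (s 24 0))]
        else 0
    else 0

/-- The entry of the table of `knapTab`. -/
def knapCell (s : State) : ℕ :=
  if s 26 0 = 0 then gainCell s else
    max (look s 12 [s 20 0, s 21 0, s 22 0, s 23 0, s 24 0, s 25 0, s 26 0 - 1]) (gainCell s)

/-- The entry of the table of `successes`. -/
def successCell (s : State) : ℕ :=
  (if s 21 0 = 0 then 0 else look s 13 [s 20 0, s 21 0 - 1]) +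
    if (s 20 0 ≠ 0 ∧ look s 9 [s 0 0] = s 0 1) ∨ (s 20 0 = 0 ∧
        (vc (s 0) (s 0 1) < dc (s 0) (s 0 1) ∨ look s 3 [s 0 1, s 0 0] = s 0 0 ∨
          rg (s 0) (look s 3 [s 0 1, s 0 0]) = 0)) then
      if 1 - rg (s 0) (s 0 1) ≤ s 0 2 - (s 0 2 - s 0 0) then
        if look s 11 [s 20 0, s 21 0, s 0 0] ≤ (1 + look s 10 [s 20 0, s 21 0, s 0 1]) +
          look s 12 [s 20 0, s 21 0, s 0 0, s 0 1, s 0 0,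
            s 0 2 - (s 0 2 - s 0 0) - (1 - rg (s 0) (s 0 1)),
            s 0 2 - (s 0 2 - s 0 0) - (1 - rg (s 0) (s 0 1))] then 1 else 0
      else if look s 11 [s 20 0, s 21 0, s 0 0] ≤ 0 then 1 else 0
    else 0

/-- The answer. -/
def answerCell (s : State) : ℕ :=
  if look s 13 [0, s 0 0] + look s 13 [1, s 0 0] ≠ 0 then 1 else 0

theorem isExpr_rg {α : State → ℕ} (hα : IsExpr α) : IsExpr (fun s => rg (s 0) (α s)) :=
  .read 0 (.add (.lit 4) hα)

theorem isExpr_vc {α : State → ℕ} (hα : IsExpr α) : IsExpr (fun s => vc (s 0) (α s)) :=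
  .read 0 (.add (.add (.lit 4) .size) hα)

theorem isExpr_dc {α : State → ℕ} (hα : IsExpr α) : IsExpr (fun s => dc (s 0) (α s)) :=
  .read 0 (.add (.add (.add (.lit 4) .size) .size) hα)

theorem isExpr_ad {α β : State → ℕ} (hα : IsExpr α) (hβ : IsExpr β) :
    IsExpr (fun s => ad (s 0) (α s) (β s)) :=
  .read 0 (.add (.add (.add (.add (.add (.lit 4) .size) .size) .size) (.mul hα .size)) hβ)

/-- Products and differences occur only in addresses and conditions; the stored values are
constants, cell contents and sums or maxima of these. -/
theorem isTree_cells : IsTree parCell ∧ IsTree mayCell ∧ IsTree walkCell ∧ IsTree hitsCell ∧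
    IsTree backersCell ∧ IsTree dearCell ∧ IsTree chainCell ∧ IsTree extraCell ∧
    IsTree needCell ∧ IsTree knapCell ∧ IsTree successCell ∧ IsTree answerCell := by
  refine ⟨?_, ?_, ?_, ?_, ?_, ?_, ?_, ?_, ?_, ?_, ?_, ?_⟩
  on_goal 1 => unfold parCell
  on_goal 2 => unfold mayCell
  on_goal 3 => unfold walkCell
  on_goal 4 => unfold hitsCell
  on_goal 5 => unfold backersCell
  on_goal 6 => unfold dearCell
  on_goal 7 => unfold chainCell
  on_goal 8 => unfold extraCell
  on_goal 9 => unfold needCell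
  on_goal 10 => unfold knapCell gainCell
  on_goal 11 => unfold successCell
  on_goal 12 => unfold answerCell
  all_goals with_reducible repeat' first
    | exact IsLin.lit _
    | exact IsExpr.lit _
    | apply isExpr_rg
    | apply isExpr_vc
    | apply isExpr_dc
    | apply isExpr_ad
    | apply IsTree.cond
    | apply IsTree.max
    | apply IsTree.add
    | apply IsTree.lin
    | apply IsCond.and
    | apply IsCond.or
    | apply IsCond.lt
    | apply IsCond.le
    | apply IsCond.ne
    | apply IsCond.eq
    | apply IsLin.look₁
    | apply IsLin.look₂
    | apply IsLin.look₃
    | apply IsLin.look₇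
    | apply IsExpr.look₁
    | apply IsExpr.look₂
    | apply IsExpr.look₃
    | apply IsExpr.look₇
    | apply IsLin.read
    | apply IsExpr.add
    | apply IsExpr.sub
    | apply IsExpr.mul
    | apply IsExpr.read

theorem holds_parTab (s₀ : State) :
    Holds 3 2 (fun τ => parTab (s₀ 0) (τ.getD 0 0) (τ.getD 1 0)) (fill 3 [20, 21] parCell s₀) := by
  refine holds_fill (by decide) (by decide) (by decide) (by decide) fun s h0 hfr hle hprev => ?_
  simp only [List.mem_cons, List.not_mem_nil, or_false, forall_eq_or_imp, forall_eq,
    List.map_cons, List.map_nil, List.length_cons, List.length_nil] at hle hprev ⊢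
  rw [parCell]
  generalize s 20 0 = i at *
  generalize s 21 0 = j at *
  obtain ⟨hi, hj⟩ := hle
  change _ = parTab (s₀ 0) i j
  rw [← h0]
  cases j with
  | zero => rw [parTab]; simp
  | succ j =>
    have := hprev [i, j] ⟨rfl, by simp; omega⟩ (by simp only [enc]; omega)
    simp [parTab, this, h0]

theorem look_par {s₀ s : State} (h3 : Holds 3 2 (fun τ => parTab (s₀ 0) (τ.getD 0 0) (τ.getD 1 0)) s₀)
    (h0 : s 0 = s₀ 0) (h : s 3 = s₀ 3) {i : ℕ} (hi : i ≤ s 0 0) :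
    look s 3 [i, s 0 0] = par (s 0) i := by
  have := h3.of_eq h0 h [i, s 0 0] ⟨rfl, by simp; omega⟩
  rw [this, par, h0]
  rfl

theorem holds_mayNext {s₀ : State}
    (h3 : Holds 3 2 (fun τ => parTab (s₀ 0) (τ.getD 0 0) (τ.getD 1 0)) s₀) :
    Holds 4 1 (fun τ => mayNext (s₀ 0) (τ.getD 0 0)) (fill 4 [20] mayCell s₀) := by
  refine holds_fill (by decide) (by decide) (by decide) (by decide) fun s h0 hfr hle hprev => ?_
  simp only [List.mem_cons, List.not_mem_nil, or_false, forall_eq,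
    List.map_cons, List.map_nil] at hle ⊢
  rw [mayCell]
  generalize s 20 0 = i at *
  rw [look_par h3 h0 (hfr 3 (by decide) (by decide)) hle]
  change _ = mayNext (s₀ 0) i
  rw [← h0]
  rfl

theorem mayNext_le (σ : ℕ → ℕ) (i : ℕ) : mayNext σ i ≤ σ 0 := by
  rw [mayNext]
  split_ifs
  · exact par_le _
  · exact le_rfl

theorem iterate_le {f : ℕ → ℕ} {n i : ℕ} (hf : ∀ i, f i ≤ n) (hi : i ≤ n) (e : ℕ) :
    f^[e] i ≤ n := by
  cases e with
  | zero => exact hi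
  | succ e => rw [Function.iterate_succ_apply']; exact hf _

/-- An iterate is itself used as a table index, so it has to stay at most `n`; coding a missing
successor by `n` and running the loops up to `n` inclusive guarantees this. -/
theorem holds_walk {s₀ : State} (h4 : Holds 4 1 (fun τ => mayNext (s₀ 0) (τ.getD 0 0)) s₀) :
    Holds 5 2 (fun τ => (mayNext (s₀ 0))^[τ.getD 1 0] (τ.getD 0 0))
      (fill 5 [20, 21] walkCell s₀) := by
  refine holds_fill (by decide) (by decide) (by decide) (by decide) fun s h0 hfr hle hprev => ?_
  simp only [List.mem_cons, List.not_mem_nil, or_false, forall_eq_or_imp, forall_eq,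
    List.map_cons, List.map_nil, List.length_cons, List.length_nil] at hle hprev ⊢
  rw [walkCell]
  generalize s 20 0 = i at *
  generalize s 21 0 = e at *
  obtain ⟨hi, he⟩ := hle
  change _ = (mayNext (s₀ 0))^[e] i
  cases e with
  | zero => simp
  | succ e =>
    have h1 : look s 5 [i, e] = (mayNext (s₀ 0))^[e] i :=
      hprev [i, e] ⟨rfl, by simp; omega⟩ (by simp only [enc]; omega)
    have h2 : (mayNext (s₀ 0))^[e] i ≤ s 0 0 :=
      iterate_le (by rw [h0]; exact mayNext_le _) hi e
    have h3 : look s 4 [(mayNext (s₀ 0))^[e] i] = mayNext (s₀ 0) ((mayNext (s₀ 0))^[e] i) :=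
      h4.of_eq h0 (hfr 4 (by decide) (by decide)) _ ⟨rfl, by simpa using h2⟩
    rw [if_neg (Nat.succ_ne_zero e), Nat.add_sub_cancel, h1, h3, Function.iterate_succ_apply']

theorem holds_hits {s₀ : State}
    (h5 : Holds 5 2 (fun τ => (mayNext (s₀ 0))^[τ.getD 1 0] (τ.getD 0 0)) s₀) :
    Holds 6 3 (fun τ => hits (s₀ 0) (τ.getD 0 0) (τ.getD 1 0) (τ.getD 2 0))
      (fill 6 [20, 21, 22] hitsCell s₀) := by
  refine holds_fill (by decide) (by decide) (by decide) (by decide) fun s h0 hfr hle hprev => ?_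
  simp only [List.mem_cons, List.not_mem_nil, or_false, forall_eq_or_imp, forall_eq,
    List.map_cons, List.map_nil, List.length_cons, List.length_nil] at hle hprev ⊢
  rw [hitsCell]
  generalize s 20 0 = j at *
  generalize s 21 0 = i at *
  generalize s 22 0 = e at *
  obtain ⟨hj, hi, he⟩ := hle
  change _ = hits (s₀ 0) j i e
  have h1 : look s 5 [i, e] = (mayNext (s₀ 0))^[e] i :=
    h5.of_eq h0 (hfr 5 (by decide) (by decide)) [i, e] ⟨rfl, by simp; omega⟩
  rw [h1]
  cases e with
  | zero => simp [hits, -Finset.sum_boole]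
  | succ e =>
    have h2 : look s 6 [j, i, e] = hits (s₀ 0) j i e :=
      hprev [j, i, e] ⟨rfl, by simp; omega⟩ (by simp only [enc]; omega)
    rw [if_neg (Nat.succ_ne_zero e), Nat.add_sub_cancel, h2, hits, hits,
      Finset.sum_range_succ _ (e + 1)]

theorem holds_backers {s₀ : State}
    (h6 : Holds 6 3 (fun τ => hits (s₀ 0) (τ.getD 0 0) (τ.getD 1 0) (τ.getD 2 0)) s₀) :
    Holds 7 2 (fun τ => backers (s₀ 0) (τ.getD 0 0) (τ.getD 1 0))
      (fill 7 [20, 21] backersCell s₀) := by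
  refine holds_fill (by decide) (by decide) (by decide) (by decide) fun s h0 hfr hle hprev => ?_
  simp only [List.mem_cons, List.not_mem_nil, or_false, forall_eq_or_imp, forall_eq,
    List.map_cons, List.map_nil, List.length_cons, List.length_nil] at hle hprev ⊢
  rw [backersCell]
  generalize s 20 0 = j at *
  generalize s 21 0 = i at *
  obtain ⟨hj, hi⟩ := hle
  change _ = backers (s₀ 0) j i
  have h1 : look s 6 [j, i, s 0 0] = hits (s₀ 0) j i (s 0 0) :=
    h6.of_eq h0 (hfr 6 (by decide) (by decide)) [j, i, s 0 0] ⟨rfl, by simp; omega⟩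
  rw [h1, h0]
  cases i with
  | zero => simp [backers, -Finset.sum_boole]
  | succ i =>
    have h2 : look s 7 [j, i] = backers (s₀ 0) j i :=
      hprev [j, i] ⟨rfl, by simp; omega⟩ (by simp only [enc]; omega)
    rw [if_neg (Nat.succ_ne_zero i), Nat.add_sub_cancel, h2, backers, backers,
      Finset.sum_range_succ _ (i + 1)]

theorem holds_dearNext {s₀ : State}
    (h3 : Holds 3 2 (fun τ => parTab (s₀ 0) (τ.getD 0 0) (τ.getD 1 0)) s₀) :
    Holds 8 1 (fun τ => dearNext (s₀ 0) (τ.getD 0 0)) (fill 8 [20] dearCell s₀) := by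
  refine holds_fill (by decide) (by decide) (by decide) (by decide) fun s h0 hfr hle hprev => ?_
  simp only [List.mem_cons, List.not_mem_nil, or_false, forall_eq,
    List.map_cons, List.map_nil] at hle ⊢
  rw [dearCell]
  generalize s 20 0 = i at *
  rw [look_par h3 h0 (hfr 3 (by decide) (by decide)) hle]
  change _ = dearNext (s₀ 0) i
  rw [← h0]
  rfl

theorem dearNext_le {σ : ℕ → ℕ} (hx : σ 1 ≤ σ 0) (i : ℕ) : dearNext σ i ≤ σ 0 := by
  rw [dearNext]
  split_ifs
  · exact hx
  · exact par_le _
  · exact le_rfl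

theorem holds_chain {s₀ : State} (hx : s₀ 0 1 ≤ s₀ 0 0)
    (h3 : Holds 3 2 (fun τ => parTab (s₀ 0) (τ.getD 0 0) (τ.getD 1 0)) s₀)
    (h8 : Holds 8 1 (fun τ => dearNext (s₀ 0) (τ.getD 0 0)) s₀) :
    Holds 9 1 (fun τ => (dearNext (s₀ 0))^[τ.getD 0 0] (par (s₀ 0) (s₀ 0 1)))
      (fill 9 [20] chainCell s₀) := by
  refine holds_fill (by decide) (by decide) (by decide) (by decide) fun s h0 hfr hle hprev => ?_
  simp only [List.mem_cons, List.not_mem_nil, or_false, forall_eq,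
    List.map_cons, List.map_nil, List.length_cons, List.length_nil] at hle hprev ⊢
  rw [chainCell]
  generalize s 20 0 = e at *
  rw [look_par h3 h0 (hfr 3 (by decide) (by decide)) (by rwa [h0])]
  change _ = (dearNext (s₀ 0))^[e] (par (s₀ 0) (s₀ 0 1))
  cases e with
  | zero => simp [h0]
  | succ e =>
    have h1 : look s 9 [e] = (dearNext (s₀ 0))^[e] (par (s₀ 0) (s₀ 0 1)) :=
      hprev [e] ⟨rfl, by simp; omega⟩ (by simp only [enc]; omega)
    have h2 : (dearNext (s₀ 0))^[e] (par (s₀ 0) (s₀ 0 1)) ≤ s 0 0 := by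
      rw [h0]
      exact iterate_le (dearNext_le hx) (par_le _) e
    have h3 : look s 8 [(dearNext (s₀ 0))^[e] (par (s₀ 0) (s₀ 0 1))] =
        dearNext (s₀ 0) ((dearNext (s₀ 0))^[e] (par (s₀ 0) (s₀ 0 1))) :=
      h8.of_eq h0 (hfr 8 (by decide) (by decide)) _ ⟨rfl, by simpa using h2⟩
    rw [if_neg (Nat.succ_ne_zero e), Nat.add_sub_cancel, h1, h3, Function.iterate_succ_apply']

theorem holds_extra {s₀ : State} (hx : s₀ 0 1 ≤ s₀ 0 0)
    (h3 : Holds 3 2 (fun τ => parTab (s₀ 0) (τ.getD 0 0) (τ.getD 1 0)) s₀)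
    (h7 : Holds 7 2 (fun τ => backers (s₀ 0) (τ.getD 0 0) (τ.getD 1 0)) s₀) :
    Holds 10 3 (fun τ => extra (s₀ 0) (τ.getD 0 0) (τ.getD 1 0) (τ.getD 2 0))
      (fill 10 [20, 21, 22] extraCell s₀) := by
  refine holds_fill (by decide) (by decide) (by decide) (by decide) fun s h0 hfr hle hprev => ?_
  simp only [List.mem_cons, List.not_mem_nil, or_false, forall_eq_or_imp, forall_eq,
    List.map_cons, List.map_nil] at hle ⊢
  rw [extraCell]
  generalize s 20 0 = μ at *
  generalize s 21 0 = t at *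
  generalize s 22 0 = j at *
  obtain ⟨hμ, ht, hj⟩ := hle
  change _ = extra (s₀ 0) μ t j
  have h1 : look s 7 [j, s 0 0] = backers (s₀ 0) j (s 0 0) :=
    h7.of_eq h0 (hfr 7 (by decide) (by decide)) [j, s 0 0] ⟨rfl, by simp; omega⟩
  rw [look_par h3 h0 (hfr 3 (by decide) (by decide)) (by rwa [h0]), h1, h0]
  rfl

theorem holds_need {s₀ : State}
    (h10 : Holds 10 3 (fun τ => extra (s₀ 0) (τ.getD 0 0) (τ.getD 1 0) (τ.getD 2 0)) s₀) :
    Holds 11 3 (fun τ => need (s₀ 0) (τ.getD 0 0) (τ.getD 1 0) (τ.getD 2 0))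
      (fill 11 [20, 21, 22] needCell s₀) := by
  refine holds_fill (by decide) (by decide) (by decide) (by decide) fun s h0 hfr hle hprev => ?_
  simp only [List.mem_cons, List.not_mem_nil, or_false, forall_eq_or_imp, forall_eq,
    List.map_cons, List.map_nil, List.length_cons, List.length_nil] at hle hprev ⊢
  rw [needCell]
  generalize s 20 0 = μ at *
  generalize s 21 0 = t at *
  generalize s 22 0 = j at *
  obtain ⟨hμ, ht, hj⟩ := hle
  change _ = need (s₀ 0) μ t j
  have h1 : look s 10 [μ, t, j] = extra (s₀ 0) μ t j :=
    h10.of_eq h0 (hfr 10 (by decide) (by decide)) [μ, t, j] ⟨rfl, by simp; omega⟩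
  rw [h1]
  cases j with
  | zero => simp [need]
  | succ j =>
    have h2 : look s 11 [μ, t, j] = need (s₀ 0) μ t j :=
      hprev [μ, t, j] ⟨rfl, by simp; omega⟩ (by simp only [enc]; omega)
    rw [if_neg (Nat.succ_ne_zero j), Nat.add_sub_cancel, h2, need, need,
      Finset.sum_range_succ _ (j + 1), add_assoc]

/-- A knapsack value is the last of its running maxima. Keeping the bound `c` of the maximum apart
from the budget `b` gives each running maximum its own cell, computed with a bounded number of
lookups. -/
theorem knapsack_eq_knapTab (σ : ℕ → ℕ) (μ t m v u b : ℕ) :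
    knapsack (gain σ μ t m v) u b = knapTab σ μ t m v u b b := by
  cases u with
  | zero => simp [knapsack, knapTab]
  | succ u => simp [knapsack, knapTab]

theorem best_succ (σ : ℕ → ℕ) (μ t m v b : ℕ) : best σ μ t (m + 1) v b =
    if ct σ v ≤ b then wt σ μ t v + knapTab σ μ t m v (σ 0) (b - ct σ v) (b - ct σ v) else 0 := by
  rw [← knapsack_eq_knapTab]
  rfl

theorem ct_eq (σ : ℕ → ℕ) (v : ℕ) : ct σ v = 1 - rg σ v := by
  rw [ct]
  split_ifs <;> omega

theorem enc_lt_of_third_lt {B μ t m m' a₁ a₂ a₃ a₄ b₁ b₂ b₃ b₄ : ℕ} (hm : m' < m) (h₁ : a₁ < B)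
    (h₂ : a₂ < B) (h₃ : a₃ < B) (h₄ : a₄ < B) :
    enc B 0 [μ, t, m', a₁, a₂, a₃, a₄] < enc B 0 [μ, t, m, b₁, b₂, b₃, b₄] := by
  have h : ∀ τ, enc B 0 (μ :: t :: τ) = enc B ((0 * B + μ) * B + t) τ := fun _ => rfl
  rw [h, h]
  exact enc_cons_lt hm rfl (by simp [h₁, h₂, h₃, h₄])

theorem enc_lt_of_fifth_lt {B μ t m v u u' a₁ a₂ b₁ b₂ : ℕ} (hu : u' < u) (h₁ : a₁ < B)
    (h₂ : a₂ < B) : enc B 0 [μ, t, m, v, u', a₁, a₂] < enc B 0 [μ, t, m, v, u, b₁, b₂] := by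
  have h : ∀ τ, enc B 0 (μ :: t :: m :: v :: τ) =
      enc B ((((0 * B + μ) * B + t) * B + m) * B + v) τ := fun _ => rfl
  rw [h, h]
  exact enc_cons_lt hu rfl (by simp [h₁, h₂])

theorem enc_lt_of_last_lt {B μ t m v u b c c' : ℕ} (hc : c' < c) :
    enc B 0 [μ, t, m, v, u, b, c'] < enc B 0 [μ, t, m, v, u, b, c] := by
  simp only [enc]
  exact Nat.add_lt_add_left hc _

/-- The three lookups go to lexicographically earlier cells: the previous child has smaller `u`, the
branch below `u` has smaller `m`, and the previous maximum has smaller `c`. The later indices may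
increase. -/
theorem knapTab_step {σ : ℕ → ℕ} {μ t m v u b c : ℕ} {L : ℕ → ℕ → ℕ → ℕ → ℕ → ℕ} {E : ℕ → ℕ}
    (hm : m ≤ σ 0) (hv : v ≤ σ 0) (hu : u ≤ σ 0) (hb : b ≤ σ 0) (hc : c ≤ σ 0)
    (hE : ∀ u ≤ σ 0, E u = extra σ μ t u)
    (hL : ∀ m' v' u' b' c', m' ≤ σ 0 → v' ≤ σ 0 → u' ≤ σ 0 → b' ≤ σ 0 → c' ≤ σ 0 →
      enc (σ 0 + 1) 0 [μ, t, m', v', u', b', c'] < enc (σ 0 + 1) 0 [μ, t, m, v, u, b, c] →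
      L m' v' u' b' c' = knapTab σ μ t m' v' u' b' c') :
    (if c = 0 then
      (if u = 0 then 0 else L m v (u - 1) (b - c) (b - c)) +
        if u < σ 0 ∧ u ≠ σ 1 ∧ dc σ u < vc σ u ∧ par σ u = v ∧
            (μ ≠ 0 ∨ vc σ (σ 1) < dc σ (σ 1) ∨ u ≠ par σ (σ 1)) then
          if m = 0 then 0 else
            if 1 - rg σ u ≤ c then
              (1 + E u) + L (m - 1) u (σ 0) (c - (1 - rg σ u)) (c - (1 - rg σ u))
            else 0
        else 0
    else max (L m v u b (c - 1))
      ((if u = 0 then 0 else L m v (u - 1) (b - c) (b - c)) +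
        if u < σ 0 ∧ u ≠ σ 1 ∧ dc σ u < vc σ u ∧ par σ u = v ∧
            (μ ≠ 0 ∨ vc σ (σ 1) < dc σ (σ 1) ∨ u ≠ par σ (σ 1)) then
          if m = 0 then 0 else
            if 1 - rg σ u ≤ c then
              (1 + E u) + L (m - 1) u (σ 0) (c - (1 - rg σ u)) (c - (1 - rg σ u))
            else 0
        else 0)) = knapTab σ μ t m v u b c := by
  have hprev : (if u = 0 then 0 else L m v (u - 1) (b - c) (b - c)) =
      if u = 0 then 0 else knapsack (gain σ μ t m v) (u - 1) (b - c) := by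
    split_ifs with hu0
    · rfl
    · rw [knapsack_eq_knapTab]
      exact hL _ _ _ _ _ hm hv (by omega) (by omega) (by omega)
        (enc_lt_of_fifth_lt (by omega) (by omega) (by omega))
  have hgain : (if u < σ 0 ∧ u ≠ σ 1 ∧ dc σ u < vc σ u ∧ par σ u = v ∧
            (μ ≠ 0 ∨ vc σ (σ 1) < dc σ (σ 1) ∨ u ≠ par σ (σ 1)) then
          if m = 0 then 0 else
            if 1 - rg σ u ≤ c then
              (1 + E u) + L (m - 1) u (σ 0) (c - (1 - rg σ u)) (c - (1 - rg σ u))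
            else 0
        else 0) = gain σ μ t m v u c := by
    rw [gain]
    refine if_congr Iff.rfl ?_ rfl
    cases m with
    | zero => rfl
    | succ m =>
      rw [if_neg (Nat.succ_ne_zero m), best_succ, ct_eq, Nat.add_sub_cancel, hE u hu, wt,
        hL m u (σ 0) _ _ (by omega) hu le_rfl (by omega) (by omega)
          (enc_lt_of_third_lt (by omega) (by omega) (by omega) (by omega) (by omega))]
  rw [hprev, hgain]
  cases c with
  | zero => simp [knapTab, runMax]
  | succ c =>
    rw [if_neg (Nat.succ_ne_zero c), Nat.add_sub_cancel,
      hL m v u b c hm hv hu hb (by omega) (enc_lt_of_last_lt (by omega))]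
    simp only [knapTab, runMax]

theorem holds_knapTab {s₀ : State} (hx : s₀ 0 1 ≤ s₀ 0 0)
    (h3 : Holds 3 2 (fun τ => parTab (s₀ 0) (τ.getD 0 0) (τ.getD 1 0)) s₀)
    (h10 : Holds 10 3 (fun τ => extra (s₀ 0) (τ.getD 0 0) (τ.getD 1 0) (τ.getD 2 0)) s₀) :
    Holds 12 7 (fun τ => knapTab (s₀ 0) (τ.getD 0 0) (τ.getD 1 0) (τ.getD 2 0) (τ.getD 3 0)
      (τ.getD 4 0) (τ.getD 5 0) (τ.getD 6 0))
      (fill 12 [20, 21, 22, 23, 24, 25, 26] knapCell s₀) := by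
  refine holds_fill (by decide) (by decide) (by decide) (by decide) fun s h0 hfr hle hprev => ?_
  simp only [List.mem_cons, List.not_mem_nil, or_false, forall_eq_or_imp, forall_eq,
    List.map_cons, List.map_nil, List.length_cons, List.length_nil] at hle hprev ⊢
  rw [knapCell, gainCell]
  generalize s 20 0 = μ at *
  generalize s 21 0 = t at *
  generalize s 22 0 = m at *
  generalize s 23 0 = v at *
  generalize s 24 0 = u at *
  generalize s 25 0 = b at *
  generalize s 26 0 = c at *
  obtain ⟨hμ, ht, hm, hv, hu, hb, hc⟩ := hle
  change _ = knapTab (s₀ 0) μ t m v u b c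
  have hbank3 := hfr 3 (by decide) (by decide)
  have hext : ∀ u ≤ s 0 0, look s 10 [μ, t, u] = extra (s 0) μ t u := fun u hu => by
    rw [h10.of_eq h0 (hfr 10 (by decide) (by decide)) [μ, t, u] ⟨rfl, by simp; omega⟩, h0]
    rfl
  have h12 : ∀ m' v' u' b' c', m' ≤ s 0 0 → v' ≤ s 0 0 → u' ≤ s 0 0 → b' ≤ s 0 0 → c' ≤ s 0 0 →
      enc (s 0 0 + 1) 0 [μ, t, m', v', u', b', c'] < enc (s 0 0 + 1) 0 [μ, t, m, v, u, b, c] →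
      look s 12 [μ, t, m', v', u', b', c'] = knapTab (s 0) μ t m' v' u' b' c' := by
    intro m' v' u' b' c' hm' hv' hu' hb' hc' hlt
    rw [hprev [μ, t, m', v', u', b', c'] ⟨rfl, by simp; omega⟩ hlt, h0]
    rfl
  rw [look_par h3 h0 hbank3 hu, look_par h3 h0 hbank3 (by rwa [h0]), ← h0]
  exact knapTab_step (L := fun m' v' u' b' c' => look s 12 [μ, t, m', v', u', b', c'])
    (E := fun u => look s 10 [μ, t, u]) hm hv hu hb hc hext h12

theorem holds_successes {s₀ : State} (hx : s₀ 0 1 ≤ s₀ 0 0)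
    (h3 : Holds 3 2 (fun τ => parTab (s₀ 0) (τ.getD 0 0) (τ.getD 1 0)) s₀)
    (h9 : Holds 9 1 (fun τ => (dearNext (s₀ 0))^[τ.getD 0 0] (par (s₀ 0) (s₀ 0 1))) s₀)
    (h10 : Holds 10 3 (fun τ => extra (s₀ 0) (τ.getD 0 0) (τ.getD 1 0) (τ.getD 2 0)) s₀)
    (h11 : Holds 11 3 (fun τ => need (s₀ 0) (τ.getD 0 0) (τ.getD 1 0) (τ.getD 2 0)) s₀)
    (h12 : Holds 12 7 (fun τ => knapTab (s₀ 0) (τ.getD 0 0) (τ.getD 1 0) (τ.getD 2 0) (τ.getD 3 0)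
      (τ.getD 4 0) (τ.getD 5 0) (τ.getD 6 0)) s₀) :
    Holds 13 2 (fun τ => successes (s₀ 0) (τ.getD 0 0) (τ.getD 1 0))
      (fill 13 [20, 21] successCell s₀) := by
  refine holds_fill (by decide) (by decide) (by decide) (by decide) fun s h0 hfr hle hprev => ?_
  simp only [List.mem_cons, List.not_mem_nil, or_false, forall_eq_or_imp, forall_eq,
    List.map_cons, List.map_nil, List.length_cons, List.length_nil] at hle hprev ⊢
  rw [successCell]
  generalize s 20 0 = μ at *
  generalize s 21 0 = t at *
  obtain ⟨hμ, ht⟩ := hle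
  change _ = successes (s₀ 0) μ t
  rw [← h0] at hx
  have e9 : look s 9 [s 0 0] = (dearNext (s 0))^[s 0 0] (par (s 0) (s 0 1)) := by
    rw [h9.of_eq h0 (hfr 9 (by decide) (by decide)) [s 0 0] ⟨rfl, by simp⟩, h0]
    rfl
  have e10 : look s 10 [μ, t, s 0 1] = extra (s 0) μ t (s 0 1) := by
    rw [h10.of_eq h0 (hfr 10 (by decide) (by decide)) [μ, t, s 0 1] ⟨rfl, by simp; omega⟩, h0]
    rfl
  have e11 : look s 11 [μ, t, s 0 0] = need (s 0) μ t (s 0 0) := by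
    rw [h11.of_eq h0 (hfr 11 (by decide) (by decide)) [μ, t, s 0 0] ⟨rfl, by simp; omega⟩, h0]
    rfl
  have e12 : ∀ b ≤ s 0 0, look s 12 [μ, t, s 0 0, s 0 1, s 0 0, b, b] =
      knapTab (s 0) μ t (s 0 0) (s 0 1) (s 0 0) b b := fun b hb => by
    rw [h12.of_eq h0 (hfr 12 (by decide) (by decide)) [μ, t, s 0 0, s 0 1, s 0 0, b, b]
      ⟨rfl, by simp; omega⟩, h0]
    rfl
  have hind : (if (μ ≠ 0 ∧ look s 9 [s 0 0] = s 0 1) ∨ (μ = 0 ∧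
        (vc (s 0) (s 0 1) < dc (s 0) (s 0 1) ∨ look s 3 [s 0 1, s 0 0] = s 0 0 ∨
          rg (s 0) (look s 3 [s 0 1, s 0 0]) = 0)) then
      if 1 - rg (s 0) (s 0 1) ≤ s 0 2 - (s 0 2 - s 0 0) then
        if look s 11 [μ, t, s 0 0] ≤ (1 + look s 10 [μ, t, s 0 1]) +
          look s 12 [μ, t, s 0 0, s 0 1, s 0 0, s 0 2 - (s 0 2 - s 0 0) - (1 - rg (s 0) (s 0 1)),
            s 0 2 - (s 0 2 - s 0 0) - (1 - rg (s 0) (s 0 1))] then 1 else 0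
      else if look s 11 [μ, t, s 0 0] ≤ 0 then 1 else 0
    else 0) = if Adm (s 0) μ ∧ need (s 0) μ t (s 0 0) ≤
        best (s 0) μ t (s 0 0 + 1) (s 0 1) (s 0 2 - (s 0 2 - s 0 0)) then 1 else 0 := by
    rw [look_par h3 h0 (hfr 3 (by decide) (by decide)) hx, e9, e10, e11, e12 _ (by omega),
      best_succ, ct_eq, wt, ite_and]
    refine if_congr Iff.rfl ?_ rfl
    split_ifs <;> rfl
  rw [hind, h0]
  cases t with
  | zero => simp [successes, -Finset.sum_boole]
  | succ t =>
    have h2 : look s 13 [μ, t] = successes (s₀ 0) μ t :=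
      hprev [μ, t] ⟨rfl, by simp; omega⟩ (by simp only [enc]; omega)
    rw [if_neg (Nat.succ_ne_zero t), Nat.add_sub_cancel, h2, successes, successes,
      Finset.sum_range_succ _ (t + 1)]

theorem _root_.RAM.Holds.fill {T r T' : ℕ} {F : List ℕ → ℕ} {as : List ℕ} {φ : State → ℕ}
    {s : State} (h : Holds T r F s) (hT : T ≠ T') (ha : T ∉ as) (h0 : 0 ≠ T') (h0a : 0 ∉ as) :
    Holds T r F (fill T' as φ s) :=
  h.of_eq (fill_bank h0 h0a _ _) (fill_bank hT ha _ _)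

/-- Fill all tables. -/
def tables (s : State) : State :=
  fill 13 [20, 21] successCell <| fill 12 [20, 21, 22, 23, 24, 25, 26] knapCell <|
  fill 11 [20, 21, 22] needCell <| fill 10 [20, 21, 22] extraCell <| fill 9 [20] chainCell <|
  fill 8 [20] dearCell <| fill 7 [20, 21] backersCell <| fill 6 [20, 21, 22] hitsCell <|
  fill 5 [20, 21] walkCell <| fill 4 [20] mayCell <| fill 3 [20, 21] parCell s

theorem tables_bank_zero (s : State) : tables s 0 = s 0 := by
  simp only [tables]
  repeat rw [fill_bank (by decide) (by decide)]

theorem polyTime_tables : PolyTime tables := by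
  obtain ⟨h₃, h₄, h₅, h₆, h₇, h₈, h₉, h₁₀, h₁₁, h₁₂, h₁₃, -⟩ := isTree_cells
  have h : ∀ T as φ, T ≠ 0 → T ∉ as → 0 ∉ as → as.Nodup → IsTree φ → ∀ {f : State → State},
      PolyTime f → PolyTime (fun s => fill T as φ (f s)) :=
    fun T as φ h1 h2 h3 h4 h5 f hf => (PolyTime.fill h1 h2 h3 h4 h5).comp hf
  refine h 13 _ _ (by decide) (by decide) (by decide) (by decide) h₁₃ ?_
  refine h 12 _ _ (by decide) (by decide) (by decide) (by decide) h₁₂ ?_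
  refine h 11 _ _ (by decide) (by decide) (by decide) (by decide) h₁₁ ?_
  refine h 10 _ _ (by decide) (by decide) (by decide) (by decide) h₁₀ ?_
  refine h 9 _ _ (by decide) (by decide) (by decide) (by decide) h₉ ?_
  refine h 8 _ _ (by decide) (by decide) (by decide) (by decide) h₈ ?_
  refine h 7 _ _ (by decide) (by decide) (by decide) (by decide) h₇ ?_
  refine h 6 _ _ (by decide) (by decide) (by decide) (by decide) h₆ ?_
  refine h 5 _ _ (by decide) (by decide) (by decide) (by decide) h₅ ?_
  refine h 4 _ _ (by decide) (by decide) (by decide) (by decide) h₄ ?_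
  exact PolyTime.fill (by decide) (by decide) (by decide) (by decide) h₃

theorem holds_tables {s : State} (hx : s 0 1 ≤ s 0 0) :
    Holds 13 2 (fun τ => successes (s 0) (τ.getD 0 0) (τ.getD 1 0)) (tables s) := by
  rw [tables]
  have h3 := holds_parTab s
  have e1 : fill 3 [20, 21] parCell s 0 = s 0 := fill_bank (by decide) (by decide) _ _
  generalize fill 3 [20, 21] parCell s = s₁ at *
  rw [← e1] at h3 hx ⊢
  clear e1
  have h4 := holds_mayNext h3
  replace h3 := h3.fill (T' := 4) (as := [20]) (φ := mayCell)
    (by decide) (by decide) (by decide) (by decide)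
  have e2 : fill 4 [20] mayCell s₁ 0 = s₁ 0 := fill_bank (by decide) (by decide) _ _
  generalize fill 4 [20] mayCell s₁ = s₂ at *
  rw [← e2] at h3 h4 hx ⊢
  clear e2
  have h5 := holds_walk h4
  replace h3 := h3.fill (T' := 5) (as := [20, 21]) (φ := walkCell)
    (by decide) (by decide) (by decide) (by decide)
  have e3 : fill 5 [20, 21] walkCell s₂ 0 = s₂ 0 := fill_bank (by decide) (by decide) _ _
  generalize fill 5 [20, 21] walkCell s₂ = s₃ at *
  rw [← e3] at h3 h5 hx ⊢
  clear e3 h4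
  have h6 := holds_hits h5
  replace h3 := h3.fill (T' := 6) (as := [20, 21, 22]) (φ := hitsCell)
    (by decide) (by decide) (by decide) (by decide)
  have e4 : fill 6 [20, 21, 22] hitsCell s₃ 0 = s₃ 0 := fill_bank (by decide) (by decide) _ _
  generalize fill 6 [20, 21, 22] hitsCell s₃ = s₄ at *
  rw [← e4] at h3 h6 hx ⊢
  clear e4 h5
  have h7 := holds_backers h6
  replace h3 := h3.fill (T' := 7) (as := [20, 21]) (φ := backersCell)
    (by decide) (by decide) (by decide) (by decide)
  have e5 : fill 7 [20, 21] backersCell s₄ 0 = s₄ 0 := fill_bank (by decide) (by decide) _ _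
  generalize fill 7 [20, 21] backersCell s₄ = s₅ at *
  rw [← e5] at h3 h7 hx ⊢
  clear e5 h6
  have h8 := holds_dearNext h3
  replace h3 := h3.fill (T' := 8) (as := [20]) (φ := dearCell)
    (by decide) (by decide) (by decide) (by decide)
  replace h7 := h7.fill (T' := 8) (as := [20]) (φ := dearCell)
    (by decide) (by decide) (by decide) (by decide)
  have e6 : fill 8 [20] dearCell s₅ 0 = s₅ 0 := fill_bank (by decide) (by decide) _ _
  generalize fill 8 [20] dearCell s₅ = s₆ at *
  rw [← e6] at h3 h7 h8 hx ⊢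
  clear e6
  have h9 := holds_chain hx h3 h8
  replace h3 := h3.fill (T' := 9) (as := [20]) (φ := chainCell)
    (by decide) (by decide) (by decide) (by decide)
  replace h7 := h7.fill (T' := 9) (as := [20]) (φ := chainCell)
    (by decide) (by decide) (by decide) (by decide)
  have e7 : fill 9 [20] chainCell s₆ 0 = s₆ 0 := fill_bank (by decide) (by decide) _ _
  generalize fill 9 [20] chainCell s₆ = s₇ at *
  rw [← e7] at h3 h7 h9 hx ⊢
  clear e7 h8
  have h10 := holds_extra hx h3 h7
  replace h3 := h3.fill (T' := 10) (as := [20, 21, 22]) (φ := extraCell)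
    (by decide) (by decide) (by decide) (by decide)
  replace h9 := h9.fill (T' := 10) (as := [20, 21, 22]) (φ := extraCell)
    (by decide) (by decide) (by decide) (by decide)
  have e8 : fill 10 [20, 21, 22] extraCell s₇ 0 = s₇ 0 := fill_bank (by decide) (by decide) _ _
  generalize fill 10 [20, 21, 22] extraCell s₇ = s₈ at *
  rw [← e8] at h3 h9 h10 hx ⊢
  clear e8 h7
  have h11 := holds_need h10
  replace h3 := h3.fill (T' := 11) (as := [20, 21, 22]) (φ := needCell)
    (by decide) (by decide) (by decide) (by decide)
  replace h9 := h9.fill (T' := 11) (as := [20, 21, 22]) (φ := needCell)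
    (by decide) (by decide) (by decide) (by decide)
  replace h10 := h10.fill (T' := 11) (as := [20, 21, 22]) (φ := needCell)
    (by decide) (by decide) (by decide) (by decide)
  have e9 : fill 11 [20, 21, 22] needCell s₈ 0 = s₈ 0 := fill_bank (by decide) (by decide) _ _
  generalize fill 11 [20, 21, 22] needCell s₈ = s₉ at *
  rw [← e9] at h3 h9 h10 h11 hx ⊢
  clear e9
  have h12 := holds_knapTab hx h3 h10
  replace h3 := h3.fill (T' := 12) (as := [20, 21, 22, 23, 24, 25, 26]) (φ := knapCell)
    (by decide) (by decide) (by decide) (by decide)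
  replace h9 := h9.fill (T' := 12) (as := [20, 21, 22, 23, 24, 25, 26]) (φ := knapCell)
    (by decide) (by decide) (by decide) (by decide)
  replace h10 := h10.fill (T' := 12) (as := [20, 21, 22, 23, 24, 25, 26]) (φ := knapCell)
    (by decide) (by decide) (by decide) (by decide)
  replace h11 := h11.fill (T' := 12) (as := [20, 21, 22, 23, 24, 25, 26]) (φ := knapCell)
    (by decide) (by decide) (by decide) (by decide)
  have e10 : fill 12 [20, 21, 22, 23, 24, 25, 26] knapCell s₉ 0 = s₉ 0 :=
    fill_bank (by decide) (by decide) _ _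
  generalize fill 12 [20, 21, 22, 23, 24, 25, 26] knapCell s₉ = s₁₀ at *
  rw [← e10] at h3 h9 h10 h11 h12 hx ⊢
  exact holds_successes hx h3 h9 h10 h11 h12

/-- Fill all tables and store the answer. -/
def solve (s : State) : State := (tables s).update 2 0 (answerCell (tables s))

theorem polyTime_solve : PolyTime solve :=
  (PolyTime.writeTree (by decide) (.lit 0) isTree_cells.2.2.2.2.2.2.2.2.2.2.2).comp
    polyTime_tables

/-- The mode `1` is a table index, so it must not exceed `n`; this is the role of `hn`. -/
theorem solve_eq {s : State} (hn : 1 ≤ s 0 0) (hx : s 0 1 ≤ s 0 0) : solve s 2 0 =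
    if successes (s 0) 0 (s 0 0) + successes (s 0) 1 (s 0 0) ≠ 0 then 1 else 0 := by
  have h := holds_tables hx
  have h0 := tables_bank_zero s
  rw [solve, State.update_same, answerCell, h [0, tables s 0 0] ⟨rfl, by simp⟩,
    h [1, tables s 0 0] ⟨rfl, by simpa [h0] using hn⟩, h0]
  rfl

/-! ### The encoding -/

theorem getD_flatten {n : ℕ} (L : List (List ℕ)) (hL : ∀ l ∈ L, l.length = n) {i j : ℕ}
    (hj : j < n) : L.flatten.getD (i * n + j) 0 = (L.getD i []).getD j 0 := by
  induction L generalizing i with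
  | nil => simp
  | cons l L ih =>
    have hl := hL l List.mem_cons_self
    rw [List.flatten_cons]
    cases i with
    | zero =>
      rw [List.getD_append _ _ _ _ (by rw [hl]; omega)]
      simp
    | succ i =>
      rw [List.getD_append_right _ _ _ _ (by rw [hl, Nat.succ_mul]; omega), hl, Nat.succ_mul,
        List.getD_cons_succ, ← ih fun l hl => hL l (List.mem_cons_of_mem _ hl)]
      congr 1
      omega

theorem getD_ofFn {α : Type} {n : ℕ} (f : Fin n → α) (i : Fin n) (d : α) :
    (List.ofFn f).getD i d = f i := by
  rw [List.getD_eq_getElem _ _ (by simp)]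
  simp

theorem encodes_initial (I : CAVInstance) : Encodes (initial I.encode 0) I := by
  have hσ : ∀ i, initial I.encode 0 i = I.encode.getD i 0 := fun i => if_pos rfl
  have h0 : initial I.encode 0 0 = I.n := by rw [hσ]; rfl
  have hlen : I.encode = [I.n, (I.x : ℕ), I.k, I.β] ++
      (List.ofFn (fun i => if i ∈ I.registered then 1 else 0) ++ (List.ofFn I.G.v ++
      (List.ofFn I.G.d ++
      (List.ofFn (fun i => List.ofFn (fun j => if (i, j) ∈ I.G.E then 1 else 0))).flatten))) := by
    simp only [CAVInstance.encode, List.append_assoc]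
  have h4 : ∀ i, initial I.encode 0 (4 + i) =
      (List.ofFn (fun i => if i ∈ I.registered then 1 else 0) ++ (List.ofFn I.G.v ++
      (List.ofFn I.G.d ++ (List.ofFn (fun i => List.ofFn
        (fun j => if (i, j) ∈ I.G.E then 1 else 0))).flatten))).getD i 0 := by
    intro i
    rw [hσ, hlen, List.getD_append_right _ _ _ _ (by simp)]
    congr 1
    simp
  have h4n : ∀ i, initial I.encode 0 (4 + I.n + i) = (List.ofFn I.G.v ++ (List.ofFn I.G.d ++
      (List.ofFn (fun i => List.ofFn
        (fun j => if (i, j) ∈ I.G.E then 1 else 0))).flatten)).getD i 0 := by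
    intro i
    rw [add_assoc, h4, List.getD_append_right _ _ _ _ (by simp)]
    simp
  have h4nn : ∀ i, initial I.encode 0 (4 + I.n + I.n + i) = (List.ofFn I.G.d ++
      (List.ofFn (fun i => List.ofFn
        (fun j => if (i, j) ∈ I.G.E then 1 else 0))).flatten).getD i 0 := by
    intro i
    rw [add_assoc, h4n, List.getD_append_right _ _ _ _ (by simp)]
    simp
  have h4nnn : ∀ i, initial I.encode 0 (4 + I.n + I.n + I.n + i) =
      (List.ofFn (fun i => List.ofFn
        (fun j => if (i, j) ∈ I.G.E then 1 else 0))).flatten.getD i 0 := by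
    intro i
    rw [add_assoc, h4nn, List.getD_append_right _ _ _ _ (by simp)]
    simp
  refine ⟨h0, by rw [hσ]; rfl, by rw [hσ]; rfl, fun i => ?_, fun i => ?_, fun i => ?_,
    fun i j => ?_⟩
  · rw [rg, h4, List.getD_append _ _ _ _ (by simp), getD_ofFn]
    simp
  · rw [vc, h0, h4n, List.getD_append _ _ _ _ (by simp), getD_ofFn]
  · rw [dc, h0, h4nn, List.getD_append _ _ _ _ (by simp), getD_ofFn]
  · rw [ad, h0, add_assoc _ (_ * _), h4nnn, getD_flatten _ (by simp) j.2, getD_ofFn, getD_ofFn]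
    simp

end Algo

/-! ### From `PolyTime` functions to decision problems -/

namespace RAM

theorem length_le_inputSize (l : List ℕ) : l.length ≤ inputSize l := by
  induction l with
  | nil => simp
  | cons a l ih =>
    simp only [inputSize, List.map_cons, List.sum_cons, List.length_cons] at ih ⊢
    omega

theorem size_le_inputSize {l : List ℕ} {m : ℕ} (hm : m ∈ l) : Nat.size m ≤ inputSize l := by
  have := List.single_le_sum (l := l.map fun m => Nat.size m + 1) (by simp) _
    (List.mem_map_of_mem hm)
  exact (Nat.le_succ _).trans this

theorem size_le_self (m : ℕ) : Nat.size m ≤ m := Nat.size_le.2 Nat.lt_two_pow_self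

theorem bounded_initial (l : List ℕ) : Bounded (initial l) (inputSize l) := by
  intro a i
  rw [initial]
  split_ifs
  · by_cases hi : i < l.length
    · rw [List.getD_eq_getElem _ _ hi]
      exact size_le_inputSize (List.getElem_mem hi)
    · rw [List.getD_eq_default _ _ (by omega)]
      simp
  · exact (size_le_self _).trans (length_le_inputSize l)
  · simp

theorem eval_mono (p : Polynomial ℕ) {a b : ℕ} (h : a ≤ b) : p.eval a ≤ p.eval b := by
  rw [Polynomial.eval_eq_sum_range, Polynomial.eval_eq_sum_range]
  exact Finset.sum_le_sum fun i _ => Nat.mul_le_mul_left _ (Nat.pow_le_pow_left h i)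

/-- The time bound is polynomial in the number in cell `0`, not in its length. It becomes polynomial
in the input size because `hsize` bounds that number by the number of input entries. -/
theorem PolyTime.solvable {α : Type} {encode : α → List ℕ} {domain : Set α}
    {question : α → Prop} {f : State → State} (hf : PolyTime f)
    (hsize : ∀ I ∈ domain, initial (encode I) 0 0 ≤ (encode I).length)
    (hyes : ∀ I ∈ domain, question I → f (initial (encode I)) 2 0 = 1)
    (hno : ∀ I ∈ domain, ¬ question I → f (initial (encode I)) 2 0 = 0) :
    SolvableInPolyTime encode domain question := by
  obtain ⟨c, Q, hc⟩ := hf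
  refine ⟨c, Q * (.X + 1), fun I hI => ?_⟩
  obtain ⟨-, -, t, ht, htl⟩ := hc _ _ (bounded_initial (encode I))
  refine ⟨_, t, ht, htl.trans ?_, hyes I hI, hno I hI⟩
  rw [Polynomial.eval_mul, Polynomial.eval_add, Polynomial.eval_X, Polynomial.eval_one]
  exact Nat.mul_le_mul_right _
    (eval_mono Q ((hsize I hI).trans (length_le_inputSize _)))

end RAM

theorem mainTheorem8 :
    RAM.SolvableInPolyTime CAVInstance.encode
      {I : CAVInstance | I.G.maxOutDegree ≤ 1} CAVInstance.IsYes := by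
  refine Algo.polyTime_solve.solvable (fun I _ => ?_) (fun I hI h => ?_) (fun I hI h => ?_)
  · rw [(Algo.encodes_initial I).n_eq]
    -- The list contains blocks with one entry per voter, so its length is at least `n`.
    simp only [CAVInstance.encode, List.length_append, List.length_ofFn]
    omega
  all_goals
    have he := Algo.encodes_initial I
    have hx : RAM.initial I.encode 0 1 < RAM.initial I.encode 0 0 := by
      rw [he.x_eq, he.n_eq]
      exact I.x.2
    rw [Algo.solve_eq (by omega) hx.le]
    rw [he.isYes_iff (Election.functional_of_maxOutDegree_le_one hI)] at h
  · rw [if_pos h]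
  · rw [if_neg h]
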